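/- A graph is distance-hereditary if it has no induced house, hole (chordless cycle of length at least $5$), domino or gem, and it is m-decyclable if it has a matching $M$ such that $G-M$ is acyclic. All graphs are finite, simple and nonempty. The m-decyclable distance-hereditary graphs can be recognized in $O(n)$ time: there are a program for the unit-cost random access machine (with words of $O(\log n)$ bits) and a constant $c$ such that, for every graph $G$ on the vertex set $\{0,\dots,n-1\}$ with $n\ge 1$, given by adjacency lists (stored consecutively in memory, with $n$ and the starting address of each list, the neighbours in arbitrary order), the program halts after at most $c\,n$ steps, and it accepts if and only if $G$ is distance-hereditary and m-decyclable. In particular, it decides in $O(n)$ time whether a given distance-hereditary graph is m-decyclable. -/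

import Mathlib

/-! ### Graphs -/

/-- A graph is matching-decyclable if it has a matching `M` such that `G - M` is acyclic. -/
def MDecyclable {V : Type*} (G : SimpleGraph V) : Prop :=
  ∃ M : G.Subgraph, M.IsMatching ∧ (G.deleteEdges M.edgeSet).IsAcyclic

/-- The house: the square `0 1 2 3` with the roof `4` over the edge `01`. -/
def houseGraph : SimpleGraph (Fin 5) :=
  SimpleGraph.fromEdgeSet {s(0, 1), s(1, 2), s(2, 3), s(0, 3), s(0, 4), s(1, 4)}

/-- The domino: the squares `0 1 2 3` and `1 4 5 2` sharing the edge `12`. -/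
def dominoGraph : SimpleGraph (Fin 6) :=
  SimpleGraph.fromEdgeSet {s(0, 1), s(1, 2), s(2, 3), s(0, 3), s(1, 4), s(4, 5), s(2, 5)}

/-- The gem: the path `0 1 2 3` with the vertex `4` joined to all of it. -/
def gemGraph : SimpleGraph (Fin 5) :=
  SimpleGraph.fromEdgeSet {s(0, 1), s(1, 2), s(2, 3), s(0, 4), s(1, 4), s(2, 4), s(3, 4)}

/-- Distance-hereditary graphs: no induced house, hole (chordless cycle of length at least 5),
domino or gem. -/
def DistanceHereditary {V : Type*} (G : SimpleGraph V) : Prop :=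
  ¬ houseGraph.IsIndContained G ∧
  (∀ k : ℕ, 5 ≤ k → ¬ (SimpleGraph.cycleGraph k).IsIndContained G) ∧
  ¬ dominoGraph.IsIndContained G ∧
  ¬ gemGraph.IsIndContained G

/-! ### Random access machine

Registers and memory cells hold natural numbers, and each instruction costs one step. The only
arithmetic on stored values is adding or subtracting 1, besides the addressing mode `base + index`.
Hence after `t` steps no stored value exceeds the largest input value or program constant by more
than `t`: when that value is polynomial in `n` and `t = O(n)`, all words have `O(log n)` bits, so a
program of this machine runs on the usual unit-cost RAM with logarithmic word length, with the same
number of steps up to a constant factor. -/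

/-- Instructions of the machine. Registers are named by natural numbers, jump targets are absolute
positions in the program. -/
inductive RamInstr where
  /-- `reg r := k` -/
  | const (r k : ℕ)
  /-- `reg r := reg s` -/
  | copy (r s : ℕ)
  /-- `reg r := reg r + 1` -/
  | inc (r : ℕ)
  /-- `reg r := reg r - 1` (and `0` stays `0`) -/
  | dec (r : ℕ)
  /-- `reg r := mem (reg b + reg i)` -/
  | load (r b i : ℕ)
  /-- `mem (reg b + reg i) := reg s` -/
  | store (b i s : ℕ)
  /-- jump to `l` -/
  | jump (l : ℕ)
  /-- jump to `l` if `reg r = reg s` -/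
  | jumpEq (r s l : ℕ)
  /-- jump to `l` if `reg r < reg s` -/
  | jumpLt (r s l : ℕ)
  /-- stop with the given answer -/
  | halt (answer : Bool)

/-- Configurations: program counter, registers, memory. -/
structure RamConfig where
  pc : ℕ
  reg : ℕ → ℕ
  mem : ℕ → ℕ

/-- One step of the program `P`. At a `halt` instruction, or when the program counter is outside
the program, the configuration does not change any more. -/
def ramStep (P : List RamInstr) (c : RamConfig) : RamConfig :=
  match P[c.pc]? with
  | some (.const r k) => ⟨c.pc + 1, Function.update c.reg r k, c.mem⟩
  | some (.copy r s) => ⟨c.pc + 1, Function.update c.reg r (c.reg s), c.mem⟩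
  | some (.inc r) => ⟨c.pc + 1, Function.update c.reg r (c.reg r + 1), c.mem⟩
  | some (.dec r) => ⟨c.pc + 1, Function.update c.reg r (c.reg r - 1), c.mem⟩
  | some (.load r b i) =>
      ⟨c.pc + 1, Function.update c.reg r (c.mem (c.reg b + c.reg i)), c.mem⟩
  | some (.store b i s) =>
      ⟨c.pc + 1, c.reg, Function.update c.mem (c.reg b + c.reg i) (c.reg s)⟩
  | some (.jump l) => ⟨l, c.reg, c.mem⟩
  | some (.jumpEq r s l) => ⟨if c.reg r = c.reg s then l else c.pc + 1, c.reg, c.mem⟩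
  | some (.jumpLt r s l) => ⟨if c.reg r < c.reg s then l else c.pc + 1, c.reg, c.mem⟩
  | some (.halt _) => c
  | none => c

/-- The initial configuration: the input `x` stands in the memory cells `0, 1, 2, …`; all other
cells and all registers are `0`. -/
def ramInit (x : List ℕ) : RamConfig :=
  ⟨0, fun _ => 0, fun a => x.getD a 0⟩

/-- Started on the input `x`, the program `P` halts after at most `T` steps with the answer `b`. -/
def RamHaltsWith (P : List RamInstr) (x : List ℕ) (T : ℕ) (b : Bool) : Prop :=
  ∃ t ≤ T, P[((ramStep P)^[t] (ramInit x)).pc]? = some (RamInstr.halt b)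

/-! ### Adjacency list representation -/

/-- `adj` is a family of adjacency lists of `G`: the list of `v` holds each neighbour of `v`
exactly once, in any order. -/
def IsAdjLists {n : ℕ} (G : SimpleGraph (Fin n)) (adj : Fin n → List (Fin n)) : Prop :=
  ∀ v : Fin n, (adj v).Nodup ∧ ∀ w : Fin n, w ∈ adj v ↔ G.Adj v w

/-- The contents of the memory for given adjacency lists. Cell `0` holds `n`. For `k ≤ n`, cell
`k + 1` holds the address at which the list of vertex `k` starts (for `k = n`: the first address
behind the last list). The lists of the vertices `0, …, n - 1` follow one after the other from
cell `n + 2` on. -/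
def encodeAdjLists {n : ℕ} (adj : Fin n → List (Fin n)) : List ℕ :=
  n :: ((List.range (n + 1)).map fun k =>
      n + 2 + (((List.finRange n).take k).map fun v => (adj v).length).sum) ++
    (List.finRange n).flatMap fun v => (adj v).map Fin.val

/-! The class is handled together with a set `X` of vertices that the matching must not use (`Good G
X`), because this makes it compatible with cut vertices. House, holes, domino and gem are
2-connected, so an induced copy lies on one side of a cut vertex `r`, and matchings of the two sides
combine as soon as at most one of them uses `r`. Hence a side attached at `r` can be cut off: if it
is good even with `r` forbidden, it is dropped; if it is good only when it may use `r`, it is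
dropped and `r` is added to `X`; if it is not good at all, neither is `G`
(`good_iff_of_side_avoids`, `good_iff_of_side_needs`). Removed vertices are kept as isolated
vertices, which changes nothing because the obstructions have none.

The sides that arise have bounded size. On `k` vertices a forest has at most `k - 1` edges and a
matching at most `k / 2`, so good graphs are sparse, also locally. With house, holes and domino
excluded, this leaves only cycles of length 3, 4 and 6 (`Good.cycle_length`) and few shapes for
three disjoint links between two vertices (`Good.theta`). In a depth-first search tree a back edge
therefore spans at most five tree edges, three ears cannot follow one another, and at most twelve
children of a vertex have subtrees that reach above it. So a subtree all of whose proper subtrees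
reach above their attachment vertex has depth at most ten and at most `segBound` vertices
(`IsDfsTree.card_le_segBound`).

The algorithm numbers the vertices by depth-first search and treats them from the largest number
down. Vertices whose fate is open wait on a stack, where what is left of the subtree of the current
vertex `c` forms an initial run. If an edge leaves this subtree for a vertex above the parent of
`c`, then `c` is pushed; otherwise the subtree is a side of bounded size attached at the parent and
is cut off as above. A run that is too long, or a vertex with six smaller neighbours, shows that `G`
is not good. `PeelInv` is the invariant.

Whether a piece is good depends only on the order of boundedly many registers, so the answers are
wired into a decision tree of comparisons. All loop bodies have constant size, and the loops run
`O(n)` times since inputs with too many edges are rejected at once. The machine level is handled by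
weakest preconditions for loop-free code, whose size bounds its running time (`Code.reach`), and by
a loop rule (`Prog.Spec.loop`). -/

/-! ### Graphs with forbidden matching vertices -/

/-- `G` has a matching that avoids the vertices in `X` and whose removal leaves a forest. -/
def MDecAvoid {V : Type*} (G : SimpleGraph V) (X : Set V) : Prop :=
  ∃ M : SimpleGraph V, M ≤ G ∧ (∀ v a b, M.Adj v a → M.Adj v b → a = b) ∧
    (∀ v ∈ X, ∀ a, ¬ M.Adj v a) ∧ (G \ M).IsAcyclic

/-- Distance-hereditary graphs with a decycling matching that avoids `X`. -/
def Good {V : Type*} (G : SimpleGraph V) (X : Set V) : Prop :=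
  DistanceHereditary G ∧ MDecAvoid G X

/-- The graph `G` with all vertices outside `S` made isolated. -/
def restrictTo {V : Type*} (G : SimpleGraph V) (S : Set V) : SimpleGraph V where
  Adj u v := G.Adj u v ∧ u ∈ S ∧ v ∈ S
  symm := ⟨fun _ _ h => ⟨h.1.symm, h.2.2, h.2.1⟩⟩
  loopless := ⟨fun _ h => G.loopless.irrefl _ h.1⟩

theorem restrictTo_adj {V : Type*} {G : SimpleGraph V} {S : Set V} {u v : V} :
    (restrictTo G S).Adj u v ↔ G.Adj u v ∧ u ∈ S ∧ v ∈ S := Iff.rfl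

theorem mDecyclable_iff_mDecAvoid {V : Type*} (G : SimpleGraph V) :
    MDecyclable G ↔ MDecAvoid G ∅ := by
  constructor
  · rintro ⟨M, hM, hac⟩
    refine ⟨M.spanningCoe, M.spanningCoe_le, fun v a b ha hb => hM.eq_of_adj_left ha hb,
      by simp, ?_⟩
    have : G \ M.spanningCoe = G.deleteEdges M.edgeSet := by
      ext u v; simp [SimpleGraph.deleteEdges_adj]
    rwa [this]
  · rintro ⟨M, hMG, hM, -, hac⟩
    refine ⟨{ verts := {v | ∃ w, M.Adj v w}, Adj := M.Adj, adj_sub := fun h => hMG h,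
              edge_vert := fun h => ⟨_, h⟩, symm := M.symm }, ?_, ?_⟩
    · rintro v ⟨w, hw⟩
      exact ⟨w, hw, fun y hy => hM _ _ _ hy hw⟩
    · refine hac.anti ?_
      intro u v h
      rw [SimpleGraph.deleteEdges_adj] at h
      exact ⟨h.1, fun h' => h.2 h'⟩

/-- A graph is acyclic if each of its edges survives as an edge in a weak homomorphic image in an
acyclic graph, without being identified with another edge. -/
theorem isAcyclic_of_retractions {V : Type*} {W : Type*} {H : SimpleGraph V}
    (h : ∀ u v, H.Adj u v → ∃ (H' : SimpleGraph W) (φ : V → W), H'.IsAcyclic ∧ H'.Adj (φ u) (φ v) ∧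
      ∀ x y, H.Adj x y → (φ x = φ y ∨ H'.Adj (φ x) (φ y)) ∧
        (s(φ x, φ y) = s(φ u, φ v) → s(x, y) = s(u, v))) : H.IsAcyclic := by
  rw [SimpleGraph.isAcyclic_iff_forall_adj_isBridge]
  intro u v huv
  obtain ⟨H', φ, hac, hadj, hφ⟩ := h u v huv
  rw [SimpleGraph.isAcyclic_iff_forall_adj_isBridge] at hac
  have hb := hac hadj
  rw [SimpleGraph.isBridge_iff] at hb ⊢
  intro hr
  apply hb
  -- A walk that avoids `uv` maps to one that avoids its image: collapsed edges are skipped, and no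
  -- other edge lands on the image of `uv`. As that image is a bridge of `H'`, `uv` is a bridge of
  -- `H`.
  have key : ∀ x y, (H.deleteEdges {s(u, v)}).Walk x y →
      (H'.deleteEdges {s(φ u, φ v)}).Reachable (φ x) (φ y) := by
    intro x y p
    induction p with
    | nil => exact SimpleGraph.Reachable.refl _
    | @cons a b c hab p ih =>
      rw [SimpleGraph.deleteEdges_adj] at hab
      obtain ⟨h1, h2⟩ := hφ a b hab.1
      rcases h1 with h1 | h1
      · rw [h1]; exact ih
      · refine SimpleGraph.Reachable.trans (SimpleGraph.Adj.reachable ?_) ih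
        rw [SimpleGraph.deleteEdges_adj]
        exact ⟨h1, fun h3 => hab.2 (h2 h3)⟩
  obtain ⟨p⟩ := hr
  exact key _ _ p

/-! ### Transport along injections -/

/-- Every vertex has a neighbour. -/
def NoIsolated {W : Type*} (P : SimpleGraph W) : Prop := ∀ a, ∃ b, P.Adj a b

/-- Vertices of `G` outside the image of `φ` have no edges, so a pattern without isolated vertices
cannot use them. -/
theorem isIndContained_iff_of_image {W V U : Type*} {H : SimpleGraph W} {G : SimpleGraph V}
    {P : SimpleGraph U} (hP : NoIsolated P) (φ : W → V) (hφ : Function.Injective φ)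
    (hadj : ∀ a b, G.Adj (φ a) (φ b) ↔ H.Adj a b)
    (himg : ∀ u v, G.Adj u v → ∃ a, φ a = u) :
    P.IsIndContained G ↔ P.IsIndContained H := by
  constructor
  · rintro ⟨f⟩
    have : ∀ p, ∃ a, φ a = f p := fun p => by
      obtain ⟨q, hq⟩ := hP p
      exact himg _ _ (f.map_adj_iff.2 hq)
    choose g hg using this
    refine ⟨⟨⟨g, fun p q h => f.injective ?_⟩, ?_⟩⟩
    · rw [← hg p, ← hg q, h]
    · intro p q
      change H.Adj (g p) (g q) ↔ _
      rw [← hadj, hg, hg, f.map_adj_iff]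
  · rintro ⟨f⟩
    exact ⟨⟨⟨φ ∘ f, hφ.comp f.injective⟩, by
      intro p q
      change G.Adj (φ (f p)) (φ (f q)) ↔ _
      rw [hadj, f.map_adj_iff]⟩⟩

theorem noIsolated_house : NoIsolated houseGraph := by
  unfold NoIsolated houseGraph; simp only [SimpleGraph.fromEdgeSet_adj]; decide

theorem noIsolated_domino : NoIsolated dominoGraph := by
  unfold NoIsolated dominoGraph; simp only [SimpleGraph.fromEdgeSet_adj]; decide

theorem noIsolated_gem : NoIsolated gemGraph := by
  unfold NoIsolated gemGraph; simp only [SimpleGraph.fromEdgeSet_adj]; decide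

theorem noIsolated_cycleGraph {k : ℕ} (hk : 5 ≤ k) : NoIsolated (SimpleGraph.cycleGraph k) := by
  obtain ⟨m, rfl⟩ : ∃ m, k = m + 2 := ⟨k - 2, by omega⟩
  intro a
  exact ⟨a + 1, by rw [SimpleGraph.cycleGraph_adj]; simp⟩

theorem distanceHereditary_iff_of_image {W V : Type*} {H : SimpleGraph W} {G : SimpleGraph V}
    (φ : W → V) (hφ : Function.Injective φ)
    (hadj : ∀ a b, G.Adj (φ a) (φ b) ↔ H.Adj a b)
    (himg : ∀ u v, G.Adj u v → ∃ a, φ a = u) :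
    DistanceHereditary G ↔ DistanceHereditary H := by
  unfold DistanceHereditary
  rw [isIndContained_iff_of_image noIsolated_house φ hφ hadj himg,
    isIndContained_iff_of_image noIsolated_domino φ hφ hadj himg,
    isIndContained_iff_of_image noIsolated_gem φ hφ hadj himg]
  refine and_congr Iff.rfl (and_congr ?_ Iff.rfl)
  refine forall_congr' fun k => forall_congr' fun hk => ?_
  rw [isIndContained_iff_of_image (noIsolated_cycleGraph hk) φ hφ hadj himg]

/-- A matching is pulled back along `φ` in one direction and pushed forward in the other. Every edge
of `G` lies in the image, so an inverse of `φ` is the retraction that shows the remainder of `G` to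
be acyclic. -/
theorem mDecAvoid_iff_of_image {W V : Type*} {H : SimpleGraph W} {G : SimpleGraph V}
    (φ : W → V) (hφ : Function.Injective φ)
    (hadj : ∀ a b, G.Adj (φ a) (φ b) ↔ H.Adj a b)
    (himg : ∀ u v, G.Adj u v → ∃ a, φ a = u) (X : Set V) :
    MDecAvoid G X ↔ MDecAvoid H (φ ⁻¹' X) := by
  constructor
  · rintro ⟨M, hMG, hM, hX, hac⟩
    refine ⟨M.comap φ, fun a b h => (hadj a b).1 (hMG h), fun v a b ha hb => hφ (hM _ _ _ ha hb),
      fun v hv a h => hX _ hv _ h, ?_⟩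
    refine hac.comap ⟨φ, ?_⟩ hφ
    intro a b h
    exact ⟨(hadj a b).2 h.1, fun h' => h.2 h'⟩
  · rintro ⟨M, hMG, hM, hX, hac⟩
    let N : SimpleGraph V :=
      { Adj := fun u v => ∃ a b, M.Adj a b ∧ φ a = u ∧ φ b = v
        symm := ⟨fun u v ⟨a, b, h, h1, h2⟩ => ⟨b, a, h.symm, h2, h1⟩⟩
        loopless := ⟨fun u ⟨a, b, h, h1, h2⟩ => h.ne (hφ (h1.trans h2.symm))⟩ }
    have hN : ∀ a b, N.Adj (φ a) (φ b) ↔ M.Adj a b := by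
      intro a b
      constructor
      · rintro ⟨a', b', h, h1, h2⟩
        rwa [← hφ h1, ← hφ h2]
      · intro h; exact ⟨a, b, h, rfl, rfl⟩
    refine ⟨N, ?_, ?_, ?_, ?_⟩
    · rintro _ _ ⟨a, b, h, rfl, rfl⟩
      exact (hadj a b).2 (hMG h)
    · rintro _ _ _ ⟨a, b, h, rfl, rfl⟩ ⟨a', b', h', h1, rfl⟩
      rw [hφ h1] at h'
      rw [hM _ _ _ h h']
    · rintro _ hv _ ⟨a, b, h, rfl, rfl⟩
      exact hX _ hv _ h
    · refine isAcyclic_of_retractions (W := W) fun u v huv => ?_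
      obtain ⟨a, rfl⟩ := himg _ _ huv.1
      have : Nonempty W := ⟨a⟩
      have hinv := Function.leftInverse_invFun hφ
      refine ⟨H \ M, Function.invFun φ, hac, ?_, ?_⟩
      · obtain ⟨b, rfl⟩ := himg _ _ huv.1.symm
        rw [hinv, hinv]
        exact ⟨(hadj a b).1 huv.1, fun h => huv.2 ((hN _ _).2 h)⟩
      · intro x y hxy
        obtain ⟨b, rfl⟩ := himg _ _ huv.1.symm
        obtain ⟨c, rfl⟩ := himg _ _ hxy.1
        obtain ⟨d, rfl⟩ := himg _ _ hxy.1.symm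
        simp only [hinv _]
        refine ⟨Or.inr ⟨(hadj c d).1 hxy.1, fun h => hxy.2 ((hN _ _).2 h)⟩, fun h => ?_⟩
        simpa using congrArg (Sym2.map φ) h

theorem good_iff_of_image {W V : Type*} {H : SimpleGraph W} {G : SimpleGraph V}
    (φ : W → V) (hφ : Function.Injective φ)
    (hadj : ∀ a b, G.Adj (φ a) (φ b) ↔ H.Adj a b)
    (himg : ∀ u v, G.Adj u v → ∃ a, φ a = u) (X : Set V) :
    Good G X ↔ Good H (φ ⁻¹' X) :=
  and_congr (distanceHereditary_iff_of_image φ hφ hadj himg)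
    (mDecAvoid_iff_of_image φ hφ hadj himg X)

/-! ### Gluing at a cut vertex -/

/-- Deleting any single vertex leaves a connected graph (expressed by closed sets). -/
def StaysConnected {W : Type*} (P : SimpleGraph W) : Prop :=
  ∀ (x : W) (T : W → Bool) (a b : W), a ≠ x → b ≠ x → T a = true →
    (∀ u v, T u = true → u ≠ x → v ≠ x → P.Adj u v → T v = true) → T b = true

/-- In a path `0, …, m` with the closure property, membership spreads. -/
theorem spread_along_path {m : ℕ} {Q : ℕ → Prop} (h : ∀ i, i + 1 < m → (Q i ↔ Q (i + 1)))
    {i j : ℕ} (hi : i < m) (hj : j < m) (hQ : Q i) : Q j := by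
  have h0 : ∀ i, i < m → (Q 0 ↔ Q i) := by
    intro i
    induction i with
    | zero => simp
    | succ i ih => intro h1; rw [ih (by omega)]; exact h i h1
  exact (h0 j hj).1 ((h0 i hi).2 hQ)

theorem staysConnected_cycleGraph {k : ℕ} (hk : 5 ≤ k) :
    StaysConnected (SimpleGraph.cycleGraph k) := by
  obtain ⟨m, rfl⟩ : ∃ m, k = m + 2 := ⟨k - 2, by omega⟩
  intro x T a b ha hb hTa hT
  -- The vertices other than `x` in cyclic order behind `x`: deleting `x` leaves the path `pos 0, …,
  -- pos m`.
  let pos : ℕ → Fin (m + 2) := fun i => x + (Fin.ofNat (m + 2) (i + 1))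
  have hpos : ∀ y : Fin (m + 2), y ≠ x → ∃ i < m + 1, y = pos i := by
    intro y hy
    refine ⟨(y - x).val - 1, by have := (y - x).isLt; omega, ?_⟩
    have h1 : (y - x).val ≠ 0 := by
      intro h; apply hy; rw [← sub_eq_zero]; exact Fin.ext h
    have h2 : (y - x).val - 1 + 1 = (y - x).val := by omega
    simp only [pos, h2]
    have : Fin.ofNat (m + 2) (y - x).val = y - x := by
      apply Fin.ext; simp [Fin.ofNat, Nat.mod_eq_of_lt (y - x).isLt]
    rw [this]; abel
  have hne : ∀ i, i < m + 1 → pos i ≠ x := by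
    intro i hi h
    have h1 : Fin.ofNat (m + 2) (i + 1) = 0 := by simpa [pos] using h
    have := congrArg Fin.val h1
    simp [Fin.ofNat] at this
    rw [Nat.mod_eq_of_lt (by omega)] at this
    omega
  have hsucc : ∀ i, pos (i + 1) = pos i + 1 := by
    intro i
    have : Fin.ofNat (m + 2) (i + 1 + 1) = Fin.ofNat (m + 2) (i + 1) + 1 := by
      apply Fin.ext; simp [Fin.ofNat, Fin.val_add]
    simp only [pos]
    rw [this, ← add_assoc]
  obtain ⟨i, hi, rfl⟩ := hpos a ha
  obtain ⟨j, hj, rfl⟩ := hpos b hb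
  refine spread_along_path (Q := fun i => T (pos i) = true) (m := m + 1) ?_ hi hj hTa
  intro l hl
  constructor
  · intro h
    refine hT _ _ h (hne _ (by omega)) (hne _ (by omega)) ?_
    rw [SimpleGraph.cycleGraph_adj, hsucc]; simp
  · intro h
    refine hT _ _ h (hne _ (by omega)) (hne _ (by omega)) ?_
    rw [SimpleGraph.cycleGraph_adj, hsucc]; simp

/-- A graph with a spanning cycle of length at least `5` stays connected. -/
theorem staysConnected_of_spanning_cycle {k : ℕ} (hk : 5 ≤ k) {P : SimpleGraph (Fin k)}
    (σ τ : Fin k → Fin k) (h1 : ∀ a, σ (τ a) = a) (h2 : ∀ a, τ (σ a) = a)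
    (h : ∀ a b, (SimpleGraph.cycleGraph k).Adj a b → P.Adj (σ a) (σ b)) : StaysConnected P := by
  intro x T a b ha hb hTa hT
  have := staysConnected_cycleGraph hk (τ x) (fun c => T (σ c)) (τ a) (τ b)
    (fun h => ha (by rw [← h1 a, h, h1])) (fun h => hb (by rw [← h1 b, h, h1])) (by rw [h1, hTa])
    (fun u v hu hux hvx huv => hT _ _ hu (fun h => hux (by rw [← h, h2]))
      (fun h => hvx (by rw [← h, h2])) (h _ _ huv))
  rwa [h1] at this

/-- The spanning cycle `0 4 1 2 3` takes the detour over the roof. -/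
theorem staysConnected_house : StaysConnected houseGraph := by
  refine staysConnected_of_spanning_cycle (by norm_num) ![0, 4, 1, 2, 3] ![0, 2, 3, 4, 1]
    (by decide) (by decide) ?_
  simp only [SimpleGraph.cycleGraph_adj, houseGraph, SimpleGraph.fromEdgeSet_adj]
  decide

theorem staysConnected_domino : StaysConnected dominoGraph := by
  refine staysConnected_of_spanning_cycle (by norm_num) ![0, 1, 4, 5, 2, 3] ![0, 1, 4, 5, 2, 3]
    (by decide) (by decide) ?_
  simp only [SimpleGraph.cycleGraph_adj, dominoGraph, SimpleGraph.fromEdgeSet_adj]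
  decide

theorem staysConnected_gem : StaysConnected gemGraph := by
  refine staysConnected_of_spanning_cycle (by norm_num) ![0, 1, 2, 3, 4] ![0, 1, 2, 3, 4]
    (by decide) (by decide) ?_
  simp only [SimpleGraph.cycleGraph_adj, gemGraph, SimpleGraph.fromEdgeSet_adj]
  decide

section Glue

variable {V : Type*} {G : SimpleGraph V} {S : Set V} {r : V}

theorem isIndContained_of_le {U : Type*} {P : SimpleGraph U} (hP : NoIsolated P) {T : Set V}
    (h : P.IsIndContained (restrictTo G T)) : P.IsIndContained G := by
  obtain ⟨f⟩ := h
  refine ⟨⟨f.toEmbedding, ?_⟩⟩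
  intro a b
  have hmem : ∀ a, f a ∈ T := fun a => by
    obtain ⟨b, hb⟩ := hP a
    exact (f.map_adj_iff.2 hb).2.1
  constructor
  · intro h; exact f.map_adj_iff.1 ⟨h, hmem a, hmem b⟩
  · intro h; exact (f.map_adj_iff.2 h).1

/-- A copy with one vertex in `S` and another outside `S ∪ {r}` would be disconnected by deleting
the pattern vertex placed on `r`, which `StaysConnected` excludes. If no pattern vertex is placed on
`r`, any third vertex can be deleted instead; `h3` provides it. -/
theorem isIndContained_glue (hr : r ∉ S)
    (hS : ∀ x ∈ S, ∀ y, G.Adj x y → y ∈ S ∨ y = r) {U : Type*} {P : SimpleGraph U}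
    (hP : NoIsolated P) (hC : StaysConnected P) (h3 : ∀ a b : U, ∃ c, c ≠ a ∧ c ≠ b) :
    P.IsIndContained G ↔
      P.IsIndContained (restrictTo G (S ∪ {r})) ∨ P.IsIndContained (restrictTo G Sᶜ) := by
  classical
  constructor
  · rintro ⟨f⟩
    have lift : ∀ T : Set V, (∀ a, f a ∈ T) → P.IsIndContained (restrictTo G T) := by
      intro T hT
      refine ⟨⟨f.toEmbedding, ?_⟩⟩
      intro a b
      refine ⟨fun h => f.map_adj_iff.1 h.1, fun h => ⟨f.map_adj_iff.2 h, hT a, hT b⟩⟩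
    by_cases h1 : ∀ a, f a ∈ Sᶜ
    · exact Or.inr (lift _ h1)
    left
    apply lift
    by_contra h2
    push Not at h1 h2
    obtain ⟨a, ha⟩ := h1
    obtain ⟨b, hb⟩ := h2
    have ha' : f a ∈ S := by simpa using ha
    have hb1 : f b ∉ S := fun h => hb (Or.inl h)
    have hb2 : f b ≠ r := fun h => hb (Or.inr h)
    obtain ⟨x, hxa, hxb, hx⟩ : ∃ x, x ≠ a ∧ x ≠ b ∧ ∀ y, f y = r → y = x := by
      by_cases h : ∃ x, f x = r
      · obtain ⟨x, hx⟩ := h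
        refine ⟨x, ?_, ?_, fun y hy => f.injective (hy.trans hx.symm)⟩
        · rintro rfl; rw [hx] at ha'; exact hr ha'
        · rintro rfl; exact hb2 hx
      · obtain ⟨c, hc1, hc2⟩ := h3 a b
        exact ⟨c, hc1, hc2, fun y hy => absurd ⟨y, hy⟩ h⟩
    have := hC x (fun c => decide (f c ∈ S)) a b hxa.symm hxb.symm (by simpa using ha') (by
      intro u v hu hux hvx huv
      simp only [decide_eq_true_eq] at hu ⊢
      rcases hS _ hu _ (f.map_adj_iff.2 huv) with h | h
      · exact h
      · exact absurd (hx v h) hvx)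
    exact hb1 (by simpa using this)
  · rintro (h | h)
    · exact isIndContained_of_le hP h
    · exact isIndContained_of_le hP h

theorem distanceHereditary_glue (hr : r ∉ S)
    (hS : ∀ x ∈ S, ∀ y, G.Adj x y → y ∈ S ∨ y = r) :
    DistanceHereditary G ↔
      DistanceHereditary (restrictTo G (S ∪ {r})) ∧ DistanceHereditary (restrictTo G Sᶜ) := by
  unfold DistanceHereditary
  have hcy : ∀ k, 5 ≤ k → ((SimpleGraph.cycleGraph k).IsIndContained G ↔ _) := fun k hk =>
    isIndContained_glue hr hS (noIsolated_cycleGraph hk) (staysConnected_cycleGraph hk) (by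
      intro a b
      obtain ⟨c, hc⟩ := Finset.exists_mem_notMem_of_card_lt_card (s := {a, b})
        (t := (Finset.univ : Finset (Fin k))) (by
          have := Finset.card_le_two (a := a) (b := b)
          simp only [Finset.card_univ, Fintype.card_fin]; omega)
      exact ⟨c, by simpa using hc.2⟩)
  rw [isIndContained_glue hr hS noIsolated_house staysConnected_house (by decide),
    isIndContained_glue hr hS noIsolated_domino staysConnected_domino (by decide),
    isIndContained_glue hr hS noIsolated_gem staysConnected_gem (by decide)]
  constructor
  · rintro ⟨h1, h2, h3, h4⟩
    refine ⟨⟨fun h => h1 (Or.inl h), fun k hk h => h2 k hk ((hcy k hk).2 (Or.inl h)),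
      fun h => h3 (Or.inl h), fun h => h4 (Or.inl h)⟩,
      ⟨fun h => h1 (Or.inr h), fun k hk h => h2 k hk ((hcy k hk).2 (Or.inr h)),
      fun h => h3 (Or.inr h), fun h => h4 (Or.inr h)⟩⟩
  · rintro ⟨⟨h1, h2, h3, h4⟩, ⟨h1', h2', h3', h4'⟩⟩
    refine ⟨fun h => h.elim h1 h1', fun k hk h => ((hcy k hk).1 h).elim (h2 k hk) (h2' k hk),
      fun h => h.elim h3 h3', fun h => h.elim h4 h4'⟩

theorem mDecAvoid_restrictTo {X : Set V} {T : Set V} {M : SimpleGraph V} (hMG : M ≤ G)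
    (hM : ∀ v a b, M.Adj v a → M.Adj v b → a = b) (hac : (G \ M).IsAcyclic)
    (hX : ∀ v ∈ X, ∀ a, (restrictTo M T).Adj v a → False) : MDecAvoid (restrictTo G T) X :=
  ⟨restrictTo M T, fun _ _ h => ⟨hMG h.1, h.2⟩, fun v a b ha hb => hM v a b ha.1 hb.1,
    fun v hv a h => hX v hv a h, by
      refine hac.anti ?_
      intro u v h
      exact ⟨h.1.1, fun h' => h.2 ⟨h', h.1.2⟩⟩⟩

/-- Matchings on the two sides of a cut vertex `r` combine if at most one of them uses `r`. -/
theorem mDecAvoid_of_sides (hr : r ∉ S) (hS : ∀ x ∈ S, ∀ y, G.Adj x y → y ∈ S ∨ y = r)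
    {X Y₁ Y₂ : Set V} (h1 : MDecAvoid (restrictTo G (S ∪ {r})) (X ∪ Y₁))
    (h2 : MDecAvoid (restrictTo G Sᶜ) (X ∪ Y₂)) (hY : r ∈ Y₁ ∨ r ∈ Y₂) : MDecAvoid G X := by
  classical
  obtain ⟨M₁, hG₁, hM₁, hX₁, hac₁⟩ := h1
  obtain ⟨M₂, hG₂, hM₂, hX₂, hac₂⟩ := h2
  -- Only `r` lies on both sides, and one of the two matchings avoids it.
  have hcross : ∀ v a b, M₁.Adj v a → M₂.Adj v b → False := by
    intro v a b ha hb
    have hv1 := (hG₁ ha).2.1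
    have hv2 := (hG₂ hb).2.1
    have hvr : v = r := by
      rcases hv1 with h | h
      · exact absurd h hv2
      · exact h
    subst hvr
    rcases hY with h | h
    · exact hX₁ _ (Or.inr h) _ ha
    · exact hX₂ _ (Or.inr h) _ hb
  refine ⟨M₁ ⊔ M₂, ?_, ?_, ?_, ?_⟩
  · rintro u v (h | h)
    · exact (hG₁ h).1
    · exact (hG₂ h).1
  · rintro v a b (ha | ha) (hb | hb)
    · exact hM₁ _ _ _ ha hb
    · exact (hcross _ _ _ ha hb).elim
    · exact (hcross _ _ _ hb ha).elim
    · exact hM₂ _ _ _ ha hb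
  · rintro v hv a (h | h)
    · exact hX₁ v (Or.inl hv) a h
    · exact hX₂ v (Or.inl hv) a h
  · have hcase : ∀ x y, G.Adj x y → (x ∈ S ∪ {r} ∧ y ∈ S ∪ {r} ∧ (x ∈ S ∨ y ∈ S)) ∨
        (x ∉ S ∧ y ∉ S) := by
      intro x y hxy
      by_cases hx : x ∈ S
      · left; exact ⟨Or.inl hx, hS x hx y hxy, Or.inl hx⟩
      · by_cases hy : y ∈ S
        · left; exact ⟨hS y hy x hxy.symm, Or.inl hy, Or.inr hy⟩
        · right; exact ⟨hx, hy⟩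
    -- For an edge on one side, the other side is collapsed to `r`. The edges of the collapsed side
    -- become loops and cannot be confused with the given edge.
    refine isAcyclic_of_retractions (W := V) fun u v huv => ?_
    have hnr : ∀ x, x ∈ S ∪ {r} → x ∉ S → x = r := fun x h h' => h.resolve_left h'
    rcases hcase u v huv.1 with ⟨hu, hv, huv'⟩ | ⟨hu, hv⟩
    · refine ⟨_, fun x => if x ∈ S ∪ {r} then x else r, hac₁, ?_, ?_⟩
      · simp only [hu, hv, if_true]
        exact ⟨⟨huv.1, hu, hv⟩, fun h => huv.2 (Or.inl h)⟩
      · intro x y hxy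
        rcases hcase x y hxy.1 with ⟨hx, hy, -⟩ | ⟨hx, hy⟩
        · simp only [hu, hv, hx, hy, if_true]
          exact ⟨Or.inr ⟨⟨hxy.1, hx, hy⟩, fun h => hxy.2 (Or.inl h)⟩, fun h => h⟩
        · have ex : (if x ∈ S ∪ {r} then x else r) = r := by
            split_ifs with h
            · exact hnr x h hx
            · rfl
          have ey : (if y ∈ S ∪ {r} then y else r) = r := by
            split_ifs with h
            · exact hnr y h hy
            · rfl
          simp only [hu, hv, if_true, ex, ey]
          refine ⟨Or.inl trivial, fun h => ?_⟩
          have : u = r ∧ v = r := by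
            rcases Sym2.eq_iff.1 h with ⟨h1, h2⟩ | ⟨h1, h2⟩
            · exact ⟨h1.symm, h2.symm⟩
            · exact ⟨h2.symm, h1.symm⟩
          rw [this.1, this.2] at huv
          exact (huv.1.ne rfl).elim
    · refine ⟨_, fun x => if x ∈ S then r else x, hac₂, ?_, ?_⟩
      · simp only [hu, hv, if_false]
        exact ⟨⟨huv.1, hu, hv⟩, fun h => huv.2 (Or.inr h)⟩
      · intro x y hxy
        rcases hcase x y hxy.1 with ⟨hx, hy, -⟩ | ⟨hx, hy⟩
        · have ex : (if x ∈ S then r else x) = r := by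
            split_ifs with h
            · rfl
            · exact hnr x hx h
          have ey : (if y ∈ S then r else y) = r := by
            split_ifs with h
            · rfl
            · exact hnr y hy h
          simp only [hu, hv, if_false, ex, ey]
          refine ⟨Or.inl trivial, fun h => ?_⟩
          have : u = r ∧ v = r := by
            rcases Sym2.eq_iff.1 h with ⟨h1, h2⟩ | ⟨h1, h2⟩
            · exact ⟨h1.symm, h2.symm⟩
            · exact ⟨h2.symm, h1.symm⟩
          rw [this.1, this.2] at huv
          exact (huv.1.ne rfl).elim
        · simp only [hu, hv, hx, hy, if_false]
          exact ⟨Or.inr ⟨⟨hxy.1, hx, hy⟩, fun h => hxy.2 (Or.inr h)⟩, fun h => h⟩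

/-- If the side `S` needs no matching edge at the cut vertex `r`, it can be dropped. -/
theorem good_iff_of_side_avoids (hr : r ∉ S) (hS : ∀ x ∈ S, ∀ y, G.Adj x y → y ∈ S ∨ y = r)
    {X : Set V} (h : Good (restrictTo G (S ∪ {r})) (X ∪ {r})) :
    Good G X ↔ Good (restrictTo G Sᶜ) X := by
  constructor
  · rintro ⟨hd, M, hMG, hM, hX, hac⟩
    exact ⟨((distanceHereditary_glue hr hS).1 hd).2,
      mDecAvoid_restrictTo hMG hM hac fun v hv a h => hX v hv a h.1⟩
  · rintro ⟨hd, hm⟩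
    refine ⟨(distanceHereditary_glue hr hS).2 ⟨h.1, hd⟩,
      mDecAvoid_of_sides (Y₁ := {r}) (Y₂ := ∅) hr hS h.2 (by simpa using hm) (by simp)⟩

/-- If the side `S` needs a matching edge at the cut vertex `r`, the other side must do without. -/
theorem good_iff_of_side_needs (hr : r ∉ S) (hS : ∀ x ∈ S, ∀ y, G.Adj x y → y ∈ S ∨ y = r)
    {X : Set V} (h : Good (restrictTo G (S ∪ {r})) X)
    (h' : ¬ Good (restrictTo G (S ∪ {r})) (X ∪ {r})) :
    Good G X ↔ Good (restrictTo G Sᶜ) (X ∪ {r}) := by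
  constructor
  · rintro ⟨hd, M, hMG, hM, hX, hac⟩
    refine ⟨((distanceHereditary_glue hr hS).1 hd).2,
      mDecAvoid_restrictTo hMG hM hac fun v hv a hva => ?_⟩
    rcases hv with hv | rfl
    · exact hX v hv a hva.1
    -- An edge of `M` from `r` into the complement of `S` is the only one at `r`, so the restriction
    -- of `M` to `S ∪ {r}` avoids `r`.
    · apply h'
      refine ⟨h.1, mDecAvoid_restrictTo hMG hM hac fun w hw b hwb => ?_⟩
      rcases hw with hw | rfl
      · exact hX w hw b hwb.1
      · have := hM _ _ _ hva.1 hwb.1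
        subst this
        rcases hwb.2.2 with h1 | h1
        · exact hva.2.2 h1
        · exact hva.1.ne h1.symm
  · rintro ⟨hd, hm⟩
    refine ⟨(distanceHereditary_glue hr hS).2 ⟨h.1, hd⟩,
      mDecAvoid_of_sides (Y₁ := ∅) (Y₂ := {r}) hr hS (by simpa using h.2) hm (by simp)⟩

theorem Good.restrictTo_side (hr : r ∉ S) (hS : ∀ x ∈ S, ∀ y, G.Adj x y → y ∈ S ∨ y = r)
    {X : Set V} (h : Good G X) : Good (restrictTo G (S ∪ {r})) X := by
  obtain ⟨hd, M, hMG, hM, hX, hac⟩ := h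
  exact ⟨((distanceHereditary_glue hr hS).1 hd).1,
      mDecAvoid_restrictTo hMG hM hac fun v hv a h => hX v hv a h.1⟩

end Glue

theorem good_of_no_edges {V : Type*} {G : SimpleGraph V} (h : ∀ u v, ¬ G.Adj u v) (X : Set V) :
    Good G X := by
  have h1 : ∀ {U : Type} {P : SimpleGraph U}, NoIsolated P → Nonempty U → ¬ P.IsIndContained G := by
    rintro U P hP ⟨a⟩ ⟨f⟩
    obtain ⟨b, hb⟩ := hP a
    exact h _ _ (f.map_adj_iff.2 hb)
  refine ⟨⟨h1 noIsolated_house ⟨0⟩, fun k hk => h1 (noIsolated_cycleGraph hk) ⟨⟨0, by omega⟩⟩,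
    h1 noIsolated_domino ⟨0⟩, h1 noIsolated_gem ⟨0⟩⟩, ⊥, bot_le, by simp, by simp, ?_⟩
  rw [SimpleGraph.isAcyclic_iff_forall_adj_isBridge]
  intro u v huv
  exact (h _ _ huv.1).elim

/-! ### Counting edges -/

/-- The forest extends to a spanning tree of the complete graph, which has `k - 1` edges. -/
theorem IsAcyclic_card_edges {k : ℕ} (hk : 1 ≤ k) {F : SimpleGraph (Fin k)} (hF : F.IsAcyclic)
    (E : Finset (Sym2 (Fin k))) (hE : ∀ e ∈ E, e ∈ F.edgeSet) : E.card + 1 ≤ k := by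
  classical
  have : Nonempty (Fin k) := ⟨⟨0, hk⟩⟩
  obtain ⟨T, hFT, hT⟩ := SimpleGraph.exists_maximal_isAcyclic_of_le_isAcyclic
    (G := (⊤ : SimpleGraph (Fin k))) le_top hF
  rw [SimpleGraph.connected_top.maximal_le_isAcyclic_iff_isTree le_top] at hT
  have h1 := hT.card_edgeFinset
  rw [Fintype.card_fin] at h1
  have h2 : E ⊆ T.edgeFinset := by
    intro e he
    rw [SimpleGraph.mem_edgeFinset]
    exact SimpleGraph.edgeSet_mono hFT (hE e he)
  have := Finset.card_le_card h2
  omega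

theorem matching_card_edges {k : ℕ} {N : SimpleGraph (Fin k)}
    (hN : ∀ v a b, N.Adj v a → N.Adj v b → a = b)
    (E : Finset (Sym2 (Fin k))) (hE : ∀ e ∈ E, e ∈ N.edgeSet) : 2 * E.card ≤ k := by
  classical
  have h1 := N.sum_degrees_eq_twice_card_edges
  have h2 : ∑ v, N.degree v ≤ ∑ _v : Fin k, 1 := by
    refine Finset.sum_le_sum fun v _ => ?_
    rw [← SimpleGraph.card_neighborFinset_eq_degree, Finset.card_le_one]
    intro a ha b hb
    rw [SimpleGraph.mem_neighborFinset] at ha hb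
    exact hN _ _ _ ha hb
  have h3 : E ⊆ N.edgeFinset := by
    intro e he
    rw [SimpleGraph.mem_edgeFinset]; exact hE e he
  have := Finset.card_le_card h3
  simp at h2
  omega

/-- A matching-decyclable graph has at most `3k/2 - 1` edges on any `k` vertices. -/
theorem MDecAvoid.card_edges {V : Type*} {G : SimpleGraph V} {X : Set V} (h : MDecAvoid G X)
    {k : ℕ} (hk : 1 ≤ k) (f : Fin k → V) (hf : Function.Injective f) (E : Finset (Sym2 (Fin k)))
    (hE : ∀ a b, s(a, b) ∈ E → G.Adj (f a) (f b)) : 2 * E.card + 2 ≤ 3 * k := by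
  classical
  obtain ⟨M, hMG, hM, -, hac⟩ := h
  -- `E` splits into edges outside `M`, at most `k - 1` because they form a forest, and edges in
  -- `M`, at most `k / 2`.
  have h1 := IsAcyclic_card_edges hk (F := (G \ M).comap f)
    (hac.comap ⟨f, fun h => h⟩ hf) (E.filter fun e => e ∉ (M.comap f).edgeSet) (by
      intro e he
      induction e with | _ a b =>
      rw [Finset.mem_filter] at he
      exact ⟨hE a b he.1, fun h => he.2 h⟩)
  have h2 := matching_card_edges (N := M.comap f) (fun v a b ha hb => hf (hM _ _ _ ha hb))
    (E.filter fun e => e ∈ (M.comap f).edgeSet) (by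
      intro e he
      rw [Finset.mem_filter] at he
      exact he.2)
  have h3 := Finset.card_filter_add_card_filter_not (s := E) (fun e => e ∈ (M.comap f).edgeSet)
  omega

/-- Paths in a forest are unique, but here there would be one through `a` and one through `b`. -/
theorem IsAcyclic_no_square {V : Type*} {G : SimpleGraph V} (hG : G.IsAcyclic) {x y a b : V}
    (hxy : x ≠ y) (hab : a ≠ b) (h1 : G.Adj x a) (h2 : G.Adj a y) (h3 : G.Adj x b)
    (h4 : G.Adj b y) : False := by
  have h := (hG.subsingleton_path x y).elim
    (⟨.cons h1 (.cons h2 .nil), by simp [h1.ne, h2.ne, hxy]⟩ : G.Path x y)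
    (⟨.cons h3 (.cons h4 .nil), by simp [h3.ne, h4.ne, hxy]⟩ : G.Path x y)
  have := congrArg (fun p : G.Path x y => p.1.support) h
  simp at this
  exact hab this

/-- A matching-decyclable graph contains no `K_{2,4}`. -/
theorem MDecAvoid.no_K24 {V : Type*} {G : SimpleGraph V} {X : Set V} (h : MDecAvoid G X)
    {x y : V} (hxy : x ≠ y) (d : Fin 4 → V) (hd : Function.Injective d)
    (hx : ∀ i, G.Adj x (d i)) (hy : ∀ i, G.Adj y (d i)) : False := by
  classical
  obtain ⟨M, hMG, hM, -, hac⟩ := h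
  have h1 : (Finset.univ.filter fun i => M.Adj x (d i)).card ≤ 1 := by
    rw [Finset.card_le_one]
    intro i hi j hj
    simp only [Finset.mem_filter, Finset.mem_univ, true_and] at hi hj
    exact hd (hM _ _ _ hi hj)
  have h2 : (Finset.univ.filter fun i => M.Adj y (d i)).card ≤ 1 := by
    rw [Finset.card_le_one]
    intro i hi j hj
    simp only [Finset.mem_filter, Finset.mem_univ, true_and] at hi hj
    exact hd (hM _ _ _ hi hj)
  -- `M` contains at most one edge at `x` and one at `y`, so two of the four common neighbours keep
  -- both edges and form a square with `x` and `y`.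
  have h3 : 1 < (Finset.univ \ ((Finset.univ.filter fun i => M.Adj x (d i)) ∪
      (Finset.univ.filter fun i => M.Adj y (d i)))).card := by
    have a1 := Finset.le_card_sdiff ((Finset.univ.filter fun i => M.Adj x (d i)) ∪
      (Finset.univ.filter fun i => M.Adj y (d i))) Finset.univ
    have a2 := Finset.card_union_le (Finset.univ.filter fun i => M.Adj x (d i))
      (Finset.univ.filter fun i => M.Adj y (d i))
    simp only [Finset.card_univ, Fintype.card_fin] at a1
    omega
  obtain ⟨i, hi, j, hj, hij⟩ := Finset.one_lt_card.1 h3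
  simp only [Finset.mem_sdiff, Finset.mem_union, Finset.mem_filter, Finset.mem_univ, true_and,
    not_or] at hi hj
  exact IsAcyclic_no_square hac hxy (fun h => hij (hd h)) ⟨hx i, hi.1⟩
    (SimpleGraph.Adj.symm ⟨hy i, hi.2⟩) ⟨hx j, hj.1⟩ (SimpleGraph.Adj.symm ⟨hy j, hj.2⟩)

/-! ### Cycles in good graphs -/

section Cycles

variable {V : Type*} {G : SimpleGraph V}

/-- The vertices of `I` in order lead from `u` to `v`. -/
def Lk (G : SimpleGraph V) (u : V) (I : List V) (v : V) : Prop :=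
  (u :: (I ++ [v])).IsChain G.Adj

theorem Lk_nil {u v : V} : Lk G u [] v ↔ G.Adj u v := by simp [Lk]

theorem Lk_cons {u v w : V} {I : List V} : Lk G u (v :: I) w ↔ G.Adj u v ∧ Lk G v I w := by
  simp [Lk]

theorem Lk_append {u v w : V} {I J : List V} :
    Lk G u (I ++ v :: J) w ↔ Lk G u I v ∧ Lk G v J w := by
  induction I generalizing u with
  | nil => simp [Lk_cons, Lk_nil]
  | cons x I ih => rw [List.cons_append, Lk_cons, Lk_cons, ih, and_assoc]

theorem Lk.reverse {u v : V} {I : List V} (h : Lk G u I v) : Lk G v I.reverse u := by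
  induction I generalizing u with
  | nil => rw [Lk_nil] at h; rw [List.reverse_nil, Lk_nil]; exact h.symm
  | cons x I ih =>
    rw [Lk_cons] at h
    rw [List.reverse_cons, Lk_append]
    exact ⟨ih h.2, Lk_nil.2 h.1.symm⟩

/-- The list `a :: t` runs through a cycle. -/
def CycL (G : SimpleGraph V) (a : V) (t : List V) : Prop :=
  Lk G a t a ∧ (a :: t).Nodup ∧ 2 ≤ t.length

/-- Any vertex can be brought to the front; together with `CycL.split`, which cuts along a chord at
the front, this makes every chord usable. -/
theorem CycL.rotate {a v : V} {Q R : List V} (h : CycL G a (Q ++ v :: R)) :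
    CycL G v (R ++ a :: Q) := by
  obtain ⟨h1, h2, h3⟩ := h
  rw [Lk_append] at h1
  refine ⟨Lk_append.2 ⟨h1.2, h1.1⟩, ?_, ?_⟩
  · have : (v :: (R ++ a :: Q)).Perm (a :: (Q ++ v :: R)) := by
      have := List.perm_append_comm (l₁ := v :: R) (l₂ := a :: Q)
      simpa using this
    exact this.nodup_iff.2 h2
  · simp at h3 ⊢; omega

theorem CycL.split {a v : V} {Q R : List V} (h : CycL G a (Q ++ v :: R)) (hav : G.Adj a v)
    (hQ : Q ≠ []) : CycL G a (Q ++ [v]) := by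
  obtain ⟨h1, h2, h3⟩ := h
  rw [Lk_append] at h1
  refine ⟨Lk_append.2 ⟨h1.1, Lk_nil.2 hav.symm⟩, ?_, ?_⟩
  · refine h2.sublist ?_
    refine List.Sublist.cons_cons _ (List.Sublist.append_left ?_ _)
    simp
  · have := List.length_pos_iff.2 hQ
    simp; omega

theorem CycL.of_links {u v : V} {A B : List V} (hA : Lk G u A v) (hB : Lk G u B v)
    (hnd : (u :: v :: (A ++ B)).Nodup) (hne : 1 ≤ A.length + B.length) :
    CycL G u (A ++ v :: B.reverse) := by
  refine ⟨Lk_append.2 ⟨hA, hB.reverse⟩, ?_, ?_⟩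
  · have : (u :: (A ++ v :: B.reverse)).Perm (u :: v :: (A ++ B)) := by
      refine List.Perm.cons _ ?_
      refine List.perm_middle.trans (List.Perm.cons _ ?_)
      exact List.Perm.append_left _ (List.reverse_perm B)
    exact this.nodup_iff.2 hnd
  · simp; omega

theorem CycL.adj_of_succ {a : V} {t : List V} (h : CycL G a t) {i : ℕ}
    (hi : i + 1 < (a :: t).length) : G.Adj (a :: t)[i] (a :: t)[i + 1] := by
  have h1 := h.1
  unfold Lk at h1
  rw [← List.cons_append] at h1
  exact (List.isChain_iff_getElem.1 (List.isChain_append.1 h1).1) i hi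

theorem CycL.adj_last {a : V} {t : List V} (h : CycL G a t) :
    G.Adj (a :: t)[t.length] a := by
  have h1 := h.1
  unfold Lk at h1
  rw [← List.cons_append] at h1
  have := (List.isChain_append.1 h1).2.2 (a :: t)[t.length] (by
    rw [List.getLast?_eq_getElem?]; simp) a (by simp)
  exact this

/-- In a graph without holes, every cycle of length at least `5` has a chord. -/
theorem CycL.exists_chord {a : V} {t : List V} (h : CycL G a t) {k : ℕ}
    (hk : (a :: t).length = k) (hk5 : 5 ≤ k)
    (hG : ¬ (SimpleGraph.cycleGraph k).IsIndContained G) :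
    ∃ (i j : ℕ) (_ : i + 1 < j) (hj : j < (a :: t).length), (i ≠ 0 ∨ j + 1 ≠ k) ∧
      G.Adj (a :: t)[i] (a :: t)[j] := by
  by_contra hno
  push Not at hno
  apply hG
  subst hk
  obtain ⟨m, hm⟩ : ∃ m, (a :: t).length = m + 2 := ⟨(a :: t).length - 2, by omega⟩
  have hinj := List.nodup_iff_injective_get.1 h.2.1
  -- In the absence of chords, the positions on the cycle carry exactly the edges of the cycle
  -- graph, so the cycle is a hole.
  have key : ∀ i j : Fin (a :: t).length, i < j → (G.Adj (a :: t)[i] (a :: t)[j] ↔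
      (SimpleGraph.cycleGraph (a :: t).length).Adj i j) := by
    intro i j hij
    have hij' : i.val < j.val := hij
    rw [SimpleGraph.cycleGraph_adj']
    have e1 : (j - i).val = j.val - i.val := Fin.sub_val_of_le hij.le
    have e2 : (i - j).val = (a :: t).length + i.val - j.val := Fin.coe_sub_iff_lt.2 hij
    rw [e1, e2]
    have hjl := j.isLt
    constructor
    · intro hadj
      by_contra hc
      refine hno i.val j.val (by omega) hjl ?_ hadj
      omega
    · rintro (hc | hc)
      · have h0 : i.val = 0 := by omega
        have h1 : j.val = t.length := by simp at hjl hc; omega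
        have := h.adj_last.symm
        simpa [h0, h1] using this
      · have h1 : j.val = i.val + 1 := by omega
        have := h.adj_of_succ (i := i.val) (by omega)
        simpa [h1] using this
  refine ⟨⟨⟨fun i => (a :: t)[i], fun i j hij => hinj hij⟩, ?_⟩⟩
  intro i j
  change G.Adj (a :: t)[i] (a :: t)[j] ↔ _
  rcases lt_trichotomy i j with hij | rfl | hij
  · exact key i j hij
  · simp
  · rw [SimpleGraph.adj_comm, key j i hij, SimpleGraph.adj_comm]

/-- A chord cuts a cycle into two links. -/
theorem CycL.split_at_chord {a : V} {t : List V} (h : CycL G a t) {i j : ℕ} (hij : i + 1 < j)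
    (hj : j < (a :: t).length) (hne : i ≠ 0 ∨ j + 1 ≠ (a :: t).length)
    (hadj : G.Adj (a :: t)[i] (a :: t)[j]) :
    ∃ u Q v R, Q ≠ [] ∧ R ≠ [] ∧ CycL G u (Q ++ v :: R) ∧ G.Adj u v ∧
      Q.length + R.length + 2 = (a :: t).length := by
  obtain ⟨L1, u, L2, v, L3, hl, h1, h2, h3, hu, hv⟩ : ∃ L1 u L2 v L3,
      a :: t = L1 ++ u :: (L2 ++ v :: L3) ∧ L1.length = i ∧ L2.length = j - i - 1 ∧
      L3.length = (a :: t).length - j - 1 ∧ u = (a :: t)[i] ∧ v = (a :: t)[j] := by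
    refine ⟨(a :: t).take i, (a :: t)[i], ((a :: t).drop (i + 1)).take (j - i - 1), (a :: t)[j],
      (a :: t).drop (j + 1), ?_, ?_, ?_, ?_, rfl, rfl⟩
    · have e1 : (a :: t).drop (i + 1) = ((a :: t).drop (i + 1)).take (j - i - 1) ++
          (a :: t)[j] :: (a :: t).drop (j + 1) := by
        conv_lhs => rw [← List.take_append_drop (j - i - 1) ((a :: t).drop (i + 1))]
        rw [List.drop_drop, show i + 1 + (j - i - 1) = j by omega, List.drop_eq_getElem_cons hj]
      rw [← e1, ← List.drop_eq_getElem_cons, List.take_append_drop]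
    · simp at hj ⊢; omega
    · simp at hj ⊢; omega
    · simp; omega
  rw [← hu, ← hv] at hadj
  have hL2 : L2 ≠ [] := by rintro rfl; simp at h2; omega
  -- If the chord starts at the head of the list, the second link is nonempty because the chord is
  -- not the closing edge. Otherwise the list is rotated, and the old head lies on the second link.
  cases L1 with
  | nil =>
    simp only [List.nil_append, List.cons.injEq] at hl
    obtain ⟨rfl, rfl⟩ := hl
    refine ⟨a, L2, v, L3, hL2, ?_, h, hadj, by simp; omega⟩
    rintro rfl
    simp at h1 h3 hj hne; omega
  | cons b L1 =>
    simp only [List.cons_append, List.cons.injEq] at hl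
    obtain ⟨rfl, rfl⟩ := hl
    have := h.rotate
    rw [List.append_assoc, List.cons_append] at this
    refine ⟨u, L2, v, L3 ++ a :: L1, hL2, by simp, this, hadj, by simp; omega⟩

/-- Vertices and edges are named by positions in a list, so that `decide` can check that concrete
edges are distinct. -/
theorem MDecAvoid.card_pairs {X : Set V} (h : MDecAvoid G X) (l : List V) (hl : l.Nodup) {k : ℕ}
    (hk : l.length = k) (hk1 : 1 ≤ k) (L : List (Fin k × Fin k))
    (hL : L.Nodup) (hlt : ∀ p ∈ L, p.1 < p.2)
    (hadj : ∀ p ∈ L, G.Adj (l.get (p.1.cast hk.symm)) (l.get (p.2.cast hk.symm))) :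
    2 * L.length + 2 ≤ 3 * k := by
  classical
  replace hL : (L.map fun p => s(p.1, p.2)).Nodup := by
    refine hL.map_on fun p hp q hq hpq => ?_
    rcases Sym2.eq_iff.1 hpq with ⟨h1, h2⟩ | ⟨h1, h2⟩
    · exact Prod.ext h1 h2
    · have hp' := hlt p hp
      rw [h1, h2] at hp'
      exact absurd hp' (hlt q hq).asymm
  have := h.card_edges hk1 (fun i => l.get (i.cast hk.symm))
    (fun i j hij => by
      have := List.nodup_iff_injective_get.1 hl hij
      exact Fin.ext (by simpa using congrArg Fin.val this))
    (L.map fun p => s(p.1, p.2)).toFinset (by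
      intro a b hab
      simp only [List.mem_toFinset, List.mem_map] at hab
      obtain ⟨p, hp, he⟩ := hab
      have := hadj p hp
      rcases Sym2.eq_iff.1 he with ⟨h1, h2⟩ | ⟨h1, h2⟩
      · rwa [h1, h2] at this
      · rw [h1, h2] at this; exact this.symm)
  rw [List.toFinset_card_of_nodup hL, List.length_map] at this
  exact this

theorem isIndContained_of_list {k : ℕ} {P : SimpleGraph (Fin k)} (l : List V) (hl : l.Nodup)
    (hk : l.length = k)
    (h : ∀ i j : Fin k, i < j →
      (G.Adj (l.get (i.cast hk.symm)) (l.get (j.cast hk.symm)) ↔ P.Adj i j)) :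
    P.IsIndContained G := by
  refine ⟨⟨⟨fun i => l.get (i.cast hk.symm), fun i j hij => ?_⟩, ?_⟩⟩
  · have := List.nodup_iff_injective_get.1 hl hij
    exact Fin.ext (by simpa using congrArg Fin.val this)
  · intro i j
    change G.Adj (l.get (i.cast hk.symm)) (l.get (j.cast hk.symm)) ↔ _
    rcases lt_trichotomy i j with hij | rfl | hij
    · exact h i j hij
    · simp
    · rw [SimpleGraph.adj_comm, h j i hij, SimpleGraph.adj_comm]

/-! ### Possible cycle lengths and systems of disjoint links -/

variable {X : Set V}

/-- Five vertices carry at most six edges, so the cycle has no chord besides `uv`. Then it is an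
induced house: the square `u v r s` with the roof `q`. -/
theorem Good.no_five_of_chord (h : Good G X) {u q v r s : V} (hc : CycL G u [q, v, r, s])
    (huv : G.Adj u v) : False := by
  obtain ⟨h1, hnd, -⟩ := hc
  simp only [Lk_cons, Lk_nil] at h1
  obtain ⟨e1, e2, e3, e4, e5⟩ := h1
  have count : ∀ x y : Fin 5, G.Adj ([u, q, v, r, s].get x) ([u, q, v, r, s].get y) →
      x < y → (x, y) ∉ [(0, 1), (1, 2), (2, 3), (3, 4), (0, 4), (0, 2)] → False := by
    intro x y hxy hlt hn
    have := h.2.card_pairs [u, q, v, r, s] hnd (k := 5) rfl (by norm_num)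
      ((x, y) :: [(0, 1), (1, 2), (2, 3), (3, 4), (0, 4), (0, 2)])
      (List.nodup_cons.2 ⟨hn, by decide⟩) (List.forall_mem_cons.2 ⟨hlt, by decide⟩) (by
        simp only [List.mem_cons, List.not_mem_nil, or_false, forall_eq_or_imp, forall_eq]
        exact ⟨hxy, e1, e2, e3, e4, e5.symm, huv⟩)
    simp at this
  have n1 : ¬ G.Adj q r := fun hx => count 1 3 hx (by decide) (by decide)
  have n2 : ¬ G.Adj q s := fun hx => count 1 4 hx (by decide) (by decide)
  have n3 : ¬ G.Adj u r := fun hx => count 0 3 hx (by decide) (by decide)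
  have n4 : ¬ G.Adj v s := fun hx => count 2 4 hx (by decide) (by decide)
  refine h.1.1 (isIndContained_of_list [u, v, r, s, q] ?_ rfl ?_)
  · refine (List.Perm.nodup_iff ?_).1 hnd
    refine List.Perm.cons _ ?_
    have := List.perm_append_comm (l₁ := [q]) (l₂ := [v, r, s])
    simpa using this
  · simp only [houseGraph, SimpleGraph.fromEdgeSet_adj, Fin.forall_fin_succ, Fin.isValue]
    simp [huv, e3, e4, e5.symm, e1, e2.symm, n3, n4, G.adj_comm r q, G.adj_comm s q, n1, n2]

theorem Good.no_five (h : Good G X) {a b c d e : V} (hc : CycL G a [b, c, d, e]) : False := by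
  obtain ⟨i, j, hij, hj, hne, hadj⟩ := hc.exists_chord (k := 5) rfl le_rfl (h.1.2.1 5 le_rfl)
  obtain ⟨u, Q, v, R, hQ, hR, hcy, huv, hlen⟩ := hc.split_at_chord hij hj hne hadj
  simp only [List.length_cons, List.length_nil] at hlen
  have h1 := List.length_pos_iff.2 hQ
  have h2 := List.length_pos_iff.2 hR
  rcases (by omega : (Q.length = 1 ∧ R.length = 2) ∨ (Q.length = 2 ∧ R.length = 1)) with
    ⟨l1, l2⟩ | ⟨l1, l2⟩
  · obtain ⟨q, rfl⟩ := List.length_eq_one_iff.1 l1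
    obtain ⟨r, s, rfl⟩ := List.length_eq_two.1 l2
    exact h.no_five_of_chord hcy huv
  · obtain ⟨q, rfl⟩ := List.length_eq_one_iff.1 l2
    obtain ⟨r, s, rfl⟩ := List.length_eq_two.1 l1
    exact h.no_five_of_chord hcy.rotate huv.symm

/-- Such a chord would cut off one vertex and leave a 5-cycle. -/
theorem Good.no_short_chord_six (h : Good G X) {a b c d e f : V}
    (hc : CycL G a [b, c, d, e, f]) : ¬ G.Adj a c := by
  intro hac
  have := (CycL.rotate (Q := [b]) (R := [d, e, f]) hc)
  exact h.no_five (CycL.split (Q := [d, e, f]) (R := [b]) this hac.symm (by simp))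

/-- A 6-cycle in a good graph with a long chord has a further long chord. -/
theorem Good.six_of_chord (h : Good G X) {a b c d e f : V} (hc : CycL G a [b, c, d, e, f])
    (had : G.Adj a d) : G.Adj b e ∨ G.Adj c f := by
  by_contra hno
  push Not at hno
  have s1 := h.no_short_chord_six hc
  have c2 := CycL.rotate (Q := []) (R := [c, d, e, f]) hc
  have s2 := h.no_short_chord_six c2
  have c3 := CycL.rotate (Q := []) (R := [d, e, f, a]) c2
  have s3 := h.no_short_chord_six c3
  have c4 := CycL.rotate (Q := []) (R := [e, f, a, b]) c3
  have s4 := h.no_short_chord_six c4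
  have c5 := CycL.rotate (Q := []) (R := [f, a, b, c]) c4
  have s5 := h.no_short_chord_six c5
  have c6 := CycL.rotate (Q := []) (R := [a, b, c, d]) c5
  have s6 := h.no_short_chord_six c6
  obtain ⟨h1, hnd, -⟩ := hc
  simp only [Lk_cons, Lk_nil] at h1
  obtain ⟨e1, e2, e3, e4, e5, e6⟩ := h1
  -- Without further chords this is an induced domino: the squares `b a d c` and `a f e d` share the
  -- edge `ad`.
  refine h.1.2.2.1 (isIndContained_of_list [b, a, d, c, f, e] ?_ rfl ?_)
  · simp only [List.nodup_cons, List.mem_cons, List.not_mem_nil, or_false, not_or,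
      List.nodup_nil, not_false_iff, and_true] at hnd ⊢
    grind
  · simp only [dominoGraph, SimpleGraph.fromEdgeSet_adj, Fin.forall_fin_succ, Fin.isValue]
    simp [e1.symm, e2, e3.symm, e4, e5.symm, e6.symm, had, s1, s2, s3, G.adj_comm d b,
      G.adj_comm b f, G.adj_comm a e, G.adj_comm f d, s4, s5, s6, hno]

/-- The cycle is not a hole and has no short chord, so it has a long one, and with only one long
chord it would be a domino. Hence at least two of the three long chords are present. -/
theorem Good.six (h : Good G X) {a b c d e f : V} (hc : CycL G a [b, c, d, e, f]) :
    (G.Adj a d ∧ G.Adj b e) ∨ (G.Adj b e ∧ G.Adj c f) ∨ (G.Adj a d ∧ G.Adj c f) := by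
  have c2 := CycL.rotate (Q := []) (R := [c, d, e, f]) hc
  have c3 := CycL.rotate (Q := []) (R := [d, e, f, a]) c2
  have some_chord : G.Adj a d ∨ G.Adj b e ∨ G.Adj c f := by
    by_contra hno
    push Not at hno
    have s1 := h.no_short_chord_six hc
    have s2 := h.no_short_chord_six c2
    have s3 := h.no_short_chord_six c3
    have c4 := CycL.rotate (Q := []) (R := [e, f, a, b]) c3
    have s4 := h.no_short_chord_six c4
    have c5 := CycL.rotate (Q := []) (R := [f, a, b, c]) c4
    have s5 := h.no_short_chord_six c5
    have c6 := CycL.rotate (Q := []) (R := [a, b, c, d]) c5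
    have s6 := h.no_short_chord_six c6
    obtain ⟨i, j, hij, hj, hne, hadj⟩ := hc.exists_chord (k := 6) rfl (by norm_num)
      (h.1.2.1 6 (by norm_num))
    simp only [List.length_cons, List.length_nil] at hj
    have : j = 2 ∨ j = 3 ∨ j = 4 ∨ j = 5 := by omega
    have hi : i < 4 := by omega
    rcases this with rfl | rfl | rfl | rfl <;> interval_cases i <;>
      first | omega | simp_all [G.adj_comm]
  rcases some_chord with h1 | h1 | h1
  · rcases h.six_of_chord hc h1 with h2 | h2
    · exact Or.inl ⟨h1, h2⟩
    · exact Or.inr (Or.inr ⟨h1, h2⟩)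
  · rcases h.six_of_chord c2 h1 with h2 | h2
    · exact Or.inr (Or.inl ⟨h1, h2⟩)
    · exact Or.inl ⟨h2.symm, h1⟩
  · rcases h.six_of_chord c3 h1 with h2 | h2
    · exact Or.inr (Or.inr ⟨h2.symm, h1⟩)
    · exact Or.inr (Or.inl ⟨h2.symm, h1⟩)

/-- The chord `uv` leaves the 6-cycle `v r s t w u`. Two of its long chords `vt`, `rw`, `su` exist,
so `vt` or `su` does, and either one closes a 5-cycle through `q`. -/
theorem Good.no_seven_of_chord (h : Good G X) {u q v r s t w : V}
    (hc : CycL G u [q, v, r, s, t, w]) (huv : G.Adj u v) : False := by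
  have c6 : CycL G v [r, s, t, w, u] :=
    CycL.split (Q := [r, s, t, w]) (R := [q])
      (CycL.rotate (Q := [q]) (R := [r, s, t, w]) hc) huv.symm (by simp)
  have no1 : ¬ G.Adj r u := fun hx => by
    have := CycL.rotate (Q := []) (CycL.rotate (Q := [q]) (R := [r, s, t, w]) hc)
    exact h.no_five (CycL.split (Q := [s, t, w]) (R := [q, v]) this hx (by simp))
  have no2 : ¬ G.Adj u s := fun hx =>
    h.no_five (CycL.split (Q := [q, v, r]) (R := [t, w]) hc hx (by simp))
  have no3 : ¬ G.Adj v t := fun hx => by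
    have := CycL.rotate (Q := [q]) (R := [r, s, t, w]) hc
    have := CycL.rotate (Q := [r, s]) (R := [w, u, q]) this
    exact h.no_five (CycL.split (Q := [w, u, q]) (R := [r, s]) this hx.symm (by simp))
  rcases h.six c6 with h1 | h1 | h1
  · exact no3 h1.1
  · exact no2 h1.2.symm
  · exact no3 h1.1

/-- Eight vertices carry at most eleven edges, so an 8-cycle has at most three chords. -/
theorem Good.no_eight_of_chords (h : Good G X) {a b c d e f g i : V}
    (hc : CycL G a [b, c, d, e, f, g, i]) (x1 y1 x2 y2 x3 y3 x4 y4 : Fin 8)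
    (hnd : [(0, 1), (1, 2), (2, 3), (3, 4), (4, 5), (5, 6), (6, 7), (0, 7), (x1, y1), (x2, y2),
      (x3, y3), (x4, y4)].Nodup)
    (hlt : ∀ p ∈ [(x1, y1), (x2, y2), (x3, y3), (x4, y4)], p.1 < p.2)
    (h1 : G.Adj ([a, b, c, d, e, f, g, i].get x1) ([a, b, c, d, e, f, g, i].get y1))
    (h2 : G.Adj ([a, b, c, d, e, f, g, i].get x2) ([a, b, c, d, e, f, g, i].get y2))
    (h3 : G.Adj ([a, b, c, d, e, f, g, i].get x3) ([a, b, c, d, e, f, g, i].get y3))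
    (h4 : G.Adj ([a, b, c, d, e, f, g, i].get x4) ([a, b, c, d, e, f, g, i].get y4)) : False := by
  obtain ⟨hl, hn, -⟩ := hc
  simp only [Lk_cons, Lk_nil] at hl
  obtain ⟨e1, e2, e3, e4, e5, e6, e7, e8⟩ := hl
  have := h.2.card_pairs [a, b, c, d, e, f, g, i] hn (k := 8) rfl (by norm_num)
    _ hnd (by
      simp only [List.mem_cons, List.not_mem_nil, or_false, forall_eq_or_imp, forall_eq] at hlt ⊢
      exact ⟨by decide, by decide, by decide, by decide, by decide, by decide, by decide,
        by decide, hlt⟩) (by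
      simp only [List.mem_cons, List.not_mem_nil, or_false, forall_eq_or_imp, forall_eq]
      exact ⟨e1, e2, e3, e4, e5, e6, e7, e8.symm, h1, h2, h3, h4⟩)
  simp at this

/-- The 6-cycle `d e f g i a` cut off by `ad` has two long chords, among them `af` or `dg`. That one
closes a second 6-cycle, `a b c d e f` or `g i a b c d`, which has `ad` as a long chord and needs
another one. This makes four chords. -/
theorem Good.no_eight_of_chord (h : Good G X) {a b c d e f g i : V}
    (hc : CycL G a [b, c, d, e, f, g, i]) (had : G.Adj a d) : False := by
  have hd := CycL.rotate (Q := [b, c]) (R := [e, f, g, i]) hc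
  have k1 : CycL G d [e, f, g, i, a] := CycL.split (Q := [e, f, g, i]) (R := [b, c]) hd had.symm
    (by simp)
  have from_af : G.Adj a f → G.Adj b e ∨ G.Adj c f := fun haf => by
    have k2 : CycL G a [b, c, d, e, f] :=
      CycL.split (Q := [b, c, d, e]) (R := [g, i]) hc haf (by simp)
    exact h.six_of_chord k2 had
  have from_dg : G.Adj d g → G.Adj g b ∨ G.Adj i c := fun hdg => by
    have hg := CycL.rotate (Q := [e, f]) (R := [i, a, b, c]) hd
    have k2 : CycL G g [i, a, b, c, d] :=
      CycL.split (Q := [i, a, b, c]) (R := [e, f]) hg hdg.symm (by simp)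
    rcases h.six k2 with h1 | h1 | h1
    · exact Or.inl h1.1
    · exact Or.inr h1.1
    · exact Or.inl h1.1
  rcases h.six k1 with ⟨h1, h2⟩ | ⟨h1, h2⟩ | ⟨h1, h2⟩
  · rcases from_dg h1 with h3 | h3
    · exact h.no_eight_of_chords hc 0 3 3 6 4 7 1 6 (by decide) (by decide) had h1 h2 h3.symm
    · exact h.no_eight_of_chords hc 0 3 3 6 4 7 2 7 (by decide) (by decide) had h1 h2 h3.symm
  · rcases from_af h2.symm with h3 | h3
    · exact h.no_eight_of_chords hc 0 3 4 7 0 5 1 4 (by decide) (by decide) had h1 h2.symm h3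
    · exact h.no_eight_of_chords hc 0 3 4 7 0 5 2 5 (by decide) (by decide) had h1 h2.symm h3
  · rcases from_af h2.symm with h3 | h3
    · exact h.no_eight_of_chords hc 0 3 3 6 0 5 1 4 (by decide) (by decide) had h1 h2.symm h3
    · exact h.no_eight_of_chords hc 0 3 3 6 0 5 2 5 (by decide) (by decide) had h1 h2.symm h3

/-- The 6-cycle `a b c d e f` has the long chord `ad` or `be`, and either one cuts two vertices off
the 10-cycle and leaves an 8-cycle. -/
theorem Good.no_ten_of_chord (h : Good G X) {a b c d e f g i j k : V}
    (hno : ∀ a (t : List V), CycL G a t → t.length ≠ 7)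
    (hc : CycL G a [b, c, d, e, f, g, i, j, k]) (haf : G.Adj a f) : False := by
  have hk : CycL G a [b, c, d, e, f] :=
    CycL.split (Q := [b, c, d, e]) (R := [g, i, j, k]) hc haf (by simp)
  have far : ∀ {x y z w : V} {R : List V}, CycL G x ([y, z] ++ w :: R) → R.length = 6 →
      ¬ G.Adj x w := by
    intro x y z w R hx hR hxw
    refine hno _ _ (CycL.split (Q := R) (R := [y, z]) hx.rotate hxw.symm ?_) (by simp [hR])
    rintro rfl; simp at hR
  have had := far (R := [e, f, g, i, j, k]) hc rfl
  rcases h.six hk with h1 | h1 | h1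
  · exact had h1.1
  · exact far (R := [f, g, i, j, k, a])
      (CycL.rotate (Q := []) (R := [c, d, e, f, g, i, j, k]) hc) rfl h1.1
  · exact had h1.1

/-- The cycles of a good graph have length `3`, `4` or `6`. -/
theorem Good.cycle_length (h : Good G X) (k : ℕ) : ∀ (a : V) (t : List V), CycL G a t →
    t.length + 1 = k → k = 3 ∨ k = 4 ∨ k = 6 := by
  induction k using Nat.strong_induction_on with
  | _ k ih =>
  intro a t hc hk
  have h2 := hc.2.2
  rcases (by omega : k = 3 ∨ k = 4 ∨ k = 5 ∨ k = 6 ∨ 7 ≤ k) with hk' | hk' | hk' | hk' | hk'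
  · exact Or.inl hk'
  · exact Or.inr (Or.inl hk')
  · exfalso
    obtain ⟨b, t, rfl⟩ := List.exists_cons_of_length_pos (l := t) (by omega)
    obtain ⟨c, d, e, rfl⟩ := List.length_eq_three.1 (show t.length = 3 by simp at hk; omega)
    exact h.no_five hc
  · exact Or.inr (Or.inr hk')
  exfalso
  obtain ⟨i, j, hij, hj, hne, hadj⟩ := hc.exists_chord (k := k) (by simpa using hk) (by omega)
    (h.1.2.1 k (by omega))
  obtain ⟨u, Q, v, R, hQ, hR, hcy, huv, hlen⟩ := hc.split_at_chord hij hj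
    (by simpa [hk] using hne) hadj
  have hcy' := hcy.rotate
  have c1 := hcy.split huv hQ
  have c2 := hcy'.split huv.symm hR
  have p1 := List.length_pos_iff.2 hQ
  have p2 := List.length_pos_iff.2 hR
  simp only [List.length_cons] at hlen
  have i1 := ih (Q.length + 2) (by omega) _ _ c1 (by simp)
  have i2 := ih (R.length + 2) (by omega) _ _ c2 (by simp)
  have four : ∀ l : List V, l.length = 4 → ∃ a b c d, l = [a, b, c, d] := by
    intro l hl
    obtain ⟨b, t, rfl⟩ := List.exists_cons_of_length_pos (l := l) (by omega)
    obtain ⟨c, d, e, rfl⟩ := List.length_eq_three.1 (show t.length = 3 by simp at hl; omega)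
    exact ⟨_, _, _, _, rfl⟩
  -- A chord cuts a `k`-cycle into two cycles of total length `k + 2`. By induction both have length
  -- 3, 4 or 6, so for `k ≥ 7` at least one has length 6, and `k` is 7, 8 or 10.
  rcases (by omega : (Q.length = 1 ∧ R.length = 4) ∨ (Q.length = 4 ∧ R.length = 1) ∨
      (Q.length = 2 ∧ R.length = 4) ∨ (Q.length = 4 ∧ R.length = 2) ∨
      (Q.length = 4 ∧ R.length = 4)) with ⟨l1, l2⟩ | ⟨l1, l2⟩ | ⟨l1, l2⟩ | ⟨l1, l2⟩ | ⟨l1, l2⟩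
  · obtain ⟨q, rfl⟩ := List.length_eq_one_iff.1 l1
    obtain ⟨_, _, _, _, rfl⟩ := four _ l2
    exact h.no_seven_of_chord hcy huv
  · obtain ⟨q, rfl⟩ := List.length_eq_one_iff.1 l2
    obtain ⟨_, _, _, _, rfl⟩ := four _ l1
    exact h.no_seven_of_chord hcy' huv.symm
  · obtain ⟨_, _, rfl⟩ := List.length_eq_two.1 l1
    obtain ⟨_, _, _, _, rfl⟩ := four _ l2
    exact h.no_eight_of_chord hcy huv
  · obtain ⟨_, _, rfl⟩ := List.length_eq_two.1 l2
    obtain ⟨_, _, _, _, rfl⟩ := four _ l1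
    exact h.no_eight_of_chord hcy' huv.symm
  · obtain ⟨_, _, _, _, rfl⟩ := four _ l1
    obtain ⟨_, _, _, _, rfl⟩ := four _ l2
    refine h.no_ten_of_chord (fun a t ht h7 => ?_) hcy huv
    have := ih 8 (by omega) a t ht (by omega)
    omega

/-- Seven vertices carry at most nine edges, but the 6-cycle, two of its long chords and two edges
at `w` are ten. -/
theorem Good.no_ear_of_pairs (h : Good G X) {a b c d e f w : V}
    (hc : CycL G a [b, c, d, e, f]) (hw : w ∉ [a, b, c, d, e, f]) {x y : Fin 7}
    (h1 : G.Adj w ([a, b, c, d, e, f, w].get x)) (h2 : G.Adj w ([a, b, c, d, e, f, w].get y))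
    (hx : x < 6) (hy : y < 6) (hxy : x ≠ y) : False := by
  have hs := h.six hc
  obtain ⟨hl, hn, -⟩ := hc
  simp only [Lk_cons, Lk_nil] at hl
  obtain ⟨e1, e2, e3, e4, e5, e6⟩ := hl
  have hn' : [a, b, c, d, e, f, w].Nodup := by
    have : [a, b, c, d, e, f, w] = [a, b, c, d, e, f] ++ [w] := rfl
    rw [this, List.nodup_append]
    refine ⟨hn, by simp, ?_⟩
    rintro p hp q hq rfl
    rw [List.mem_singleton] at hq
    subst hq; exact hw hp
  have key : ∀ p q r s : Fin 7, [(0, 1), (1, 2), (2, 3), (3, 4), (4, 5), (0, 5), (p, q), (r, s),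
      (x, 6), (y, 6)].Nodup → p < q → r < s →
      G.Adj ([a, b, c, d, e, f, w].get p) ([a, b, c, d, e, f, w].get q) →
      G.Adj ([a, b, c, d, e, f, w].get r) ([a, b, c, d, e, f, w].get s) → False := by
    intro p q r s hnd hpq hrs h3 h4
    have := h.2.card_pairs [a, b, c, d, e, f, w] hn' (k := 7) rfl (by norm_num) _ hnd (by
      simp only [List.mem_cons, List.not_mem_nil, or_false, forall_eq_or_imp, forall_eq]
      exact ⟨by decide, by decide, by decide, by decide, by decide, by decide, hpq, hrs, hx, hy⟩)
      (by
      simp only [List.mem_cons, List.not_mem_nil, or_false, forall_eq_or_imp, forall_eq]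
      exact ⟨e1, e2, e3, e4, e5, e6.symm, h3, h4, h1.symm, h2.symm⟩)
    simp at this
  rcases hs with ⟨h3, h4⟩ | ⟨h3, h4⟩ | ⟨h3, h4⟩
  · exact key 0 3 1 4 (by simp [hxy]) (by decide) (by decide) h3 h4
  · exact key 1 4 2 5 (by simp [hxy]) (by decide) (by decide) h3 h4
  · exact key 0 3 2 5 (by simp [hxy]) (by decide) (by decide) h3 h4

/-- In a good graph, no vertex outside a 6-cycle has two neighbours on it. -/
theorem Good.no_ear_of_six (h : Good G X) {a : V} {t : List V} (hc : CycL G a t)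
    (ht : t.length = 5) {w x y : V} (hw : w ∉ a :: t) (hx : x ∈ a :: t) (hy : y ∈ a :: t)
    (hxy : x ≠ y) (h1 : G.Adj w x) (h2 : G.Adj w y) : False := by
  obtain ⟨b, t, rfl⟩ := List.exists_cons_of_length_pos (l := t) (by omega)
  obtain ⟨c, t, rfl⟩ := List.exists_cons_of_length_pos (l := t) (by simp at ht; omega)
  obtain ⟨d, e, f, rfl⟩ := List.length_eq_three.1 (show t.length = 3 by simp at ht; omega)
  obtain ⟨i, hi, rfl⟩ := List.getElem_of_mem hx
  obtain ⟨j, hj, rfl⟩ := List.getElem_of_mem hy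
  simp only [List.length_cons, List.length_nil] at hi hj
  have get : ∀ (i : ℕ) (hi : i < 6), [a, b, c, d, e, f][i]'hi =
      [a, b, c, d, e, f, w].get (⟨i, by omega⟩ : Fin 7) := by
    intro i hi; interval_cases i <;> rfl
  rw [get i hi] at h1
  rw [get j hj] at h2
  refine h.no_ear_of_pairs hc hw h1 h2 ?_ ?_ ?_
  · exact hi
  · exact hj
  · intro h; have := congrArg Fin.val h; simp at this; subst this; exact hxy rfl

/-- The first two links form a 6-cycle, on which `w` would have the two neighbours `u` and `v`. -/
theorem Good.no_two_links_and_ear (h : Good G X) {u v w : V} {A B : List V}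
    (hc : CycL G u (A ++ v :: B.reverse)) (hl : A.length + B.length = 4)
    (hw : Lk G u [w] v) (hn : (u :: v :: (A ++ B ++ [w])).Nodup) : False := by
  rw [Lk_cons, Lk_nil] at hw
  have hp : (w :: u :: (A ++ v :: B.reverse)).Nodup := by
    refine (List.Perm.nodup_iff ?_).1 hn
    have e1 : (u :: v :: (A ++ B ++ [w])).Perm (w :: u :: v :: (A ++ B)) := by
      have := List.perm_append_comm (l₁ := u :: v :: (A ++ B)) (l₂ := [w])
      simpa using this
    refine e1.trans (List.Perm.cons _ (List.Perm.cons _ ?_))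
    refine List.Perm.trans ?_ List.perm_middle.symm
    exact List.Perm.cons _ (List.Perm.append_left _ (List.reverse_perm B).symm)
  refine h.no_ear_of_six hc (by simp; omega) (w := w) (x := u) (y := v) (List.nodup_cons.1 hp).1
    (by simp) (by simp) ?_ hw.1.symm hw.2
  rintro rfl
  simp at hn

/-- The edge `xw` between two of the links gives the 8-cycle `u c d v y x w z`. -/
theorem Good.no_theta_two_of_adj (h : Good G X) {u v x y z w c d : V}
    (e2 : G.Adj x y) (e3 : G.Adj y v) (e4 : G.Adj u z) (e5 : G.Adj z w)
    (e7 : G.Adj x w) (f1 : G.Adj u c) (f2 : G.Adj c d) (f3 : G.Adj d v)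
    (hn : (u :: v :: ([x, y] ++ [z, w] ++ [c, d])).Nodup) : False := by
  have cy : CycL G u [c, d, v, y, x, w, z] := by
    refine ⟨?_, ?_, by simp⟩
    · simp only [Lk_cons, Lk_nil]
      exact ⟨f1, f2, f3, e3.symm, e2.symm, e7, e5.symm, e4.symm⟩
    · refine (List.Perm.nodup_iff ?_).1 hn
      refine List.Perm.cons _ ?_
      have p1 := List.perm_append_comm (l₁ := [v, x, y, z, w]) (l₂ := [c, d])
      refine p1.trans ?_
      refine List.Perm.cons _ (List.Perm.cons _ (List.Perm.cons _ ?_))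
      exact (List.Perm.swap y x [z, w]).trans
        (List.Perm.cons _ (List.Perm.cons _ (List.Perm.swap w z [])))
  have := h.cycle_length 8 _ _ cy rfl
  omega

/-- Three internally disjoint links between two vertices of a good graph. -/
theorem Good.theta (h : Good G X) {u v : V} {A B C : List V} (hA : Lk G u A v) (hB : Lk G u B v)
    (hC : Lk G u C v) (hnd : (u :: v :: (A ++ B ++ C)).Nodup) (hB0 : B ≠ []) (hC0 : C ≠ []) :
    (A.length = 0 ∧ B.length = 1 ∧ C.length = 1) ∨ (A.length = 1 ∧ B.length = 1 ∧ C.length = 1) ∨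
    (A.length = 0 ∧ B.length = 2 ∧ C.length = 2) := by
  have p1 := List.length_pos_iff.2 hB0
  have p2 := List.length_pos_iff.2 hC0
  have nAB : (u :: v :: (A ++ B)).Nodup := hnd.sublist (by simp)
  have nAC : (u :: v :: (A ++ C)).Nodup := hnd.sublist (by simp)
  have nBC : (u :: v :: (B ++ C)).Nodup := hnd.sublist (by simp)
  have cAB := CycL.of_links hA hB nAB (by omega)
  have cAC := CycL.of_links hA hC nAC (by omega)
  have cBC := CycL.of_links hB hC nBC (by omega)
  have l1 := h.cycle_length _ _ _ cAB rfl
  have l2 := h.cycle_length _ _ _ cAC rfl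
  have l3 := h.cycle_length _ _ _ cBC rfl
  simp only [List.length_append, List.length_cons, List.length_reverse] at l1 l2 l3
  have perm1 : (u :: v :: (A ++ C ++ B)).Nodup := by
    refine (List.Perm.nodup_iff ?_).1 hnd
    refine List.Perm.cons _ (List.Perm.cons _ ?_)
    rw [List.append_assoc, List.append_assoc]
    exact List.Perm.append_left _ List.perm_append_comm
  -- Any two links form a cycle, so the pairwise sums of the lengths are 1, 2 or 4. This leaves
  -- seven triples, the last four of which are excluded below.
  have cases : (A.length = 0 ∧ B.length = 1 ∧ C.length = 1) ∨
    (A.length = 1 ∧ B.length = 1 ∧ C.length = 1) ∨ (A.length = 0 ∧ B.length = 2 ∧ C.length = 2) ∨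
    (A.length = 3 ∧ B.length = 1 ∧ C.length = 1) ∨ (A.length = 1 ∧ B.length = 1 ∧ C.length = 3) ∨
    (A.length = 1 ∧ B.length = 3 ∧ C.length = 1) ∨ (A.length = 2 ∧ B.length = 2 ∧ C.length = 2) := by
    clear cAB cAC cBC nAB nAC nBC hnd perm1 hA hB hC hB0 hC0
    generalize A.length = x, B.length = y, C.length = z at *
    have hx : x ≤ 3 := by omega
    have hy : y ≤ 3 := by omega
    have hz : z ≤ 3 := by omega
    interval_cases x <;> interval_cases y <;> interval_cases z <;> simp_all
  rcases cases
    with hh | hh | hh | ⟨k1, k2, k3⟩ | ⟨k1, k2, k3⟩ | ⟨k1, k2, k3⟩ | ⟨k1, k2, k3⟩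
  · exact Or.inl hh
  · exact Or.inr (Or.inl hh)
  · exact Or.inr (Or.inr hh)
  · obtain ⟨c, rfl⟩ := List.length_eq_one_iff.1 k3
    exact (h.no_two_links_and_ear cAB (by omega) hC hnd).elim
  · obtain ⟨c, rfl⟩ := List.length_eq_one_iff.1 k2
    exact (h.no_two_links_and_ear cAC (by omega) hB perm1).elim
  · obtain ⟨c, rfl⟩ := List.length_eq_one_iff.1 k3
    exact (h.no_two_links_and_ear cAB (by omega) hC hnd).elim
  -- Of the long chords of the 6-cycle `u a1 a2 v b2 b1` two are present, hence one other than `uv`.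
  -- It joins two links and leads to an 8-cycle through `c1` and `c2`.
  · exfalso
    obtain ⟨c1, c2, rfl⟩ := List.length_eq_two.1 k3
    obtain ⟨b1, b2, rfl⟩ := List.length_eq_two.1 k2
    obtain ⟨a1, a2, rfl⟩ := List.length_eq_two.1 k1
    simp only [Lk_cons, Lk_nil] at hA hB hC
    have e8 : G.Adj a1 b2 → False := fun hx =>
      h.no_theta_two_of_adj hA.2.1 hA.2.2 hB.1 hB.2.1 hx hC.1 hC.2.1 hC.2.2 hnd
    have e8' : G.Adj b1 a2 → False := fun hx =>
      h.no_theta_two_of_adj hB.2.1 hB.2.2 hA.1 hA.2.1 hx hC.1 hC.2.1 hC.2.2 (by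
        refine (List.Perm.nodup_iff ?_).1 hnd
        refine List.Perm.cons _ (List.Perm.cons _ ?_)
        exact List.Perm.append_right _ List.perm_append_comm)
    have := h.six (a := u) (b := a1) (c := a2) (d := v) (e := b2) (f := b1) (by simpa using cAB)
    rcases this with h1 | h1 | h1
    · exact e8 h1.2
    · exact e8 h1.1
    · exact e8' h1.2.symm

end Cycles

/-! ### Depth-first search trees -/

theorem nodup_append_of_disjoint {V : Type*} {l l' : List V} (h : l.Nodup) (h' : l'.Nodup)
    (hd : ∀ a ∈ l, a ∉ l') : (l ++ l').Nodup :=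
  List.nodup_append.2 ⟨h, h', fun a ha _ hb hab => hd a ha (hab ▸ hb)⟩

/-- Reduces the distinctness of the vertices on reordered or reversed parts of a list to a
comparison of multiplicities, which is linear arithmetic. -/
theorem nodup_of_count_le {l m : List ℕ} (hm : m.Nodup) (h : ∀ a, l.count a ≤ m.count a) :
    l.Nodup :=
  List.nodup_iff_count_le_one.2 fun a => (h a).trans (List.nodup_iff_count_le_one.1 hm a)

/-- Along the tree path `f < g < h < j` the numbers alone separate most of the lists; disjointness
has to be supplied only for the branches `B`, `E` and `E'` that leave this path. -/
theorem nodup_ears {A B E J E' J' : List ℕ} {f g h j : ℕ} (hfg : f < g) (hgh : g < h)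
    (hhj : h < j)
    (nA : A.Nodup) (nB : B.Nodup) (nE : E.Nodup) (nJ : J.Nodup) (nE' : E'.Nodup) (nJ' : J'.Nodup)
    (A1 : ∀ y ∈ A, h < y ∧ y < j) (B1 : ∀ y ∈ B, j < y) (E1 : ∀ y ∈ E, j < y)
    (J1 : ∀ y ∈ J, g < y ∧ y < h) (E1' : ∀ y ∈ E', g < y) (J1' : ∀ y ∈ J', f < y ∧ y < g)
    (dBE : ∀ y ∈ B, y ∉ E) (d1 : ∀ y ∈ E', ¬ (y ∈ A ∨ y = j ∨ y ∈ B ∨ y ∈ E))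
    (d2 : ∀ y ∈ E', y ≠ h ∧ y ∉ J) :
    (A ++ B ++ E ++ J ++ (E' ++ f :: J') ++ [j, h, g]).Nodup := by
  refine nodup_append_of_disjoint (nodup_append_of_disjoint (nodup_append_of_disjoint
    (nodup_append_of_disjoint (nodup_append_of_disjoint nA nB ?_) nE ?_) nJ ?_)
    (nodup_append_of_disjoint nE' (List.nodup_cons.2 ⟨?_, nJ'⟩) ?_) ?_) ?_ ?_
  · intro y hy hy'; have := A1 y hy; have := B1 y hy'; omega
  · intro y hy hy'
    have := E1 y hy'
    rcases List.mem_append.1 hy with hy | hy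
    · have := A1 y hy; omega
    · exact dBE y hy hy'
  · intro y hy hy'
    have := J1 y hy'
    simp only [List.mem_append] at hy
    rcases hy with (hy | hy) | hy
    · have := A1 y hy; omega
    · have := B1 y hy; omega
    · have := E1 y hy; omega
  · intro hy; have := J1' _ hy; omega
  · intro y hy hy'
    have := E1' y hy
    rcases List.mem_cons.1 hy' with rfl | hy'
    · omega
    · have := J1' y hy'; omega
  · intro y hy hy'
    simp only [List.mem_append, List.mem_cons] at hy hy'
    have hlt : g < y := by
      rcases hy with ((hy | hy) | hy) | hy
      · have := A1 y hy; omega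
      · have := B1 y hy; omega
      · have := E1 y hy; omega
      · have := J1 y hy; omega
    rcases hy' with hy' | rfl | hy'
    · have := d1 y hy'
      have := d2 y hy'
      tauto
    · omega
    · have := J1' y hy'; omega
  · simp only [List.nodup_cons, List.mem_cons, List.not_mem_nil, or_false, not_or, List.nodup_nil,
      not_false_iff, and_true]
    omega
  · intro y hy hy'
    simp only [List.mem_append, List.mem_cons, List.not_mem_nil, or_false] at hy hy'
    rcases hy with (((hy | hy) | hy) | hy) | (hy | hy | hy)
    · have := A1 y hy; omega
    · have := B1 y hy; omega
    · have := E1 y hy; omega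
    · have := J1 y hy; omega
    · have := d1 y hy
      have := d2 y hy
      have := E1' y hy
      rcases hy' with hy' | hy' | hy'
      · tauto
      · tauto
      · omega
    · omega
    · have := J1' y hy; omega

section Tree

/-- `a` is an ancestor of `x`, or `x` itself, with respect to the parent function `par`. -/
def Desc (par : ℕ → ℕ) (a x : ℕ) : Prop := ∃ k, par^[k] x = a

/-- `par` is the parent function of a depth-first search forest of `H` (with `0` as the parent of
the roots): every edge joins an ancestor with a descendant. -/
structure IsDfsTree (H : SimpleGraph ℕ) (par : ℕ → ℕ) : Prop where
  par_le : ∀ x, par x ≤ x - 1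
  adj_par : ∀ x, par x ≠ 0 → H.Adj x (par x)
  desc_of_adj : ∀ u w, H.Adj u w → u < w → Desc par u w
  pos : ∀ u w, H.Adj u w → 0 < u

variable {H : SimpleGraph ℕ} {par : ℕ → ℕ} {X : Set ℕ}

theorem Desc.refl (x : ℕ) : Desc par x x := ⟨0, rfl⟩

theorem Desc.trans {a b c : ℕ} (h1 : Desc par a b) (h2 : Desc par b c) : Desc par a c := by
  obtain ⟨k, rfl⟩ := h1
  obtain ⟨l, rfl⟩ := h2
  exact ⟨k + l, Function.iterate_add_apply par k l c⟩

theorem desc_iff {a x : ℕ} : Desc par a x ↔ a = x ∨ Desc par a (par x) := by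
  constructor
  · rintro ⟨k, rfl⟩
    cases k with
    | zero => exact Or.inl rfl
    | succ k => exact Or.inr ⟨k, (Function.iterate_succ_apply par k x).symm⟩
  · rintro (rfl | ⟨k, rfl⟩)
    · exact Desc.refl _
    · exact ⟨k + 1, Function.iterate_succ_apply par k x⟩

theorem desc_par (x : ℕ) : Desc par (par x) x := desc_iff.2 (Or.inr (Desc.refl _))

/-! ### Ancestors -/

section Basic

variable (hT : ∀ x, par x ≤ x - 1)
include hT

theorem iterate_par_le (k x : ℕ) : par^[k] x ≤ x := by
  induction k generalizing x with
  | zero => exact le_rfl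
  | succ k ih =>
    rw [Function.iterate_succ_apply]
    have := hT x
    exact (ih _).trans (by omega)

theorem iterate_par_lt {k x : ℕ} (hk : 0 < k) (hx : 0 < x) : par^[k] x < x := by
  obtain ⟨m, rfl⟩ : ∃ m, k = m + 1 := ⟨k - 1, by omega⟩
  rw [Function.iterate_succ_apply]
  have := iterate_par_le hT m (par x)
  have := hT x
  omega

theorem Desc.le {a x : ℕ} (h : Desc par a x) : a ≤ x := by
  obtain ⟨k, rfl⟩ := h; exact iterate_par_le hT k x

theorem Desc.comparable {a b x : ℕ} (ha : Desc par a x) (hb : Desc par b x) (hab : a ≤ b) :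
    Desc par a b := by
  obtain ⟨k, rfl⟩ := ha
  obtain ⟨l, rfl⟩ := hb
  rcases le_total l k with h | h
  · exact ⟨k - l, by rw [← Function.iterate_add_apply]; congr 1; omega⟩
  · have : Desc par (par^[l] x) (par^[k] x) :=
      ⟨l - k, by rw [← Function.iterate_add_apply]; congr 1; omega⟩
    have := this.le hT
    have : par^[k] x = par^[l] x := by omega
    rw [this]; exact Desc.refl _

/-- An ancestor of `w` below the parent of `c`, where `c` is also an ancestor of `w`, is at least
as deep as `c`. -/
theorem Desc.of_child {c y w : ℕ} (hc : Desc par c w) (hy : Desc par y w) (hlt : par c < y) :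
    Desc par c y := by
  rcases le_total c y with h | h
  · exact hc.comparable hT hy h
  · have := hy.comparable hT hc h
    rcases desc_iff.1 this with rfl | h1
    · exact Desc.refl _
    · have := h1.le hT; omega

theorem Desc.exists_deepest {a x y : ℕ} (hx : Desc par a x) (hy : Desc par a y) :
    ∃ j, Desc par a j ∧ Desc par j x ∧ Desc par j y ∧
      ∀ b, Desc par b x → Desc par b y → b ≤ j := by
  classical
  let P : ℕ → Prop := fun b => Desc par b x ∧ Desc par b y
  have h1 : P (Nat.findGreatest P x) := Nat.findGreatest_spec (P := P) (hx.le hT) ⟨hx, hy⟩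
  have h2 : ∀ b, Desc par b x → Desc par b y → b ≤ Nat.findGreatest P x := fun b hb hb' =>
    Nat.le_findGreatest (P := P) (hb.le hT) ⟨hb, hb'⟩
  exact ⟨_, hx.comparable hT h1.1 (h2 a hx hy), h1.1, h1.2, h2⟩

end Basic

/-! ### Back edges, ears and the size of subtrees in good graphs -/

variable (hT : IsDfsTree H par)
include hT

theorem IsDfsTree.desc_of_adj_le {u w : ℕ} (h : H.Adj u w) (hle : u ≤ w) : Desc par u w :=
  hT.desc_of_adj u w h (lt_of_le_of_ne hle h.ne)

/-- The tree path from an ancestor `a` down to `x`. -/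
theorem IsDfsTree.exists_path {a : ℕ} (ha : 0 < a) (k : ℕ) : ∀ x, par^[k + 1] x = a →
    ∃ I : List ℕ, Lk H a I x ∧ I.Nodup ∧ I.length = k ∧
      (∀ y ∈ I, Desc par a y ∧ a < y ∧ Desc par y x ∧ y < x) ∧
      ∀ y, Desc par y x → a < y → y < x → y ∈ I := by
  induction k with
  | zero =>
    intro x hx
    have hx' : par x = a := hx
    refine ⟨[], Lk_nil.2 ?_, by simp, rfl, by simp, ?_⟩
    · rw [← hx']; exact (hT.adj_par x (by omega)).symm
    · intro y hy h1 h2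
      rcases desc_iff.1 hy with rfl | h3
      · omega
      · have := h3.le hT.par_le; omega
  | succ k ih =>
    intro x hx
    rw [Function.iterate_succ_apply] at hx
    obtain ⟨I, h1, h2, h3, h4, h5⟩ := ih (par x) hx
    have hlt : a < par x := by
      rw [← hx]
      refine iterate_par_lt hT.par_le (by omega) ?_
      by_contra h0
      have := iterate_par_le hT.par_le (k + 1) (par x)
      omega
    have hxlt : par x < x := by have := hT.par_le x; omega
    refine ⟨I ++ [par x], Lk_append.2 ⟨h1, Lk_nil.2 (hT.adj_par x (by omega)).symm⟩, ?_,
      by simp [h3], ?_, ?_⟩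
    · rw [List.nodup_append]
      refine ⟨h2, by simp, ?_⟩
      intro y hy z hz
      have := (h4 y hy).2.2.2
      simp at hz; omega
    · intro y hy
      rcases List.mem_append.1 hy with hy | hy
      · obtain ⟨a1, a2, a3, a4⟩ := h4 y hy
        exact ⟨a1, a2, a3.trans (desc_par x), by omega⟩
      · simp only [List.mem_singleton] at hy
        subst hy
        exact ⟨⟨k + 1, hx⟩, hlt, desc_par x, hxlt⟩
    · intro y hy h6 h7
      rcases desc_iff.1 hy with rfl | h8
      · omega
      · have := h8.le hT.par_le
        rcases Nat.lt_or_ge y (par x) with h9 | h9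
        · exact List.mem_append_left _ (h5 y h8 h6 h9)
        · have : y = par x := by omega
          simp [this]

theorem IsDfsTree.exists_path_of_desc {a x : ℕ} (ha : 0 < a) (hd : Desc par a x) (hne : a ≠ x) :
    ∃ I : List ℕ, Lk H a I x ∧ I.Nodup ∧
      (∀ y ∈ I, Desc par a y ∧ a < y ∧ Desc par y x ∧ y < x) ∧
      ∀ y, Desc par y x → a < y → y < x → y ∈ I := by
  obtain ⟨k, hk⟩ := hd
  cases k with
  | zero => exact (hne hk.symm).elim
  | succ k =>
    obtain ⟨I, h1, h2, -, h4, h5⟩ := hT.exists_path ha k x hk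
    exact ⟨I, h1, h2, h4, h5⟩

/-- The path from `j` down to `z` and over the edge `zg`. -/
theorem IsDfsTree.exists_ear {j z g : ℕ} (hj : 0 < j) (hd : Desc par j z) (hzg : H.Adj z g) :
    ∃ I : List ℕ, Lk H j I g ∧ I.Nodup ∧ (∀ y ∈ I, Desc par j y ∧ j < y ∧ Desc par y z) ∧
      (z ≠ j → I ≠ []) := by
  by_cases hz : z = j
  · subst hz
    exact ⟨[], Lk_nil.2 hzg, by simp, by simp, fun h => (h rfl).elim⟩
  · obtain ⟨I, h1, h2, h3, -⟩ := hT.exists_path_of_desc hj hd (Ne.symm hz)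
    refine ⟨I ++ [z], Lk_append.2 ⟨h1, Lk_nil.2 hzg⟩, ?_, ?_, by simp⟩
    · rw [List.nodup_append]
      refine ⟨h2, by simp, ?_⟩
      intro y hy w hw
      have := (h3 y hy).2.2.2
      simp at hw; omega
    · intro y hy
      rcases List.mem_append.1 hy with hy | hy
      · exact ⟨(h3 y hy).1, (h3 y hy).2.1, (h3 y hy).2.2.1⟩
      · simp only [List.mem_singleton] at hy
        subst hy
        have := hd.le hT.par_le
        exact ⟨hd, by omega, Desc.refl _⟩

/-- In a good graph, back edges span at most five tree edges. -/
theorem IsDfsTree.span_le (hG : Good H X) {y z k : ℕ} (h : H.Adj z y) (hk : par^[k] z = y) :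
    k ≤ 5 := by
  have hy := hT.pos _ _ h.symm
  cases k with
  | zero => omega
  | succ k =>
    obtain ⟨I, h1, h2, h3, h4, -⟩ := hT.exists_path hy k z hk
    cases k with
    | zero => omega
    | succ k =>
      have hlt : y < z := by
        rw [← hk]; exact iterate_par_lt hT.par_le (by omega) (hT.pos _ _ h)
      -- The back edge closes a tree path of at least two edges to a cycle, whose length exceeds the
      -- number of tree edges by one and is at most 6.
      have hc : CycL H y (I ++ [z]) := by
        refine ⟨Lk_append.2 ⟨h1, Lk_nil.2 h⟩, ?_, by simp; omega⟩
        rw [List.nodup_cons, List.nodup_append]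
        refine ⟨?_, h2, by simp, ?_⟩
        · intro hmem
          rcases List.mem_append.1 hmem with hmem | hmem
          · have := (h4 y hmem).2.1; omega
          · simp at hmem; omega
        · intro a ha b hb
          have := (h4 a ha).2.2.2
          simp at hb; omega
      have := hG.cycle_length _ _ _ hc rfl
      simp at this
      omega

/-- `h` is the highest vertex adjacent to the subtree of `w`, and it lies above the parent of
`w`. -/
def LowPoint (H : SimpleGraph ℕ) (par : ℕ → ℕ) (w h : ℕ) : Prop :=
  (∃ z, Desc par w z ∧ H.Adj z h) ∧ h < par w ∧ ∀ z y, Desc par w z → H.Adj z y → h ≤ y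

omit hT in
theorem exists_lowPoint {w : ℕ} (h : ∃ x y, Desc par w x ∧ H.Adj x y ∧ y < par w) :
    ∃ l, LowPoint H par w l := by
  classical
  obtain ⟨x, y, h1, h2, h3⟩ := h
  have hex : ∃ l, ∃ z, Desc par w z ∧ H.Adj z l := ⟨y, x, h1, h2⟩
  refine ⟨Nat.find hex, Nat.find_spec hex, lt_of_le_of_lt (Nat.find_min' hex ⟨x, h1, h2⟩) h3, ?_⟩
  intro z y hz hy
  exact Nat.find_min' hex ⟨z, hz, hy⟩

theorem LowPoint.facts {w h : ℕ} (hl : LowPoint H par w h) : 0 < h ∧ Desc par h w := by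
  obtain ⟨⟨z, hz, hzh⟩, hlt, -⟩ := hl
  refine ⟨hT.pos _ _ hzh.symm, ?_⟩
  have h1 := hz.le hT.par_le
  have h2 := hT.par_le w
  exact (hT.desc_of_adj_le hzh.symm (by omega)).comparable hT.par_le hz (by omega)

/-- Three ears in a row do not fit into a good graph. -/
theorem IsDfsTree.no_three_ears (hG : Good H X) {w h g f h₁ g₁ : ℕ} (hw : LowPoint H par w h)
    (hh₁ : par h₁ = h) (hh₁w : Desc par h₁ w) (hg : LowPoint H par h₁ g)
    (hg₁ : par g₁ = g) (hg₁h : Desc par g₁ h) (hf : LowPoint H par g₁ f) : False := by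
  have hle : ∀ {a b : ℕ}, Desc par a b → a ≤ b := fun hd => hd.le hT.par_le
  obtain ⟨h0, hhw⟩ := hw.facts hT
  obtain ⟨g0, -⟩ := hg.facts hT
  obtain ⟨f0, -⟩ := hf.facts hT
  obtain ⟨⟨z, hz, hzh⟩, hlt1, hmin1⟩ := hw
  obtain ⟨⟨z', hz', hzg⟩, hlt2, hmin2⟩ := hg
  obtain ⟨⟨z'', hz'', hzf⟩, hlt3, -⟩ := hf
  rw [hh₁] at hlt2
  rw [hg₁] at hlt3
  have hh₁h : h < h₁ := by have := hT.par_le h₁; omega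
  have hg₁g : g < g₁ := by have := hT.par_le g₁; omega
  -- By the minimality of the low points, `z'` is not below `w` and `z''` is not below `h₁`. So the
  -- second ear branches off at a proper ancestor `j` of `w`, and the third one at an ancestor `i`
  -- of `h`.
  have nz' : ¬ Desc par w z' := fun hd => by have := hmin1 _ _ hd hzg; omega
  have nz'' : ¬ Desc par h₁ z'' := fun hd => by have := hmin2 _ _ hd hzf; omega
  obtain ⟨j, hj1, hj2, hj3, hj4⟩ := hh₁w.exists_deepest hT.par_le hz'
  obtain ⟨i, hi1, hi2, hi3, hi4⟩ := hg₁h.exists_deepest hT.par_le hz''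
  have hjw : j ≠ w := fun he => nz' (he ▸ hj3)
  have l1 := hle hj1
  have l2 := hle hj2
  have l3 := hle hi1
  have l4 := hle hi2
  have lwz := hle hz
  have hhj : Desc par h j := hhw.comparable hT.par_le hj2 (by omega)
  have hgi : Desc par g i := (hg₁ ▸ desc_par g₁ : Desc par g g₁).trans hi1
  have hfg₁ : Desc par f g := by
    have e1 : Desc par f z'' := hT.desc_of_adj_le hzf.symm (by have := hle hz''; omega)
    have e2 : Desc par g z'' := (hg₁ ▸ desc_par g₁ : Desc par g g₁).trans hz''
    exact e1.comparable hT.par_le e2 (by omega)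
  obtain ⟨A, kA, nA, pA, -⟩ := hT.exists_path_of_desc h0 hhj (by omega)
  obtain ⟨B, kB, nB, pB, eB⟩ := hT.exists_ear (by omega) (hj2.trans hz) hzh
  obtain ⟨E, kE, nE, pE, -⟩ := hT.exists_ear (by omega) hj3 hzg
  obtain ⟨J, kJ, nJ, pJ, qJ⟩ := hT.exists_path_of_desc g0 (hgi.trans hi2) (by omega)
  obtain ⟨E', kE', nE', pE', -⟩ := hT.exists_ear (by omega) hi3 hzf
  obtain ⟨J', kJ', nJ', pJ', -⟩ := hT.exists_path_of_desc f0 hfg₁ (by omega)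
  have hB0 : B ≠ [] := eB (by omega)
  have dBE : ∀ y ∈ B, y ∉ E := by
    intro y hy hy'
    obtain ⟨-, a2, a3⟩ := pB y hy
    obtain ⟨-, -, b3⟩ := pE y hy'
    rcases le_total y w with hyw | hyw
    · have := hj4 y (a3.comparable hT.par_le hz hyw) b3
      omega
    · exact nz' ((hz.comparable hT.par_le a3 hyw).trans b3)
  have below : ∀ y, (y ∈ A ∨ y = j ∨ y ∈ B ∨ y ∈ E) → Desc par h₁ y := by
    rintro y (hy | rfl | hy | hy)
    · obtain ⟨a1, a2, a3, a4⟩ := pA y hy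
      exact hj1.of_child hT.par_le a3 (by omega)
    · exact hj1
    · exact hj1.trans (pB y hy).1
    · exact hj1.trans (pE y hy).1
  have dE'1 : ∀ y ∈ E', ¬ (y ∈ A ∨ y = j ∨ y ∈ B ∨ y ∈ E) := fun y hy h' =>
    nz'' ((below y h').trans (pE' y hy).2.2)
  have dE'2 : ∀ y ∈ E', y ≠ h ∧ y ∉ J := by
    intro y hy
    have a := pE' y hy
    constructor
    · rintro rfl
      have := hi4 _ (Desc.refl _) a.2.2
      omega
    · intro hy'
      have := hi4 _ (pJ y hy').2.2.1 a.2.2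
      omega
  obtain ⟨C, hC⟩ : ∃ C, C = E' ++ f :: J' := ⟨_, rfl⟩
  have kC : Lk H i C g := hC ▸ Lk_append.2 ⟨kE', kJ'⟩
  have hC0 : C ≠ [] := by rw [hC]; simp
  have master : (A ++ B ++ E ++ J ++ C ++ [j, h, g]).Nodup := by
    rw [hC]
    exact nodup_ears hlt3 hlt2 (by omega) nA nB nE nJ nE' nJ'
      (fun y hy => ⟨(pA y hy).2.1, (pA y hy).2.2.2⟩) (fun y hy => (pB y hy).2.1)
      (fun y hy => (pE y hy).2.1) (fun y hy => ⟨(pJ y hy).2.1, (pJ y hy).2.2.2⟩)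
      (fun y hy => by have := (pE' y hy).2.1; omega)
      (fun y hy => ⟨(pJ' y hy).2.1, (pJ' y hy).2.2.2⟩) dBE dE'1 dE'2
  -- Three links between `j` and `h`: the tree path `A`, the ear `B` through `z`, and the detour
  -- over `g` along `E` and `J`.
  have θ1 := hG.theta kA.reverse kB (Lk_append.2 ⟨kE, kJ⟩) (nodup_of_count_le master fun a => by
    simp only [List.count_append, List.count_cons, List.count_reverse, List.count_nil]
    omega) hB0 (by simp)
  have pC := List.length_pos_iff.2 hC0
  have pB' := List.length_pos_iff.2 hB0
  simp only [List.length_append, List.length_reverse, List.length_cons] at θ1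
  -- `C` leads from `i` over `f` to `g`. In `Good.theta` the last two links have equal length. If `i
  -- = h`, this gives both `|B| = |E| + 1 + |C|` and `|C| = |E| + 1 + |B|`. Otherwise `i` lies on
  -- `J`, so `θ1` forces `|J| = 1`, `|E| = 0` and `|B| = 2`, and replacing the part of `J` before
  -- `i` by `C` makes the detour too long.
  by_cases hih : i = h
  · subst hih
    have θ3 := hG.theta kA.reverse kB (Lk_append.2 ⟨kE, kC.reverse⟩)
      (nodup_of_count_le master fun a => by
      simp only [List.count_append, List.count_cons, List.count_reverse, List.count_nil]
      omega) hB0 (by simp)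
    have θ4 := hG.theta kJ kC.reverse (Lk_append.2 ⟨kE.reverse, kB⟩)
      (nodup_of_count_le master fun a => by
      simp only [List.count_append, List.count_cons, List.count_reverse, List.count_nil]
      omega) (by simpa using hC0) (by simp)
    simp only [List.length_append, List.length_reverse, List.length_cons] at θ3 θ4
    omega
  · have hmem : i ∈ J := qJ i hi2 (by omega) (by omega)
    have hJ1 := List.length_pos_of_mem hmem
    have hlen : A.length = 0 ∧ B.length = 2 ∧ E.length = 0 ∧ J.length = 1 := by omega
    obtain ⟨i', rfl⟩ := List.length_eq_one_iff.1 hlen.2.2.2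
    rw [List.mem_singleton] at hmem
    subst hmem
    rw [Lk_cons, Lk_nil] at kJ
    have θ3 := hG.theta kA.reverse kB (Lk_append.2 ⟨kE, Lk_append.2 ⟨kC.reverse, Lk_nil.2 kJ.2⟩⟩)
      (nodup_of_count_le master fun a => by
      simp only [List.count_append, List.count_cons, List.count_reverse, List.count_nil]
      omega) hB0 (by simp)
    simp only [List.length_append, List.length_reverse, List.length_cons, List.length_nil] at θ3
    omega

/-- The subtree of `d` has an edge to a vertex above the parent of `d`. -/
def Pending (H : SimpleGraph ℕ) (par : ℕ → ℕ) (d : ℕ) : Prop :=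
  ∃ x y, Desc par d x ∧ H.Adj x y ∧ y < par d

theorem LowPoint.depth_le (hG : Good H X) {w h : ℕ} (hl : LowPoint H par w h) :
    ∃ m, 1 ≤ m ∧ m ≤ 5 ∧ par^[m] w = h := by
  obtain ⟨h0, m, hm⟩ := hl.facts hT
  obtain ⟨⟨z, ⟨i, rfl⟩, hzh⟩, hlt, -⟩ := hl
  have := hT.span_le hG hzh (k := m + i) (by rw [Function.iterate_add_apply, hm])
  refine ⟨m, ?_, by omega, hm⟩
  rcases Nat.eq_zero_or_pos m with rfl | h1
  · have := hT.par_le (par^[i] z)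
    change par^[i] z = h at hm
    omega
  · exact h1

/-- From a depth of more than ten, low points can be followed three times: passing from a vertex to
the child of its low point climbs at most four levels, so the vertices reached are still proper
descendants of `c` and have low points themselves. This is the configuration excluded by
`no_three_ears`. -/
theorem IsDfsTree.depth_le (hG : Good H X) {c : ℕ} (hc : 0 < c)
    (hp : ∀ d, Desc par c d → d ≠ c → Pending H par d) {w : ℕ} (hw : Desc par c w) :
    ∃ k ≤ 10, par^[k] w = c := by
  have hle : ∀ {a b : ℕ}, Desc par a b → a ≤ b := fun hd => hd.le hT.par_le
  obtain ⟨k, hk⟩ := hw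
  refine ⟨k, ?_, hk⟩
  by_contra hk10
  have hwc : w ≠ c := by
    rintro rfl
    exact absurd (iterate_par_lt hT.par_le (k := k) (by omega) hc) (by omega)
  -- if the low point of a descendant lies above `c`, the descendant has small depth
  have step : ∀ {v l i : ℕ}, par^[i] v = c → LowPoint H par v l → 5 < i →
      ∃ v₁ m, par v₁ = l ∧ Desc par v₁ v ∧ m + 1 ≤ 5 ∧ par^[m] v = v₁ ∧ Desc par c v₁ ∧ v₁ ≠ c ∧
        par^[i - m] v₁ = c ∧ Desc par c l := by
    intro v l i hi hl h5
    obtain ⟨m, hm1, hm, hml⟩ := hl.depth_le hT hG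
    have e1 : par^[i - m] l = c := by
      rw [← hml, ← Function.iterate_add_apply, ← hi]; congr 1; omega
    have e2 : par^[i - (m - 1)] (par^[m - 1] v) = c := by
      rw [← Function.iterate_add_apply, ← hi]; congr 1; omega
    have e3 : par (par^[m - 1] v) = l := by
      rw [← Function.iterate_succ_apply' par, ← hml, show (m - 1).succ = m by omega]
    refine ⟨par^[m - 1] v, m - 1, e3, ⟨m - 1, rfl⟩, by omega, rfl, ⟨_, e2⟩, ?_, e2, ⟨_, e1⟩⟩
    intro h
    have h1 := hT.par_le (par^[m - 1] v)
    rw [e3, h] at h1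
    have := hle ⟨_, e1⟩
    omega
  obtain ⟨h, hl⟩ := exists_lowPoint (hp w ⟨k, hk⟩ hwc)
  obtain ⟨h₁, m, a1, a2, a3, -, a5, a6, a7, a8⟩ := step hk hl (by omega)
  obtain ⟨g, hlg⟩ := exists_lowPoint (hp h₁ a5 a6)
  obtain ⟨g₁, m', b1, b2, b3, -, b5, b6, b7, b8⟩ := step a7 hlg (by omega)
  obtain ⟨f, hlf⟩ := exists_lowPoint (hp g₁ b5 b6)
  have hg₁h : Desc par g₁ h := by
    rcases desc_iff.1 b2 with h2 | h2
    · exfalso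
      have := hlg.2.1
      rw [← h2, b1] at this
      exact this.false
    · rwa [a1] at h2
  exact hT.no_three_ears hG hl a1 a2 hlg b1 hg₁h hlf

/-- At most three pending children of `x` have an edge from their subtrees to the same ancestor of
`x`. -/
theorem IsDfsTree.no_four_children (hG : Good H X) {x y : ℕ} (hyx : y < x) (d z : Fin 4 → ℕ)
    (hd : Function.Injective d) (hpar : ∀ i, par (d i) = x) (hz : ∀ i, Desc par (d i) (z i))
    (hadj : ∀ i, H.Adj (z i) y) : False := by
  have hx0 : 0 < x := by omega
  have hxd : ∀ i, Desc par x (d i) := fun i => hpar i ▸ desc_par (d i)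
  have hxlt : ∀ i, x < d i := fun i => by have := hT.par_le (d i); rw [hpar i] at this; omega
  have hear : ∀ i, ∃ I : List ℕ, Lk H x I y ∧ I.Nodup ∧ I ≠ [] ∧
      ∀ e ∈ I, x < e ∧ Desc par (d i) e := by
    intro i
    obtain ⟨I, h1, h2, h3, h4⟩ := hT.exists_ear hx0 ((hxd i).trans (hz i)) (hadj i)
    refine ⟨I, h1, h2, h4 ?_, fun e he => ⟨(h3 e he).2.1, ?_⟩⟩
    · have := (hz i).le hT.par_le
      have := hxlt i
      omega
    · exact (hz i).of_child hT.par_le (h3 e he).2.2 (by rw [hpar i]; exact (h3 e he).2.1)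
  choose I h1 h2 h3 h4 using hear
  have hdisj : ∀ i k, i ≠ k → ∀ e ∈ I i, e ∉ I k := by
    intro i k hik e hi hk
    have a := (h4 i e hi).2
    have b := (h4 k e hk).2
    have key : ∀ i k, Desc par (d i) e → Desc par (d k) e → d i ≤ d k → d i = d k := by
      intro i k a b hle
      rcases desc_iff.1 (a.comparable hT.par_le b hle) with h | h
      · exact h
      · rw [hpar] at h
        have := h.le hT.par_le
        have := hxlt i
        omega
    rcases le_total (d i) (d k) with h | h
    · exact hik (hd (key i k a b h))
    · exact hik (hd (key k i b a h).symm)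
  -- Each link belongs to a triple of disjoint nonempty links from `x` to `y`, for which
  -- `Good.theta` allows only one interior vertex each. The four interior vertices then form a
  -- `K_{2,4}` with `x` and `y`.
  have hone : ∀ i, (I i).length = 1 := by
    intro i
    obtain ⟨k, l, hik, hil, hkl⟩ : ∃ k l : Fin 4, i ≠ k ∧ i ≠ l ∧ k ≠ l := by
      revert i; decide
    have hnd : (x :: y :: (I i ++ I k ++ I l)).Nodup := by
      rw [List.nodup_cons, List.nodup_cons]
      have hgt : ∀ e ∈ I i ++ I k ++ I l, x < e := by
        intro e he
        simp only [List.mem_append] at he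
        rcases he with (he | he) | he
        · exact (h4 _ e he).1
        · exact (h4 _ e he).1
        · exact (h4 _ e he).1
      refine ⟨?_, fun h => ?_, ?_⟩
      · intro h
        rcases List.mem_cons.1 h with h | h
        · omega
        · exact (hgt _ h).false
      · have := hgt _ h; omega
      · refine nodup_append_of_disjoint (nodup_append_of_disjoint (h2 i) (h2 k) (hdisj i k hik))
          (h2 l) ?_
        intro e he
        rcases List.mem_append.1 he with he | he
        · exact hdisj i l hil e he
        · exact hdisj k l hkl e he
    have := hG.theta (h1 i) (h1 k) (h1 l) hnd (h3 k) (h3 l)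
    have := List.length_pos_iff.2 (h3 i)
    omega
  have he : ∀ i, ∃ e, I i = [e] := fun i => List.length_eq_one_iff.1 (hone i)
  choose e he using he
  have hinj : Function.Injective e := by
    intro i k hik
    by_contra hne
    refine hdisj i k hne (e i) (by rw [he]; simp) (by rw [he, hik]; simp)
  have hl : ∀ i, H.Adj x (e i) ∧ H.Adj (e i) y := fun i => by
    have := h1 i
    rwa [he, Lk_cons, Lk_nil] at this
  exact hG.2.no_K24 (x := x) (y := y) (by omega) e hinj (fun i => (hl i).1)
    (fun i => (hl i).2.symm)

/-- A vertex has at most twelve pending children. -/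
theorem IsDfsTree.card_children (hG : Good H X) {x : ℕ} (D : Finset ℕ)
    (hD : ∀ d ∈ D, par d = x ∧ Pending H par d) : D.card ≤ 12 := by
  classical
  by_contra hcard
  have hex : ∀ d, ∃ z y, d ∈ D → Desc par d z ∧ H.Adj z y ∧ y < x := by
    intro d
    by_cases hd : d ∈ D
    · obtain ⟨h1, z, y, h2, h3, h4⟩ := hD d hd
      exact ⟨z, y, fun _ => ⟨h2, h3, h1 ▸ h4⟩⟩
    · exact ⟨0, 0, fun h => (hd h).elim⟩
  choose z y hzy using hex
  -- The edge spans at most five tree edges, one of which joins `d` to `x`, so it ends one to four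
  -- levels above `x`. Each of these four ancestors can serve at most three children.
  have hmaps : ∀ d ∈ D, y d ∈ (Finset.Icc 1 4).image (fun m => par^[m] x) := by
    intro d hd
    obtain ⟨h1, h2, h3⟩ := hzy d hd
    have hpx := (hD d hd).1
    have hxd : Desc par x (z d) := (hpx ▸ desc_par d : Desc par x d).trans h1
    have hyz : Desc par (y d) (z d) :=
      hT.desc_of_adj_le h2.symm (by have := hxd.le hT.par_le; omega)
    obtain ⟨m, hm⟩ := hyz.comparable hT.par_le hxd h3.le
    obtain ⟨i, hi⟩ := h1
    have := hT.span_le hG h2 (k := m + 1 + i) (by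
      rw [Function.iterate_add_apply, hi, Function.iterate_succ_apply, hpx, hm])
    refine Finset.mem_image.2 ⟨m, Finset.mem_Icc.2 ⟨?_, by omega⟩, hm⟩
    rcases Nat.eq_zero_or_pos m with rfl | h0
    · change x = y d at hm; omega
    · exact h0
  obtain ⟨v, -, hv⟩ := Finset.exists_lt_card_fiber_of_mul_lt_card_of_maps_to hmaps (n := 3) (by
    have : ((Finset.Icc 1 4).image (fun m => par^[m] x)).card ≤ 4 :=
      Finset.card_image_le.trans (by simp)
    omega)
  obtain ⟨F, hFsub, hF⟩ := Finset.exists_subset_card_eq (Nat.succ_le_of_lt hv)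
  have hmem : ∀ i, F.orderEmbOfFin hF i ∈ F := fun i => Finset.orderEmbOfFin_mem F hF i
  have hmem' : ∀ i, F.orderEmbOfFin hF i ∈ D ∧ y (F.orderEmbOfFin hF i) = v := fun i =>
    Finset.mem_filter.1 (hFsub (hmem i))
  refine hT.no_four_children hG (x := x) (y := v) ?_ (F.orderEmbOfFin hF)
    (fun i => z (F.orderEmbOfFin hF i)) (F.orderEmbOfFin hF).injective
    (fun i => (hD _ (hmem' i).1).1) (fun i => (hzy _ (hmem' i).1).1) (fun i => ?_)
  · rw [← (hmem' 0).2]; exact (hzy _ (hmem' 0).1).2.2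
  · rw [← (hmem' i).2]; exact (hzy _ (hmem' i).1).2.1

/-- A bound for the size of subtrees all of whose proper subtrees are pending. -/
def segBound : ℕ := ∑ k ∈ Finset.range 11, 12 ^ k

theorem IsDfsTree.card_le_segBound (hG : Good H X) {c : ℕ} (hc : 0 < c)
    (hp : ∀ d, Desc par c d → d ≠ c → Pending H par d) (S : Finset ℕ)
    (hS : ∀ x, x ∈ S ↔ Desc par c x) : S.card ≤ segBound := by
  classical
  have hlevel : ∀ k, (S.filter fun x => par^[k] x = c).card ≤ 12 ^ k := by
    intro k
    induction k with
    | zero =>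
      rw [pow_zero, Finset.card_le_one]
      intro a ha b hb
      have h1 : a = c := (Finset.mem_filter.1 ha).2
      have h2 : b = c := (Finset.mem_filter.1 hb).2
      rw [h1, h2]
    | succ k ih =>
      have := Finset.card_le_mul_card_image_of_maps_to (f := par)
        (s := S.filter fun x => par^[k + 1] x = c) (t := S.filter fun x => par^[k] x = c) (n := 12)
        (by
          intro a ha
          have h1 := (Finset.mem_filter.1 ha).2
          rw [Function.iterate_succ_apply] at h1
          exact Finset.mem_filter.2 ⟨(hS _).2 ⟨k, h1⟩, h1⟩) (by
          intro b hb
          refine hT.card_children hG (x := b) _ fun d hd => ?_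
          obtain ⟨h1, h2⟩ := Finset.mem_filter.1 hd
          obtain ⟨h3, h4⟩ := Finset.mem_filter.1 h1
          refine ⟨h2, hp d ((hS d).1 h3) ?_⟩
          rintro rfl
          exact (iterate_par_lt hT.par_le (Nat.succ_pos k) hc).ne h4)
      rw [pow_succ]
      exact this.trans (by rw [mul_comm]; exact Nat.mul_le_mul_right _ ih)
  have hsub : S ⊆ (Finset.range 11).biUnion fun k => S.filter fun x => par^[k] x = c := by
    intro x hx
    obtain ⟨k, hk, hkx⟩ := hT.depth_le hG hc hp ((hS x).1 hx)
    exact Finset.mem_biUnion.2 ⟨k, Finset.mem_range.2 (by omega), Finset.mem_filter.2 ⟨hx, hkx⟩⟩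
  exact (Finset.card_le_card hsub).trans
    (Finset.card_biUnion_le.trans (Finset.sum_le_sum fun k _ => hlevel k))

/-- In a good graph, every vertex has at most five neighbours among its ancestors. -/
theorem IsDfsTree.card_up_le (hG : Good H X) {x : ℕ} (U : Finset ℕ)
    (hU : ∀ y ∈ U, H.Adj x y ∧ y < x) : U.card ≤ 5 := by
  classical
  have hsub : U ⊆ (Finset.Icc 1 5).image (fun m => par^[m] x) := by
    intro y hy
    obtain ⟨h1, h2⟩ := hU y hy
    obtain ⟨m, hm⟩ := hT.desc_of_adj y x h1.symm h2
    refine Finset.mem_image.2 ⟨m, Finset.mem_Icc.2 ⟨?_, hT.span_le hG h1 hm⟩, hm⟩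
    rcases Nat.eq_zero_or_pos m with rfl | h0
    · change x = y at hm; omega
    · exact h0
  exact (Finset.card_le_card hsub).trans (Finset.card_image_le.trans (by simp))

end Tree

/-! ### Peeling a graph along a depth-first numbering -/

/-- `G` is a graph on the positive integers numbered in depth-first order, where `par x` is the
largest neighbour of `x` among the smaller vertices (and `0` if there is none). -/
structure IsDfsNumbering (G : SimpleGraph ℕ) (par : ℕ → ℕ) : Prop where
  pos : ∀ {u w}, G.Adj u w → 0 < u
  par_adj : ∀ {x}, par x ≠ 0 → G.Adj x (par x) ∧ par x < x
  le_par : ∀ {x y}, G.Adj x y → y < x → y ≤ par x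
  between : ∀ {u x w}, G.Adj u w → u < x → x < w → ∃ y, u ≤ y ∧ y < x ∧ G.Adj y x

section Peel

variable {G : SimpleGraph ℕ} {par : ℕ → ℕ}

namespace IsDfsNumbering

variable (hN : IsDfsNumbering G par)
include hN

theorem par_le (x : ℕ) : par x ≤ x - 1 := by
  by_cases h : par x = 0
  · omega
  · have := (hN.par_adj h).2
    omega

/-- For `x` strictly between `u` and `w`, the depth-first property yields a smaller neighbour of `x`
that is at least `u`. So the parent of `x` is again in the interval, and induction applies. -/
theorem desc_of_adj_of_le {u w : ℕ} (h : G.Adj u w) :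
    ∀ x, u ≤ x → x ≤ w → Desc par u x := by
  have hu := hN.pos h
  intro x
  induction x using Nat.strong_induction_on with
  | _ x ih =>
    intro hux hxw
    rcases hux.eq_or_lt with rfl | hux
    · exact Desc.refl _
    · obtain ⟨y, h1, h2, h3⟩ : ∃ y, u ≤ y ∧ y < x ∧ G.Adj y x := by
        rcases hxw.eq_or_lt with rfl | hxw
        · exact ⟨u, le_rfl, hux, h⟩
        · exact hN.between h hux hxw
      have h4 := hN.le_par h3.symm h2
      have h5 := hN.par_le x
      exact desc_iff.2 (Or.inr (ih (par x) (by omega) (by omega) (by omega)))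

/-- Subtrees are intervals of numbers: the gap between a vertex and its parent is filled by
`desc_of_adj_of_le` for the tree edge. -/
theorem desc_of_le_of_le {c x y : ℕ} (hc : 0 < c) (h : Desc par c x) (hcy : c ≤ y) (hyx : y ≤ x) :
    Desc par c y := by
  induction x using Nat.strong_induction_on with
  | _ x ih =>
    rcases desc_iff.1 h with rfl | h'
    · rw [le_antisymm hyx hcy]; exact Desc.refl _
    · have h1 := hN.par_le x
      have h2 := h'.le hN.par_le
      rcases le_or_gt y (par x) with h3 | h3
      · exact ih _ (by omega) h' h3
      · exact h'.trans (hN.desc_of_adj_of_le (hN.par_adj (by omega)).1.symm y h3.le hyx)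

end IsDfsNumbering

/-- The vertices that are left before the step for `c`, given the list of those above `c`. -/
def aliveSet (c : ℕ) (St : List ℕ) : Set ℕ := {x | x ≤ c ∨ x ∈ St}

/-- The part of the stack in the subtree of `c`. -/
def segTail (par : ℕ → ℕ) (c : ℕ) (St : List ℕ) : List ℕ := St.takeWhile fun x => c ≤ par x

/-- The part of the stack outside the subtree of `c`. -/
def segRest (par : ℕ → ℕ) (c : ℕ) (St : List ℕ) : List ℕ := St.dropWhile fun x => c ≤ par x

/-- The invariant of the peeling procedure. -/
structure PeelInv (G : SimpleGraph ℕ) (par : ℕ → ℕ) (c : ℕ) (St : List ℕ) (sat : Set ℕ) :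
    Prop where
  sorted : St.Pairwise (· < ·)
  lt : ∀ x ∈ St, c < x
  closed : ∀ x ∈ aliveSet c St, ∀ y < x, G.Adj x y → y ∈ aliveSet c St
  pending : ∀ d ∈ St, ∃ x ∈ aliveSet c St, ∃ y, Desc par d x ∧ G.Adj x y ∧ y < par d
  good_iff : Good G ∅ ↔ Good (restrictTo G (aliveSet c St)) sat

theorem restrictTo_restrictTo {V : Type*} (G : SimpleGraph V) (S T : Set V) :
    restrictTo (restrictTo G S) T = restrictTo G (S ∩ T) := by
  ext u v
  simp only [restrictTo_adj, Set.mem_inter_iff]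
  tauto

set_option linter.unusedSectionVars false

/-! ### The peeling steps preserve the invariant -/

namespace PeelInv

variable (hN : IsDfsNumbering G par) {c : ℕ} {St : List ℕ} {sat : Set ℕ}
  (h : PeelInv G par c St sat)

theorem start {n : ℕ} (hn : ∀ u w, G.Adj u w → u ≤ n) : PeelInv G par n [] ∅ where
  sorted := List.Pairwise.nil
  lt := by simp
  closed := fun x hx y hy _ => by
    simp only [aliveSet, List.not_mem_nil, or_false, Set.mem_ofPred_eq] at hx ⊢
    omega
  pending := by simp
  good_iff := by
    have : restrictTo G (aliveSet n []) = G := by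
      ext u v
      simp only [restrictTo_adj, aliveSet, List.not_mem_nil, or_false, Set.mem_ofPred_eq]
      exact ⟨fun h => h.1, fun h => ⟨h, hn _ _ h, hn _ _ h.symm⟩⟩
    rw [this]

-- The stack is empty at the end: its least entry would have a positive parent, since the entry is
-- pending, and this parent would be a still smaller stack entry. So no edges are left.
include hN h in
theorem finish (h0 : c = 0) : Good G ∅ := by
  subst h0
  rw [h.good_iff]
  have hSt : St = [] := by
    rcases hS : St with _ | ⟨d, t⟩
    · rfl
    · exfalso
      have hd : d ∈ St := by rw [hS]; exact List.mem_cons_self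
      obtain ⟨x, -, y, -, -, hlt⟩ := h.pending d hd
      have hp := hN.par_adj (x := d) (by omega)
      rcases h.closed d (Or.inr hd) _ hp.2 hp.1 with h1 | h1
      · omega
      · have h2 := h.sorted
        rw [hS] at h1 h2
        rcases List.mem_cons.1 h1 with h3 | h3
        · omega
        · have := (List.pairwise_cons.1 h2).1 _ h3
          omega
  subst hSt
  refine good_of_no_edges (fun u v huv => ?_) _
  obtain ⟨h1, h2, -⟩ := restrictTo_adj.1 huv
  have := hN.pos h1
  simp only [aliveSet, List.not_mem_nil, or_false, Set.mem_ofPred_eq] at h2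
  omega

variable (hc : 0 < c)

include hN h hc

/-- The parent of such an `x` is alive; if it exceeds `c`, it is on the stack in front of `x`, hence
in the same initial run, and induction leads to `c`. -/
theorem desc_of_mem_segTail : ∀ x ∈ segTail par c St, Desc par c x := by
  intro x
  induction x using Nat.strong_induction_on with
  | _ x ih =>
    intro hx
    have hp : c ≤ par x := by simpa using List.mem_takeWhile_imp hx
    have hxS : x ∈ St := (List.takeWhile_sublist _).subset hx
    have hpx := hN.par_adj (x := x) (by omega)
    refine desc_iff.2 (Or.inr ?_)
    rcases hp.eq_or_lt with hp | hp
    · rw [← hp]; exact Desc.refl _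
    · refine ih _ hpx.2 ?_
      have hm : par x ∈ St := by
        rcases h.closed x (Or.inr hxS) _ hpx.2 hpx.1 with h1 | h1
        · omega
        · exact h1
      by_contra hne
      have hd : par x ∈ segRest par c St := by
        rw [← List.takeWhile_append_dropWhile (p := fun x => decide (c ≤ par x)) (l := St)] at hm
        exact (List.mem_append.1 hm).resolve_left hne
      have hs := h.sorted
      rw [← List.takeWhile_append_dropWhile (p := fun x => decide (c ≤ par x)) (l := St)] at hs
      have := (List.pairwise_append.1 hs).2.2 x hx _ hd
      omega

/-- The first entry `y` behind the run has a parent below `c`, so it is no descendant of `c`. As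
subtrees are intervals, no later entry is one either. -/
theorem mem_segTail_of_desc {x : ℕ} (hx : x ∈ St) (hd : Desc par c x) : x ∈ segTail par c St := by
  have hs := h.sorted
  rw [← List.takeWhile_append_dropWhile (p := fun x => decide (c ≤ par x)) (l := St)] at hx hs
  refine (List.mem_append.1 hx).resolve_right fun hxr => ?_
  rcases hr : St.dropWhile (fun x => decide (c ≤ par x)) with _ | ⟨y, t⟩
  · rw [hr] at hxr; simp at hxr
  · have hy : ¬ c ≤ par y := by
      have := List.head_dropWhile_not (fun x => decide (c ≤ par x)) (l := St) (by rw [hr]; simp)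
      simp only [hr, List.head_cons, decide_eq_false_iff_not] at this
      exact this
    have hyS : y ∈ St := (List.dropWhile_sublist _).subset (hr ▸ List.mem_cons_self)
    have hyx : y ≤ x := by
      rw [hr] at hxr
      rcases List.mem_cons.1 hxr with rfl | h1
      · exact le_rfl
      · have := (List.pairwise_append.1 hs).2.1
        rw [hr] at this
        exact ((List.pairwise_cons.1 this).1 _ h1).le
    have hcy := h.lt y hyS
    rcases desc_iff.1 (hN.desc_of_le_of_le hc hd hcy.le hyx) with h1 | h1
    · omega
    · exact hy (h1.le hN.par_le)

/-- The subtree of `c` in what is left of the graph. -/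
theorem mem_seg_iff {x : ℕ} : x ∈ c :: segTail par c St ↔ x ∈ aliveSet c St ∧ Desc par c x := by
  rw [List.mem_cons]
  constructor
  · rintro (rfl | hx)
    · exact ⟨Or.inl le_rfl, Desc.refl _⟩
    · exact ⟨Or.inr ((List.takeWhile_sublist _).subset hx), h.desc_of_mem_segTail hN hc x hx⟩
  · rintro ⟨h1 | h1, h2⟩
    · have := h2.le hN.par_le
      exact Or.inl (by omega)
    · exact Or.inr (h.mem_segTail_of_desc hN hc h1 h2)

theorem nodup_seg : (c :: segTail par c St).Nodup := by
  refine List.nodup_cons.2 ⟨fun hm => ?_, ?_⟩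
  · exact (h.lt c ((List.takeWhile_sublist _).subset hm)).false
  · exact (h.sorted.imp fun h => ne_of_lt h).sublist (List.takeWhile_sublist _)

-- The set of alive vertices is closed under parents, so cutting the parent function down to it
-- changes no positive ancestor of an alive vertex.
omit hc in
theorem desc_restrict_iff {a x : ℕ} (ha : 0 < a) (hx : x ∈ aliveSet c St)
    [DecidablePred (· ∈ aliveSet c St)] :
    Desc (fun x => if x ∈ aliveSet c St then par x else 0) a x ↔ Desc par a x := by
  induction x using Nat.strong_induction_on with
  | _ x ih =>
    rw [desc_iff, desc_iff (par := par), if_pos hx]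
    by_cases h0 : par x = 0
    · rw [h0]
      have h1 : ¬ Desc (fun x => if x ∈ aliveSet c St then par x else 0) a 0 := fun hd => by
        have := hd.le fun x => by
          split_ifs
          · exact hN.par_le x
          · omega
        omega
      have h2 : ¬ Desc par a 0 := fun hd => by
        have := hd.le hN.par_le
        omega
      tauto
    · have h1 := hN.par_adj h0
      rw [ih _ h1.2 (h.closed x hx _ h1.2 h1.1)]

omit hc in
theorem isDfsTree [DecidablePred (· ∈ aliveSet c St)] :
    IsDfsTree (restrictTo G (aliveSet c St)) (fun x => if x ∈ aliveSet c St then par x else 0) where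
  par_le := fun x => by
    split_ifs
    · exact hN.par_le x
    · omega
  adj_par := fun x hx => by
    by_cases hA : x ∈ aliveSet c St
    · rw [if_pos hA] at hx ⊢
      have h1 := hN.par_adj hx
      exact restrictTo_adj.2 ⟨h1.1, hA, h.closed x hA _ h1.2 h1.1⟩
    · rw [if_neg hA] at hx; exact (hx rfl).elim
  desc_of_adj := fun u w huw hlt => by
    obtain ⟨h1, h2, h3⟩ := restrictTo_adj.1 huw
    exact (h.desc_restrict_iff hN (hN.pos h1) h3).2 (hN.desc_of_adj_of_le h1 w hlt.le le_rfl)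
  pos := fun _ _ hadj => hN.pos (restrictTo_adj.1 hadj).1

/-- All proper descendants of `c` that are left are on the stack, hence pending, so
`card_le_segBound` applies. This justifies rejecting when the run is longer. -/
theorem length_le (hG : Good G ∅) : (c :: segTail par c St).length ≤ segBound := by
  classical
  rw [h.good_iff] at hG
  rw [← List.toFinset_card_of_nodup (h.nodup_seg hN hc)]
  have hT := h.isDfsTree hN
  have key : ∀ x, x ∈ (c :: segTail par c St) ↔
      Desc (fun x => if x ∈ aliveSet c St then par x else 0) c x := by
    intro x
    rw [h.mem_seg_iff hN hc]
    refine ⟨fun hx => (h.desc_restrict_iff hN hc hx.1).2 hx.2, fun hx => ?_⟩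
    have hxA : x ∈ aliveSet c St := by
      rcases desc_iff.1 hx with rfl | hx'
      · exact Or.inl le_rfl
      · by_contra hne
        rw [if_neg hne] at hx'
        have := hx'.le hT.par_le
        omega
    exact ⟨hxA, (h.desc_restrict_iff hN hc hxA).1 hx⟩
  refine hT.card_le_segBound hG hc ?_ _ fun x => by rw [List.mem_toFinset]; exact key x
  intro d hd hne
  have hdS : d ∈ St := by
    have := (key d).2 hd
    rcases List.mem_cons.1 this with h1 | h1
    · exact (hne h1).elim
    · exact (List.takeWhile_sublist _).subset h1
  obtain ⟨x, hx, y, h1, h2, h3⟩ := h.pending d hdS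
  have hdlt := h.lt d hdS
  have hdx := h1.le hN.par_le
  have hpd := hN.par_le d
  refine ⟨x, y, (h.desc_restrict_iff hN (by omega) hx).2 h1,
    restrictTo_adj.2 ⟨h2, hx, h.closed x hx y (by omega) h2⟩, ?_⟩
  simpa only [if_pos (show d ∈ aliveSet c St from Or.inr hdS)] using h3

theorem up_card_le (hG : Good G ∅) (U : Finset ℕ) (hU : ∀ y ∈ U, G.Adj c y ∧ y < c) :
    U.card ≤ 5 := by
  classical
  rw [h.good_iff] at hG
  refine (h.isDfsTree hN).card_up_le hG (x := c) U fun y hy => ?_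
  have := hU y hy
  exact ⟨restrictTo_adj.2 ⟨this.1, Or.inl le_rfl, Or.inl this.2.le⟩, this.2⟩

omit hN h in
theorem aliveSet_pred : aliveSet (c - 1) (c :: St) = aliveSet c St := by
  ext x
  simp only [aliveSet, List.mem_cons, Set.mem_ofPred_eq]
  have : x ≤ c - 1 ∨ x = c ↔ x ≤ c := by omega
  tauto

/-- The step for a vertex whose subtree is adjacent to a vertex above its parent. -/
theorem push (hx : ∃ x ∈ c :: segTail par c St, ∃ y, G.Adj x y ∧ y < c ∧ y ≠ par c) :
    PeelInv G par (c - 1) (c :: St) sat where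
  sorted := List.pairwise_cons.2 ⟨h.lt, h.sorted⟩
  lt := fun x hx => by
    rcases List.mem_cons.1 hx with rfl | hx
    · omega
    · have := h.lt x hx; omega
  closed := by rw [aliveSet_pred hc]; exact h.closed
  pending := by
    rw [aliveSet_pred hc]
    intro d hd
    rcases List.mem_cons.1 hd with rfl | hd
    · obtain ⟨x, hx, y, h1, h2, h3⟩ := hx
      obtain ⟨hA, hdx⟩ := (h.mem_seg_iff hN hc).1 hx
      refine ⟨x, hA, y, hdx, h1, lt_of_le_of_ne ?_ h3⟩
      -- If `x` is not `c` itself, the depth-first property for the edge `xy` gives a neighbour of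
      -- `c` in the interval from `y` to `c`, so in both cases `y ≤ par c`.
      rcases (hdx.le hN.par_le).eq_or_lt with rfl | hlt
      · exact hN.le_par h1 h2
      · obtain ⟨z, h4, h5, h6⟩ := hN.between h1.symm h2 hlt
        exact h4.trans (hN.le_par h6.symm h5)
    · exact h.pending d hd
  good_iff := by rw [aliveSet_pred hc]; exact h.good_iff

/-- The subtree of `c` and the parent of `c`. -/
def piece (G : SimpleGraph ℕ) (par : ℕ → ℕ) (c : ℕ) (St : List ℕ) : SimpleGraph ℕ :=
  restrictTo G ({x | x ∈ c :: segTail par c St} ∪ {par c})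

variable (hcl : ∀ x ∈ c :: segTail par c St, ∀ y, G.Adj x y → y < c → y = par c)

omit hN h hc in
theorem mem_iff_segTail_or_segRest {x : ℕ} :
    x ∈ St ↔ x ∈ segTail par c St ∨ x ∈ segRest par c St := by
  rw [← List.mem_append, segTail, segRest, List.takeWhile_append_dropWhile]

theorem aliveSet_inter_compl : aliveSet c St ∩ {x | x ∈ c :: segTail par c St}ᶜ =
    aliveSet (c - 1) (segRest par c St) := by
  ext x
  have hs := h.sorted
  rw [← List.takeWhile_append_dropWhile (p := fun x => decide (c ≤ par x)) (l := St)] at hs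
  have h1 : x ∈ segRest par c St → x ∉ segTail par c St := fun hr ht =>
    ((List.pairwise_append.1 hs).2.2 x ht x hr).false
  have h2 : x ∈ St → c < x := h.lt x
  have h3 := mem_iff_segTail_or_segRest (par := par) (c := c) (St := St) (x := x)
  simp only [aliveSet, List.mem_cons, Set.mem_inter_iff, Set.mem_ofPred_eq, Set.mem_compl_iff]
  have h4 : x ≤ c - 1 ↔ x ≤ c ∧ x ≠ c := by omega
  by_cases hxc : x = c
  · subst hxc
    have : x ∉ St := fun hx => (h.lt x hx).false
    simp
    tauto
  · by_cases hle : x ≤ c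
    · have : x ∉ St := fun hx => by have := h2 hx; omega
      tauto
    · tauto

include hcl

/-- A neighbour that is at least `c` is again in the subtree, because subtrees are intervals. So the
subtree is attached at `par c` only. -/
theorem side_closed : ∀ x ∈ {x | x ∈ c :: segTail par c St}, ∀ y,
    (restrictTo G (aliveSet c St)).Adj x y → y ∈ {x | x ∈ c :: segTail par c St} ∨ y = par c := by
  intro x hx y hxy
  obtain ⟨h1, h2, h3⟩ := restrictTo_adj.1 hxy
  obtain ⟨-, hd⟩ := (h.mem_seg_iff hN hc).1 hx
  rcases lt_or_ge y c with hlt | hge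
  · exact Or.inr (hcl x hx y h1 hlt)
  · refine Or.inl ((h.mem_seg_iff hN hc).2 ⟨h3, ?_⟩)
    rcases le_total y x with hyx | hxy'
    · exact hN.desc_of_le_of_le hc hd hge hyx
    · exact hd.trans (hN.desc_of_adj_of_le h1 y hxy' le_rfl)

omit hcl in
theorem parent_notMem : par c ∉ {x | x ∈ c :: segTail par c St} := by
  intro hm
  have := ((h.mem_seg_iff hN hc).1 hm).2.le hN.par_le
  have := hN.par_le c
  omega

omit hcl in
theorem piece_eq : restrictTo (restrictTo G (aliveSet c St))
    ({x | x ∈ c :: segTail par c St} ∪ {par c}) = piece G par c St := by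
  rw [restrictTo_restrictTo, piece, Set.inter_eq_right.2]
  rintro x (hx | hx)
  · exact ((h.mem_seg_iff hN hc).1 hx).1
  · have := hN.par_le c
    rw [Set.mem_singleton_iff] at hx
    exact Or.inl (by omega)

/-- The remaining entries stay pending: if the witness of `d` were removed with the subtree of `c`,
then `d`, lying between `c` and the witness, would be in that subtree as well. -/
theorem pop_of_good_iff {sat' : Set ℕ}
    (hg : Good (restrictTo G (aliveSet c St)) sat ↔
      Good (restrictTo (restrictTo G (aliveSet c St)) {x | x ∈ c :: segTail par c St}ᶜ) sat') :
    PeelInv G par (c - 1) (segRest par c St) sat' where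
  sorted := h.sorted.sublist (List.dropWhile_sublist _)
  lt := fun x hx => by
    have := h.lt x ((List.dropWhile_sublist _).subset hx)
    omega
  closed := by
    rw [← h.aliveSet_inter_compl hN hc]
    rintro x ⟨hx, hxS⟩ y hyx hxy
    refine ⟨h.closed x hx y hyx hxy, fun hyS => hxS ?_⟩
    refine (h.mem_seg_iff hN hc).2 ⟨hx, ((h.mem_seg_iff hN hc).1 hyS).2.trans ?_⟩
    exact hN.desc_of_adj_of_le hxy.symm x hyx.le le_rfl
  pending := by
    rw [← h.aliveSet_inter_compl hN hc]
    intro d hd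
    have hdS := (List.dropWhile_sublist _).subset hd
    obtain ⟨x, hx, y, h1, h2, h3⟩ := h.pending d hdS
    refine ⟨x, ⟨hx, fun hxS => ?_⟩, y, h1, h2, h3⟩
    have hdesc := ((h.mem_seg_iff hN hc).1 hxS).2
    have h4 := h.mem_segTail_of_desc hN hc hdS
      (hN.desc_of_le_of_le hc hdesc (h.lt d hdS).le (h1.le hN.par_le))
    have hs := h.sorted
    rw [← List.takeWhile_append_dropWhile (p := fun x => decide (c ≤ par x)) (l := St)] at hs
    exact ((List.pairwise_append.1 hs).2.2 d h4 d hd).false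
  good_iff := by
    rw [h.good_iff, hg, restrictTo_restrictTo, h.aliveSet_inter_compl hN hc]

/-- If `c` is a root, `par c` is `0`, an isolated vertex, and everything that is left below `c` is
dropped without consequences. -/
theorem pop (hg : Good (piece G par c St) (sat ∪ {par c})) :
    PeelInv G par (c - 1) (segRest par c St) sat :=
  h.pop_of_good_iff hN hc hcl (good_iff_of_side_avoids (h.parent_notMem hN hc)
    (h.side_closed hN hc hcl) (by rwa [h.piece_eq hN hc]))

theorem pop_saturate (hg : Good (piece G par c St) sat)
    (hg' : ¬ Good (piece G par c St) (sat ∪ {par c})) :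
    PeelInv G par (c - 1) (segRest par c St) (sat ∪ {par c}) :=
  h.pop_of_good_iff hN hc hcl (good_iff_of_side_needs (h.parent_notMem hN hc)
    (h.side_closed hN hc hcl) (by rwa [h.piece_eq hN hc]) (by rwa [h.piece_eq hN hc]))

theorem good_piece (hg : Good G ∅) : Good (piece G par c St) sat := by
  rw [← h.piece_eq hN hc]
  exact (h.good_iff.1 hg).restrictTo_side (h.parent_notMem hN hc) (h.side_closed hN hc hcl)

end PeelInv

end Peel

/-! ### Depth-first search -/

/-- The state of a depth-first search: the numbers given to the visited vertices (`0` for the other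
ones), how many there are, the stack, the number of list entries scanned so far, for each number the
list of the smaller numbers seen in its adjacency list, and the next root to try. -/
structure DfsState where
  num : ℕ → ℕ
  cnt : ℕ
  stk : List ℕ
  pos : ℕ → ℕ
  low : ℕ → List ℕ
  root : ℕ

/-- Adjacency lists of a graph on `{0, …, n - 1}`. -/
structure AdjFamily (n : ℕ) (nb : ℕ → List ℕ) : Prop where
  nodup : ∀ v, (nb v).Nodup
  symm : ∀ {v w}, w ∈ nb v → v ∈ nb w
  lt : ∀ {v w}, w ∈ nb v → w < n
  irrefl : ∀ v, v ∉ nb v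

/-- The invariant of depth-first search. -/
structure DfsInv (n : ℕ) (nb : ℕ → List ℕ) (s : DfsState) : Prop where
  root_le : s.root ≤ n
  num_of_lt_root : ∀ v < s.root, s.num v ≠ 0
  num_le : ∀ v, s.num v ≤ s.cnt
  lt_of_num : ∀ {v}, s.num v ≠ 0 → v < n
  num_inj : ∀ {v w}, s.num v ≠ 0 → s.num v = s.num w → v = w
  num_surj : ∀ k, 1 ≤ k → k ≤ s.cnt → ∃ v, s.num v = k
  stk_sorted : s.stk.Pairwise fun a b => s.num b < s.num a
  stk_num : ∀ v ∈ s.stk, s.num v ≠ 0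
  pos_le : ∀ v, s.pos v ≤ (nb v).length
  pos_zero : ∀ v, s.num v = 0 → s.pos v = 0
  pos_full : ∀ v, s.num v ≠ 0 → v ∉ s.stk → s.pos v = (nb v).length
  scanned : ∀ v, ∀ w ∈ (nb v).take (s.pos v), s.num w ≠ 0
  stk_between : ∀ u ∈ s.stk, ∀ x, s.num u < s.num x →
    ∃ y ∈ nb x, s.num u ≤ s.num y ∧ s.num y < s.num x
  between : ∀ u x w, w ∈ nb u → s.num u ≠ 0 → s.num u < s.num x → s.num x < s.num w →
    ∃ y ∈ nb x, s.num u ≤ s.num y ∧ s.num y < s.num x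
  low_nil : ∀ k, s.cnt < k → s.low k = []
  low_zero : s.low 0 = []
  low_nodup : ∀ k, (s.low k).Nodup
  mem_low : ∀ v, s.num v ≠ 0 → ∀ y, y ∈ s.low (s.num v) ↔
    ∃ w ∈ (nb v).take (s.pos v), s.num w = y ∧ s.num w < s.num v

/-- A bound for the number of steps that are left. -/
def DfsState.potential (n : ℕ) (nb : ℕ → List ℕ) (s : DfsState) : ℕ :=
  2 * (n - s.root) + 2 * ∑ v ∈ Finset.range n, ((nb v).length - s.pos v) + s.stk.length

theorem mem_take_update_succ {nb : ℕ → List ℕ} {pos : ℕ → ℕ} {t w : ℕ}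
    (hw : (nb t)[pos t]? = some w) (v x : ℕ) :
    x ∈ (nb v).take (Function.update pos t (pos t + 1) v) ↔
      x ∈ (nb v).take (pos v) ∨ v = t ∧ x = w := by
  by_cases hv : v = t
  · subst hv
    simp [List.take_add_one, hw]
  · simp [hv]

/-! ### The steps of the search preserve its invariant -/

namespace DfsInv

variable {n : ℕ} {nb : ℕ → List ℕ} {s : DfsState} (hnb : AdjFamily n nb) (h : DfsInv n nb s)

include h in
theorem cnt_le : s.cnt ≤ n := by
  have : Finset.Icc 1 s.cnt ⊆ (Finset.range n).image s.num := by
    intro k hk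
    obtain ⟨h1, h2⟩ := Finset.mem_Icc.1 hk
    obtain ⟨v, rfl⟩ := h.num_surj k h1 h2
    exact Finset.mem_image.2 ⟨v, Finset.mem_range.2 (h.lt_of_num (by omega)), rfl⟩
  simpa using (Finset.card_le_card this).trans Finset.card_image_le

theorem start : DfsInv n nb ⟨fun _ => 0, 0, [], fun _ => 0, fun _ => [], 0⟩ := by
  constructor <;> simp
  omega

include hnb h

/-- A new vertex is visited. -/
theorem visit {w : ℕ} (hw : s.num w = 0) (hwn : w < n) {pos' : ℕ → ℕ}
    (hpos : (s.stk = [] ∧ pos' = s.pos) ∨ (∃ t tl, s.stk = t :: tl ∧ (nb t)[s.pos t]? = some w ∧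
      pos' = Function.update s.pos t (s.pos t + 1))) {root' : ℕ}
    (hroot : root' ≤ n) (hroot' : ∀ v < root', v ≠ w → s.num v ≠ 0) :
    DfsInv n nb ⟨Function.update s.num w (s.cnt + 1), s.cnt + 1, w :: s.stk, pos', s.low, root'⟩ := by
  have num_self : Function.update s.num w (s.cnt + 1) w = s.cnt + 1 := Function.update_self ..
  have num_ne : ∀ {v}, v ≠ w → Function.update s.num w (s.cnt + 1) v = s.num v :=
    fun hv => Function.update_of_ne hv ..
  have ne_of_num : ∀ {v}, s.num v ≠ 0 → v ≠ w := fun hv e => hv (e ▸ hw)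
  have htake : ∀ v x, x ∈ (nb v).take (pos' v) ↔ x ∈ (nb v).take (s.pos v) ∨
      (∃ tl, s.stk = v :: tl) ∧ x ∈ (nb v).take (pos' v) ∧ x = w := by
    intro v x
    rcases hpos with ⟨h1, rfl⟩ | ⟨t, tl, h1, h2, rfl⟩
    · simp [h1]
    · rw [mem_take_update_succ h2, h1]
      constructor
      · rintro (h | ⟨rfl, rfl⟩)
        · exact Or.inl h
        · exact Or.inr ⟨⟨tl, rfl⟩, Or.inr ⟨rfl, rfl⟩, rfl⟩
      · rintro (h | ⟨-, h, -⟩)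
        · exact Or.inl h
        · exact h
  have hw_notMem : ∀ v, v ∈ s.stk → v ≠ w := fun v hv => ne_of_num (h.stk_num v hv)
  have hpos_ne : ∀ v, v ∉ s.stk → pos' v = s.pos v := by
    intro v hv
    rcases hpos with ⟨h1, rfl⟩ | ⟨t, tl, h1, h2, rfl⟩
    · rfl
    · exact Function.update_of_ne (by rintro rfl; exact hv (by simp [h1])) ..
  have hw_stk : w ∉ s.stk := fun hm => hw_notMem w hm rfl
  constructor <;> dsimp only
  · exact hroot
  · intro v hv
    by_cases e : v = w
    · rw [e, num_self]; omega
    · rw [num_ne e]; exact hroot' v hv e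
  · intro v
    by_cases e : v = w
    · rw [e, num_self]
    · rw [num_ne e]; have := h.num_le v; omega
  · intro v hv
    by_cases e : v = w
    · rwa [e]
    · rw [num_ne e] at hv; exact h.lt_of_num hv
  · intro v x hv hvx
    have := h.num_le v
    have := h.num_le x
    by_cases e : v = w <;> by_cases e' : x = w
    · rw [e, e']
    · rw [e, num_self, num_ne e'] at hvx; omega
    · rw [e', num_self, num_ne e] at hvx; omega
    · rw [num_ne e] at hv hvx
      rw [num_ne e'] at hvx
      exact h.num_inj hv hvx
  · intro k h1 h2
    rcases h2.eq_or_lt with rfl | h2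
    · exact ⟨w, num_self⟩
    · obtain ⟨v, rfl⟩ := h.num_surj k h1 (by omega)
      exact ⟨v, num_ne (ne_of_num (by omega))⟩
  · refine List.pairwise_cons.2 ⟨fun v hv => ?_, ?_⟩
    · rw [num_self, num_ne (hw_notMem v hv)]
      have := h.num_le v
      omega
    · refine h.stk_sorted.imp_of_mem fun ha hb hab => ?_
      rwa [num_ne (hw_notMem _ ha), num_ne (hw_notMem _ hb)]
  · intro v hv
    rcases List.mem_cons.1 hv with rfl | hv
    · rw [num_self]; omega
    · rw [num_ne (hw_notMem v hv)]; exact h.stk_num v hv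
  · intro v
    rcases hpos with ⟨h1, rfl⟩ | ⟨t, tl, h1, h2, rfl⟩
    · exact h.pos_le v
    · by_cases e : v = t
      · subst e
        rw [Function.update_self]
        exact (List.getElem?_eq_some_iff.1 h2).1
      · rw [Function.update_of_ne e]; exact h.pos_le v
  · intro v hv
    by_cases e : v = w
    · rw [e, num_self] at hv; omega
    · rw [num_ne e] at hv
      rw [hpos_ne v fun hm => h.stk_num v hm hv]
      exact h.pos_zero v hv
  · intro v hv hvs
    obtain ⟨h1, h2⟩ := not_or.1 (fun hm => hvs (List.mem_cons.2 hm))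
    rw [num_ne h1] at hv
    rw [hpos_ne v h2]
    exact h.pos_full v hv h2
  · intro v x hx
    rcases (htake v x).1 hx with hx | ⟨-, -, rfl⟩
    · have := h.scanned v x hx
      rwa [num_ne (ne_of_num this)]
    · rw [num_self]; omega
  -- If `x` is the new vertex, the neighbour asked for is the former top `t` of the stack, whose
  -- number is at least that of any `u` below it.
  · intro u hu x hux
    by_cases e : x = w
    · subst e
      rw [num_self] at hux ⊢
      rcases List.mem_cons.1 hu with rfl | hu
      · rw [num_self] at hux; omega
      rw [num_ne (hw_notMem u hu)] at hux ⊢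
      rcases hpos with ⟨h1, -⟩ | ⟨t, tl, h1, h2, -⟩
      · rw [h1] at hu; simp at hu
      · have ht : t ∈ s.stk := by simp [h1]
        refine ⟨t, hnb.symm (List.mem_of_getElem? h2), ?_⟩
        rw [num_ne (hw_notMem t ht)]
        have h3 := h.stk_sorted
        rw [h1] at h3 hu
        have h4 := h.num_le t
        rcases List.mem_cons.1 hu with rfl | hu
        · exact ⟨le_rfl, by omega⟩
        · have := (List.pairwise_cons.1 h3).1 u hu
          omega
    · rw [num_ne e] at hux ⊢
      rcases List.mem_cons.1 hu with rfl | hu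
      · rw [num_self] at hux; have := h.num_le x; omega
      · rw [num_ne (hw_notMem u hu)] at hux ⊢
        obtain ⟨y, h1, h2, h3⟩ := h.stk_between u hu x hux
        refine ⟨y, h1, ?_⟩
        rw [num_ne (ne_of_num (by have := h.stk_num u hu; omega))]
        exact ⟨h2, h3⟩
  · intro u x v huv hu hux hxv
    have hx' := h.num_le x
    have hv' := h.num_le v
    by_cases e : x = w
    · rw [e, num_self] at hxv
      by_cases e' : v = w
      · rw [e', num_self] at hxv; omega
      · rw [num_ne e'] at hxv; omega
    rw [num_ne e] at hux hxv ⊢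
    by_cases e' : u = w
    · rw [e', num_self] at hux; omega
    rw [num_ne e'] at hu hux ⊢
    -- If the edge leads to the new vertex, then `u` is still on the stack; otherwise its list would
    -- be exhausted and the new vertex would have been numbered.
    have key : ∃ y ∈ nb x, s.num u ≤ s.num y ∧ s.num y < s.num x := by
      by_cases e'' : v = w
      · subst e''
        by_cases hus : u ∈ s.stk
        · exact h.stk_between u hus x hux
        · have h1 := h.pos_full u hu hus
          refine absurd hw (h.scanned u v ?_)
          rwa [h1, List.take_length]
      · rw [num_ne e''] at hxv
        exact h.between u x v huv hu hux hxv
    obtain ⟨y, h1, h2, h3⟩ := key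
    refine ⟨y, h1, ?_⟩
    rw [num_ne (ne_of_num (by omega))]
    exact ⟨h2, h3⟩
  · intro k hk
    exact h.low_nil k (by omega)
  · exact h.low_zero
  · exact h.low_nodup
  · intro v hv y
    by_cases e : v = w
    · subst e
      rw [num_self, h.low_nil _ (by omega), hpos_ne v hw_stk, h.pos_zero v hw]
      simp
    · rw [num_ne e] at hv ⊢
      rw [h.mem_low v hv]
      constructor
      · rintro ⟨x, h1, h2, h3⟩
        refine ⟨x, (htake v x).2 (Or.inl h1), ?_⟩
        rw [num_ne (ne_of_num (h.scanned v x h1))]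
        exact ⟨h2, h3⟩
      · rintro ⟨x, h1, h2, h3⟩
        rcases (htake v x).1 h1 with h4 | ⟨-, -, rfl⟩
        · rw [num_ne (ne_of_num (h.scanned v x h4))] at h2 h3
          exact ⟨x, h4, h2, h3⟩
        · rw [num_self] at h3
          have := h.num_le v
          omega

omit hnb in
theorem skip_root (h0 : s.num s.root ≠ 0) : DfsInv n nb { s with root := s.root + 1 } :=
  { h with
    root_le := h.lt_of_num h0
    num_of_lt_root := fun v hv => by
      rcases (Nat.lt_succ_iff.1 hv).eq_or_lt with rfl | hv
      · exact h0
      · exact h.num_of_lt_root v hv }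

theorem visit_root (hs : s.stk = []) (hr : s.root < n) (h0 : s.num s.root = 0) :
    DfsInv n nb ⟨Function.update s.num s.root (s.cnt + 1), s.cnt + 1, [s.root], s.pos, s.low,
      s.root + 1⟩ := by
  rw [← hs]
  exact h.visit hnb h0 hr (Or.inl ⟨hs, rfl⟩) hr fun v hv hne => h.num_of_lt_root v (by omega)

theorem visit_child {t w : ℕ} {tl : List ℕ} (hs : s.stk = t :: tl)
    (hw : (nb t)[s.pos t]? = some w) (h0 : s.num w = 0) :
    DfsInv n nb ⟨Function.update s.num w (s.cnt + 1), s.cnt + 1, w :: s.stk,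
      Function.update s.pos t (s.pos t + 1), s.low, s.root⟩ :=
  h.visit hnb h0 (hnb.lt (List.mem_of_getElem? hw)) (Or.inr ⟨t, tl, hs, hw, rfl⟩) h.root_le
    fun v hv _ => h.num_of_lt_root v hv

omit hnb in
theorem pop {t : ℕ} {tl : List ℕ} (hs : s.stk = t :: tl) (hp : s.pos t = (nb t).length) :
    DfsInv n nb { s with stk := tl } :=
  { h with
    stk_sorted := (List.pairwise_cons.1 (hs ▸ h.stk_sorted)).2
    stk_num := fun v hv => h.stk_num v (by rw [hs]; exact List.mem_cons_of_mem _ hv)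
    pos_full := fun v hv hvs => by
      by_cases e : v = t
      · rw [e]; exact hp
      · exact h.pos_full v hv (by rw [hs, List.mem_cons]; tauto)
    stk_between := fun u hu => h.stk_between u (by rw [hs]; exact List.mem_cons_of_mem _ hu) }

omit hnb in
theorem scan_aux {t w : ℕ} {tl : List ℕ} (hs : s.stk = t :: tl)
    (hw : (nb t)[s.pos t]? = some w) (h0 : s.num w ≠ 0) {low' : ℕ → List ℕ}
    (h1 : ∀ k, k ≠ s.num t → low' k = s.low k) (h2 : (low' (s.num t)).Nodup)
    (h3 : ∀ y, y ∈ low' (s.num t) ↔ y ∈ s.low (s.num t) ∨ (y = s.num w ∧ s.num w < s.num t)) :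
    DfsInv n nb { s with pos := Function.update s.pos t (s.pos t + 1), low := low' } := by
  have ht : t ∈ s.stk := by simp [hs]
  have ht0 := h.stk_num t ht
  have htc := h.num_le t
  exact
  { h with
    pos_le := fun v => by
      by_cases e : v = t
      · subst e
        simp only [Function.update_self]
        exact (List.getElem?_eq_some_iff.1 hw).1
      · simp only [Function.update_of_ne e]; exact h.pos_le v
    pos_zero := fun v hv => by
      simp only [Function.update_of_ne (show v ≠ t by rintro rfl; exact ht0 hv)]
      exact h.pos_zero v hv
    pos_full := fun v hv hvs => by
      simp only [Function.update_of_ne (show v ≠ t by rintro rfl; exact hvs ht)]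
      exact h.pos_full v hv hvs
    scanned := fun v x hx => by
      rcases (mem_take_update_succ hw v x).1 hx with hx | ⟨-, rfl⟩
      · exact h.scanned v x hx
      · exact h0
    low_nil := fun k hk => by
      dsimp only at hk ⊢
      rw [h1 k (by omega)]; exact h.low_nil k hk
    low_zero := by dsimp only; rw [h1 0 (Ne.symm ht0)]; exact h.low_zero
    low_nodup := fun k => by
      dsimp only
      by_cases e : k = s.num t
      · subst e; exact h2
      · rw [h1 k e]; exact h.low_nodup k
    mem_low := fun v hv y => by
      have hold := h.mem_low v hv y
      by_cases e : v = t
      · subst e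
        simp only [h3, mem_take_update_succ hw, hold, true_and]
        constructor
        · rintro (⟨x, h4, h5⟩ | ⟨rfl, h4⟩)
          · exact ⟨x, Or.inl h4, h5⟩
          · exact ⟨w, Or.inr rfl, rfl, h4⟩
        · rintro ⟨x, h4 | rfl, h5⟩
          · exact Or.inl ⟨x, h4, h5⟩
          · exact Or.inr ⟨h5.1.symm, h5.2⟩
      · simp only [Function.update_of_ne e]
        rw [h1 _ fun e' => e (h.num_inj hv e')]
        exact hold }

omit hnb in
theorem scan_skip {t w : ℕ} {tl : List ℕ} (hs : s.stk = t :: tl)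
    (hw : (nb t)[s.pos t]? = some w) (h0 : s.num w ≠ 0) (hge : ¬ s.num w < s.num t) :
    DfsInv n nb { s with pos := Function.update s.pos t (s.pos t + 1) } :=
  h.scan_aux hs hw h0 (fun _ _ => rfl) (h.low_nodup _) (by tauto)

theorem scan_low {t w : ℕ} {tl : List ℕ} (hs : s.stk = t :: tl)
    (hw : (nb t)[s.pos t]? = some w) (h0 : s.num w ≠ 0) (hlt : s.num w < s.num t) :
    DfsInv n nb { s with
      pos := Function.update s.pos t (s.pos t + 1)
      low := Function.update s.low (s.num t) (s.num w :: s.low (s.num t)) } := by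
  have ht : t ∈ s.stk := by simp [hs]
  refine h.scan_aux hs hw h0 (fun k hk => Function.update_of_ne hk ..) ?_ (fun y => ?_)
  · rw [Function.update_self]
    refine List.nodup_cons.2 ⟨fun hm => ?_, h.low_nodup _⟩
    obtain ⟨x, h1, h2, -⟩ := (h.mem_low t (h.stk_num t ht) _).1 hm
    have hxw : w = x := h.num_inj h0 h2.symm
    subst hxw
    obtain ⟨hlen, hget⟩ := List.getElem?_eq_some_iff.1 hw
    obtain ⟨i, hi, hiw⟩ := List.getElem_of_mem h1
    rw [List.getElem_take] at hiw
    have := (hnb.nodup t).getElem_inj_iff.1 (hiw.trans hget.symm)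
    simp only [List.length_take] at hi
    omega
  · rw [Function.update_self, List.mem_cons]
    tauto

end DfsInv

theorem sum_sub_update_succ {n t : ℕ} {len pos : ℕ → ℕ} (ht : t < n) (hp : pos t < len t) :
    ∑ v ∈ Finset.range n, (len v - Function.update pos t (pos t + 1) v) + 1 =
      ∑ v ∈ Finset.range n, (len v - pos v) := by
  have hm := Finset.mem_range.2 ht
  rw [← Finset.sum_erase_add _ _ hm, ← Finset.sum_erase_add _ (fun v => len v - pos v) hm]
  rw [Finset.sum_congr rfl fun v hv => by
    rw [Function.update_of_ne (Finset.ne_of_mem_erase hv)]]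
  rw [Function.update_self]
  omega

/-- The graph on the numbers given by a depth-first search. -/
def numberedGraph (nb : ℕ → List ℕ) (hnb : ∀ {v w}, w ∈ nb v → v ∈ nb w) (num : ℕ → ℕ)
    (hirr : ∀ u v, v ∈ nb u → num u ≠ num v) : SimpleGraph ℕ where
  Adj a b := ∃ u v, v ∈ nb u ∧ num u = a ∧ num v = b
  symm := ⟨fun _ _ ⟨u, v, h, hu, hv⟩ => ⟨v, u, hnb h, hv, hu⟩⟩
  loopless := ⟨fun _ ⟨u, v, h, hu, hv⟩ => hirr u v h (hu.trans hv.symm)⟩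

/-- The largest member of the list of `x`, and `0` if it is empty. -/
def maxLow (low : ℕ → List ℕ) (x : ℕ) : ℕ := (low x).foldr max 0

/-- The result of a depth-first search of the graph `B`. -/
structure DfsResult {V : Type*} (B : SimpleGraph V) (n : ℕ) (low : ℕ → List ℕ) (G : SimpleGraph ℕ) :
    Prop where
  good_iff : Good B ∅ ↔ Good G ∅
  adj_le : ∀ u w, G.Adj u w → u ≤ n
  mem_low : ∀ x y, y ∈ low x ↔ G.Adj x y ∧ y < x
  low_nodup : ∀ x, (low x).Nodup
  numbering : IsDfsNumbering G (maxLow low)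

theorem le_foldr_max {l : List ℕ} {x : ℕ} (h : x ∈ l) : x ≤ l.foldr max 0 := by
  induction l with
  | nil => simp at h
  | cons a t ih =>
    rcases List.mem_cons.1 h with rfl | h
    · exact le_max_left _ _
    · exact (ih h).trans (le_max_right _ _)

theorem foldr_max_mem {l : List ℕ} (h : l.foldr max 0 ≠ 0) : l.foldr max 0 ∈ l := by
  induction l with
  | nil => simp at h
  | cons a t ih =>
    rw [List.foldr_cons] at h ⊢
    rcases max_choice a (t.foldr max 0) with e | e
    · rw [e]; exact List.mem_cons_self
    · rw [e] at h ⊢; exact List.mem_cons_of_mem _ (ih h)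

/-- When the search ends, all vertices are numbered and all lists are scanned. So `num` transports
the graph injectively to the numbers, `low` holds all smaller neighbours, and `between` is the
depth-first property. -/
theorem DfsInv.result {n : ℕ} {nb : ℕ → List ℕ} {s : DfsState} (hnb : AdjFamily n nb)
    (h : DfsInv n nb s) (hs : s.stk = []) (hr : s.root = n) (B : SimpleGraph (Fin n))
    (hB : ∀ u v : Fin n, B.Adj u v ↔ (v : ℕ) ∈ nb u) : ∃ G, DfsResult B n s.low G := by
  have hnum : ∀ v < n, s.num v ≠ 0 := fun v hv => h.num_of_lt_root v (hr ▸ hv)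
  have hpos : ∀ v < n, s.pos v = (nb v).length := fun v hv =>
    h.pos_full v (hnum v hv) (by simp [hs])
  have hlt : ∀ {u v}, v ∈ nb u → u < n ∧ v < n := fun hm => ⟨hnb.lt (hnb.symm hm), hnb.lt hm⟩
  have hirr : ∀ u v, v ∈ nb u → s.num u ≠ s.num v := fun u v hm e => by
    have := h.num_inj (hnum u (hlt hm).1) e
    exact hnb.irrefl u (this ▸ hm)
  let G := numberedGraph nb hnb.symm s.num hirr
  have hGadj : ∀ {a b}, G.Adj a b ↔ ∃ u v, v ∈ nb u ∧ s.num u = a ∧ s.num v = b := Iff.rfl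
  have hlow : ∀ x y, y ∈ s.low x ↔ G.Adj x y ∧ y < x := by
    intro x y
    rcases Nat.eq_zero_or_pos x with rfl | hx
    · simp [h.low_zero]
    rcases lt_or_ge s.cnt x with hxc | hxc
    · rw [h.low_nil x hxc]
      simp only [List.not_mem_nil, false_iff]
      rintro ⟨⟨u, v, -, rfl, -⟩, -⟩
      exact absurd (h.num_le u) (by omega)
    obtain ⟨v, rfl⟩ := h.num_surj x hx hxc
    have hv : v < n := h.lt_of_num (by omega)
    rw [h.mem_low v (by omega), hpos v hv, List.take_length]
    constructor
    · rintro ⟨w, h1, rfl, h2⟩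
      exact ⟨⟨v, w, h1, rfl, rfl⟩, h2⟩
    · rintro ⟨⟨v', w, h1, h2, rfl⟩, h3⟩
      have := h.num_inj (hnum v' (hlt h1).1) h2
      subst this
      exact ⟨w, h1, rfl, h3⟩
  refine ⟨G, ?_, ?_, hlow, h.low_nodup, ?_, ?_, ?_, ?_⟩
  · have := good_iff_of_image (G := G) (H := B) (fun v : Fin n => s.num v)
      (fun a b hab => Fin.ext (h.num_inj (hnum a a.2) hab)) (fun a b => ?_) (fun u v huv => ?_) ∅
    · rw [this, Set.preimage_empty]
    · rw [hB, hGadj]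
      constructor
      · rintro ⟨u, v, h1, h2, h3⟩
        rw [← h.num_inj (hnum u (hlt h1).1) h2, ← h.num_inj (hnum v (hlt h1).2) h3]
        exact h1
      · exact fun hm => ⟨a, b, hm, rfl, rfl⟩
    · obtain ⟨a, b, h1, rfl, rfl⟩ := huv
      exact ⟨⟨a, (hlt h1).1⟩, rfl⟩
  · rintro _ _ ⟨u, v, -, rfl, -⟩
    exact (h.num_le u).trans h.cnt_le
  · rintro _ _ ⟨u, v, h1, rfl, -⟩
    exact Nat.pos_of_ne_zero (hnum u (hlt h1).1)
  · intro x hx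
    exact (hlow _ _).1 (foldr_max_mem hx)
  · intro x y hxy hyx
    exact le_foldr_max ((hlow x y).2 ⟨hxy, hyx⟩)
  · rintro _ x _ ⟨u, v, h1, rfl, rfl⟩ hux hxw
    obtain ⟨z, rfl⟩ := h.num_surj x (by omega) (hxw.le.trans (h.num_le v))
    obtain ⟨y, h2, h3, h4⟩ := h.between u z v h1 (hnum u (hlt h1).1) hux hxw
    exact ⟨s.num y, h3, h4, y, z, hnb.symm h2, rfl, rfl⟩

/-! ### Structured programs for the random access machine -/

/-- The working registers and the arrays of a structured program. -/
structure Store where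
  reg : ℕ → ℕ
  arr : ℕ → ℕ → ℕ

/-- Loop-free programs. -/
inductive Code where
  | skip
  | halt (b : Bool)
  | const (r k : ℕ)
  | copy (r s : ℕ)
  | inc (r : ℕ)
  | dec (r : ℕ)
  | load (r a i : ℕ)
  | store (a i s : ℕ)
  | seq (c d : Code)
  | ifEq (r s : ℕ) (c d : Code)
  | ifLt (r s : ℕ) (c d : Code)

namespace Store

def setReg (s : Store) (r v : ℕ) : Store := ⟨Function.update s.reg r v, s.arr⟩

def setArr (s : Store) (a i v : ℕ) : Store :=
  ⟨s.reg, Function.update s.arr a (Function.update (s.arr a) i v)⟩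

@[simp] theorem setReg_reg (s : Store) (r v r' : ℕ) :
    (s.setReg r v).reg r' = if r' = r then v else s.reg r' := by
  simp [setReg, Function.update_apply]

@[simp] theorem setReg_arr (s : Store) (r v : ℕ) : (s.setReg r v).arr = s.arr := rfl

@[simp] theorem setArr_reg (s : Store) (a i v : ℕ) : (s.setArr a i v).reg = s.reg := rfl

theorem setArr_arr (s : Store) (a i v a' i' : ℕ) :
    (s.setArr a i v).arr a' i' = if a' = a ∧ i' = i then v else s.arr a' i' := by
  by_cases ha : a' = a
  · subst ha; simp [setArr, Function.update_apply]
  · simp [setArr, ha]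

end Store

namespace Code

/-- The weakest precondition for the postcondition `Q` and the condition `H` on the answer. -/
@[simp] def wp (sz : ℕ → ℕ) (H : Bool → Prop) : Code → (Store → Prop) → Store → Prop
  | skip, Q, s => Q s
  | halt b, _, _ => H b
  | const r k, Q, s => Q (s.setReg r k)
  | copy r r', Q, s => Q (s.setReg r (s.reg r'))
  | inc r, Q, s => Q (s.setReg r (s.reg r + 1))
  | dec r, Q, s => Q (s.setReg r (s.reg r - 1))
  | load r a i, Q, s => s.reg i < sz a ∧ Q (s.setReg r (s.arr a (s.reg i)))
  | store a i r, Q, s => s.reg i < sz a ∧ Q (s.setArr a (s.reg i) (s.reg r))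
  | seq c d, Q, s => c.wp sz H (d.wp sz H Q) s
  | ifEq r r' c d, Q, s =>
      (s.reg r = s.reg r' → c.wp sz H Q s) ∧ (s.reg r ≠ s.reg r' → d.wp sz H Q s)
  | ifLt r r' c d, Q, s =>
      (s.reg r < s.reg r' → c.wp sz H Q s) ∧ (s.reg r' ≤ s.reg r → d.wp sz H Q s)

theorem wp_mono {sz : ℕ → ℕ} {H : Bool → Prop} {c : Code} {Q Q' : Store → Prop} {s : Store}
    (h : c.wp sz H Q s) (hQ : ∀ s, Q s → Q' s) : c.wp sz H Q' s := by
  induction c generalizing s Q Q' with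
  | seq c d ihc ihd => exact ihc h fun s hs => ihd hs hQ
  | ifEq r r' c d ihc ihd => exact ⟨fun e => ihc (h.1 e) hQ, fun e => ihd (h.2 e) hQ⟩
  | ifLt r r' c d ihc ihd => exact ⟨fun e => ihc (h.1 e) hQ, fun e => ihd (h.2 e) hQ⟩
  | halt b => exact h
  | load r a i => exact ⟨h.1, hQ _ h.2⟩
  | store a i r => exact ⟨h.1, hQ _ h.2⟩
  | _ => exact hQ _ h

def size : Code → ℕ
  | skip => 0
  | seq c d => c.size + d.size
  | ifEq _ _ c d => c.size + d.size + 2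
  | ifLt _ _ c d => c.size + d.size + 2
  | _ => 1

/-- The machine program for a structured program, to be placed at position `o`. The first twelve
registers hold the addresses of the arrays. -/
def compile : ℕ → Code → List RamInstr
  | _, skip => []
  | _, halt b => [.halt b]
  | _, const r k => [.const (r + 12) k]
  | _, copy r s => [.copy (r + 12) (s + 12)]
  | _, inc r => [.inc (r + 12)]
  | _, dec r => [.dec (r + 12)]
  | _, load r a i => [.load (r + 12) a (i + 12)]
  | _, store a i s => [.store a (i + 12) (s + 12)]
  | o, seq c d => c.compile o ++ d.compile (o + c.size)
  | o, ifEq r s c d => .jumpEq (r + 12) (s + 12) (o + d.size + 2) ::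
      (d.compile (o + 1) ++ .jump (o + d.size + 2 + c.size) :: c.compile (o + d.size + 2))
  | o, ifLt r s c d => .jumpLt (r + 12) (s + 12) (o + d.size + 2) ::
      (d.compile (o + 1) ++ .jump (o + d.size + 2 + c.size) :: c.compile (o + d.size + 2))

@[simp] theorem length_compile (o : ℕ) (c : Code) : (c.compile o).length = c.size := by
  induction c generalizing o with
  | seq c d ihc ihd => simp [compile, size, ihc, ihd]
  | ifEq r s c d ihc ihd => simp [compile, size, ihc, ihd]; omega
  | ifLt r s c d ihc ihd => simp [compile, size, ihc, ihd]; omega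
  | _ => rfl

end Code

/-- The program `P` contains the instructions `l` from position `o` on. -/
def CodeAt (P : List RamInstr) (o : ℕ) (l : List RamInstr) : Prop :=
  ∀ (i : ℕ) (x : RamInstr), l[i]? = some x → P[o + i]? = some x

namespace CodeAt

variable {P : List RamInstr} {o : ℕ}

theorem append_left {l l' : List RamInstr} (h : CodeAt P o (l ++ l')) : CodeAt P o l :=
  fun i x hx => h i x (by
    rw [List.getElem?_append_left (List.getElem?_eq_some_iff.1 hx).1]; exact hx)

theorem append_right {l l' : List RamInstr} (h : CodeAt P o (l ++ l')) :
    CodeAt P (o + l.length) l' := fun i x hx => by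
  rw [add_assoc]
  refine h _ x ?_
  rw [List.getElem?_append_right (by omega)]
  simpa using hx

theorem head {x : RamInstr} {l : List RamInstr} (h : CodeAt P o (x :: l)) : P[o]? = some x :=
  h 0 x rfl

theorem tail {x : RamInstr} {l : List RamInstr} (h : CodeAt P o (x :: l)) : CodeAt P (o + 1) l :=
  append_right (l := [x]) h

end CodeAt

/-- The program `P` reaches a configuration satisfying `Q` within `T` steps. -/
def Reach (P : List RamInstr) (T : ℕ) (c : RamConfig) (Q : RamConfig → Prop) : Prop :=
  ∃ t ≤ T, Q ((ramStep P)^[t] c)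

namespace Reach

variable {P : List RamInstr} {c : RamConfig} {Q Q' : RamConfig → Prop} {T T' : ℕ}

theorem refl (h : Q c) : Reach P T c Q := ⟨0, Nat.zero_le _, h⟩

theorem trans (h : Reach P T c Q) (h' : ∀ c, Q c → Reach P T' c Q') : Reach P (T + T') c Q' := by
  obtain ⟨t, ht, hQ⟩ := h
  obtain ⟨t', ht', hQ'⟩ := h' _ hQ
  exact ⟨t' + t, by omega, by rwa [Function.iterate_add_apply]⟩

theorem step (h : Reach P T (ramStep P c) Q) : Reach P (T + 1) c Q := by
  obtain ⟨t, ht, hQ⟩ := h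
  exact ⟨t + 1, by omega, by rwa [Function.iterate_succ_apply]⟩

theorem mono (h : Reach P T c Q) (hT : T ≤ T') (hQ : ∀ c, Q c → Q' c) : Reach P T' c Q' := by
  obtain ⟨t, ht, h⟩ := h
  exact ⟨t, ht.trans hT, hQ _ h⟩

end Reach

/-- The addresses and the sizes of the arrays. -/
structure Layout where
  base : ℕ → ℕ
  size : ℕ → ℕ
  lt_of_size : ∀ {a i}, i < size a → a < 12
  disjoint : ∀ {a i a' i'}, i < size a → i' < size a' → base a + i = base a' + i' → a = a' ∧ i = i'

/-- The machine configuration `c` represents the state `s` of a structured program. -/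
structure Represents (L : Layout) (c : RamConfig) (s : Store) : Prop where
  reg : ∀ r, c.reg (r + 12) = s.reg r
  base : ∀ a < 12, c.reg a = L.base a
  arr : ∀ {a i}, i < L.size a → c.mem (L.base a + i) = s.arr a i

/-- The machine has come to position `e` in a state satisfying `Q`, or has stopped with an answer
satisfying `H`. -/
def Post (L : Layout) (P : List RamInstr) (e : ℕ) (Q : Store → Prop) (H : Bool → Prop)
    (c : RamConfig) : Prop :=
  (c.pc = e ∧ ∃ s, Represents L c s ∧ Q s) ∨ ∃ b, P[c.pc]? = some (.halt b) ∧ H b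

namespace Represents

variable {L : Layout} {c : RamConfig} {s : Store}

theorem setReg (h : Represents L c s) (r v pc : ℕ) :
    Represents L ⟨pc, Function.update c.reg (r + 12) v, c.mem⟩ (s.setReg r v) where
  reg r' := by
    by_cases e : r' = r
    · subst e; simp
    · simp [e, h.reg]
  base a ha := by
    simp only [Function.update_of_ne (show a ≠ r + 12 by omega)]
    exact h.base a ha
  arr hi := h.arr hi

theorem setArr (h : Represents L c s) {a i : ℕ} (hi : i < L.size a) (v pc : ℕ) :
    Represents L ⟨pc, c.reg, Function.update c.mem (L.base a + i) v⟩ (s.setArr a i v) where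
  reg := h.reg
  base := h.base
  arr {a' i'} hi' := by
    simp only [Function.update_apply, Store.setArr_arr]
    by_cases e : L.base a' + i' = L.base a + i
    · rw [if_pos e, if_pos (L.disjoint hi' hi e)]
    · rw [if_neg e, if_neg (by rintro ⟨rfl, rfl⟩; exact e rfl)]
      exact h.arr hi'

theorem setPc (h : Represents L c s) (pc : ℕ) : Represents L ⟨pc, c.reg, c.mem⟩ s :=
  ⟨h.reg, h.base, h.arr⟩

end Represents

section Exec

variable {P : List RamInstr} {L : Layout} {H : Bool → Prop}

theorem ramStep_of {c : RamConfig} {x : RamInstr} (h : P[c.pc]? = some x) :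
    ramStep P c = match (some x : Option RamInstr) with
      | some (.const r k) => ⟨c.pc + 1, Function.update c.reg r k, c.mem⟩
      | some (.copy r s) => ⟨c.pc + 1, Function.update c.reg r (c.reg s), c.mem⟩
      | some (.inc r) => ⟨c.pc + 1, Function.update c.reg r (c.reg r + 1), c.mem⟩
      | some (.dec r) => ⟨c.pc + 1, Function.update c.reg r (c.reg r - 1), c.mem⟩
      | some (.load r b i) =>
          ⟨c.pc + 1, Function.update c.reg r (c.mem (c.reg b + c.reg i)), c.mem⟩
      | some (.store b i s) =>
          ⟨c.pc + 1, c.reg, Function.update c.mem (c.reg b + c.reg i) (c.reg s)⟩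
      | some (.jump l) => ⟨l, c.reg, c.mem⟩
      | some (.jumpEq r s l) => ⟨if c.reg r = c.reg s then l else c.pc + 1, c.reg, c.mem⟩
      | some (.jumpLt r s l) => ⟨if c.reg r < c.reg s then l else c.pc + 1, c.reg, c.mem⟩
      | some (.halt _) => c
      | none => c := by
  simp only [ramStep, h]

theorem Post.of_represents {c : RamConfig} {s : Store} {Q : Store → Prop} {e : ℕ}
    (h : Represents L c s) (hpc : c.pc = e) (hQ : Q s) : Post L P e Q H c :=
  Or.inl ⟨hpc, s, h, hQ⟩

/-- To go on after a structured program, it is enough to go on where it has not stopped. -/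
theorem Reach.andThen {c : RamConfig} {Q Q' : Store → Prop} {e e' T T' : ℕ}
    (h : Reach P T c (Post L P e Q H))
    (h' : ∀ c s, Represents L c s → c.pc = e → Q s → Reach P T' c (Post L P e' Q' H)) :
    Reach P (T + T') c (Post L P e' Q' H) :=
  h.trans fun c hc => by
    rcases hc with ⟨hpc, s, hs, hQ⟩ | hc
    · exact h' c s hs hpc hQ
    · exact .refl (Or.inr hc)

/-- Common to both conditionals: the else-branch stands first and ends with a jump over the
then-branch. -/
theorem Reach.branch {c : RamConfig} {s : Store} {Q : Store → Prop} {p : Prop} [Decidable p]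
    {o m k : ℕ} (h : Represents L c s) (hjump : P[o + 1 + m]? = some (.jump (o + m + 2 + k)))
    (hstep : ramStep P c = ⟨if p then o + m + 2 else o + 1, c.reg, c.mem⟩)
    (h1 : p → ∀ c, Represents L c s → c.pc = o + m + 2 →
      Reach P k c (Post L P (o + m + 2 + k) Q H))
    (h2 : ¬ p → ∀ c, Represents L c s → c.pc = o + 1 →
      Reach P m c (Post L P (o + 1 + m) Q H)) :
    Reach P (k + m + 2) c (Post L P (o + (k + m + 2)) Q H) := by
  have e : o + (k + m + 2) = o + m + 2 + k := by omega
  rw [e]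
  by_cases hp : p
  · refine Reach.mono (T := k + 1) (Reach.step ?_) (by omega) fun _ h => h
    rw [hstep, if_pos hp]
    exact h1 hp _ (h.setPc _) rfl
  · refine Reach.mono (T := m + 1 + 1) (Reach.step ?_) (by omega) fun _ h => h
    rw [hstep, if_neg hp]
    refine (h2 hp _ (h.setPc _) rfl).andThen fun c s hs hpc hQ => ?_
    refine Reach.step (T := 0) (.refl ?_)
    rw [ramStep_of (x := .jump (o + m + 2 + k)) (by rw [hpc]; exact hjump)]
    exact .of_represents (hs.setPc _) rfl hQ

/-- The machine executes compiled programs correctly. -/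
theorem Code.reach (code : Code) {o : ℕ} (hP : CodeAt P o (code.compile o)) {Q : Store → Prop}
    {c : RamConfig} {s : Store} (h : Represents L c s) (hpc : c.pc = o)
    (hwp : code.wp L.size H Q s) : Reach P code.size c (Post L P (o + code.size) Q H) := by
  -- Without loops every instruction is executed at most once, so the size of the code bounds its
  -- running time.
  induction code generalizing o Q c s with
  | skip => exact .refl (.of_represents h hpc hwp)
  | halt b => exact .refl (Or.inr ⟨b, by rw [hpc]; exact hP.head, hwp⟩)
  | const r k =>
    refine Reach.step (T := 0) (.refl ?_)
    rw [ramStep_of (by rw [hpc]; exact hP.head)]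
    exact .of_represents (h.setReg _ _ _) (by simp [hpc, size]) hwp
  | copy r k =>
    refine Reach.step (T := 0) (.refl ?_)
    rw [ramStep_of (by rw [hpc]; exact hP.head)]
    refine .of_represents (h.setReg _ _ _) (by simp [hpc, size]) ?_
    rw [h.reg]; exact hwp
  | inc r =>
    refine Reach.step (T := 0) (.refl ?_)
    rw [ramStep_of (by rw [hpc]; exact hP.head)]
    refine .of_represents (h.setReg _ _ _) (by simp [hpc, size]) ?_
    rw [h.reg]; exact hwp
  | dec r =>
    refine Reach.step (T := 0) (.refl ?_)
    rw [ramStep_of (by rw [hpc]; exact hP.head)]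
    refine .of_represents (h.setReg _ _ _) (by simp [hpc, size]) ?_
    rw [h.reg]; exact hwp
  | load r a i =>
    refine Reach.step (T := 0) (.refl ?_)
    rw [ramStep_of (by rw [hpc]; exact hP.head)]
    refine .of_represents (h.setReg _ _ _) (by simp [hpc, size]) ?_
    rw [h.reg, h.base a (L.lt_of_size hwp.1), h.arr hwp.1]; exact hwp.2
  | store a i r =>
    refine Reach.step (T := 0) (.refl ?_)
    rw [ramStep_of (by rw [hpc]; exact hP.head)]
    simp only [h.reg, h.base a (L.lt_of_size hwp.1)]
    exact .of_represents (h.setArr hwp.1 _ _) (by simp [hpc, size]) hwp.2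
  | seq d e ihd ihe =>
    refine (ihd hP.append_left h hpc hwp).andThen fun c s hs hpc hQ => ?_
    have := hP.append_right
    rw [length_compile] at this
    rw [size, ← add_assoc]
    exact ihe this hs hpc hQ
  | ifEq r r' d e ihd ihe =>
    have h1 := hP.tail.append_left
    have h2 := hP.tail.append_right
    rw [length_compile] at h2
    refine Reach.branch (p := s.reg r = s.reg r') h h2.head ?_ (fun hp c hs hc => ?_)
      (fun hp c hs hc => ?_)
    · rw [ramStep_of (by rw [hpc]; exact hP.head)]
      simp only [h.reg, hpc]
    · refine ihd ?_ hs hc (hwp.1 hp)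
      have := h2.tail
      rwa [show o + 1 + e.size + 1 = o + e.size + 2 by omega] at this
    · exact ihe h1 hs hc (hwp.2 hp)
  | ifLt r r' d e ihd ihe =>
    have h1 := hP.tail.append_left
    have h2 := hP.tail.append_right
    rw [length_compile] at h2
    refine Reach.branch (p := s.reg r < s.reg r') h h2.head ?_ (fun hp c hs hc => ?_)
      (fun hp c hs hc => ?_)
    · rw [ramStep_of (by rw [hpc]; exact hP.head)]
      simp only [h.reg, hpc]
    · refine ihd ?_ hs hc (hwp.1 hp)
      have := h2.tail
      rwa [show o + 1 + e.size + 1 = o + e.size + 2 by omega] at this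
    · exact ihe h1 hs hc (hwp.2 (not_lt.1 hp))

/-- Programs with loops. -/
inductive Prog where
  | code (c : Code)
  /-- `while reg r < reg s do c` -/
  | loop (r s : ℕ) (c : Code)
  | seq (p q : Prog)

namespace Prog

def size : Prog → ℕ
  | code c => c.size
  | loop _ _ c => c.size + 3
  | seq p q => p.size + q.size

def compile : ℕ → Prog → List RamInstr
  | o, code c => c.compile o
  | o, loop r s c => .jumpLt (r + 12) (s + 12) (o + 2) :: .jump (o + 3 + c.size) ::
      (c.compile (o + 2) ++ [.jump o])
  | o, seq p q => p.compile o ++ q.compile (o + p.size)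

@[simp] theorem length_compile (o : ℕ) (p : Prog) : (p.compile o).length = p.size := by
  induction p generalizing o with
  | code c => simp [compile, size]
  | loop r s c => simp [compile, size]
  | seq p q ihp ihq => simp [compile, size, ihp, ihq]

/-- From a state satisfying `Q`, the program comes within `T` steps to a state satisfying `Q'`, or
stops with an answer satisfying `H`. -/
def Spec (sz : ℕ → ℕ) (H : Bool → Prop) (Q : Store → Prop) (p : Prog) (T : ℕ) (Q' : Store → Prop) :
    Prop :=
  ∀ (P : List RamInstr) (L : Layout) (o : ℕ) (c : RamConfig) (s : Store), L.size = sz →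
    CodeAt P o (p.compile o) → Represents L c s → c.pc = o → Q s →
    Reach P T c (Post L P (o + p.size) Q' H)

variable {sz : ℕ → ℕ} {Q Q' Q'' : Store → Prop} {T T' : ℕ}

theorem Spec.code {c : Code} (h : ∀ s, Q s → c.wp sz H Q' s) : Spec sz H Q (code c) c.size Q' := by
  rintro P L o cfg s rfl hP hs hpc hQ
  exact c.reach hP hs hpc (h s hQ)

theorem Spec.seq {p q : Prog} (hp : Spec sz H Q p T Q') (hq : Spec sz H Q' q T' Q'') :
    Spec sz H Q (seq p q) (T + T') Q'' := by
  intro P L o cfg s hsz hP hs hpc hQ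
  refine (hp P L o cfg s hsz hP.append_left hs hpc hQ).andThen fun c s hs hpc hQ => ?_
  have := hP.append_right
  rw [length_compile] at this
  rw [size, ← add_assoc]
  exact hq P L _ c s hsz this hs hpc hQ

/-- The index `m` of the invariant bounds the remaining rounds. A round costs the body, the test and
the jump back; leaving the loop costs two steps. -/
theorem Spec.loop {r r' : ℕ} {c : Code} (Inv : ℕ → Store → Prop) (M : ℕ)
    (h0 : ∀ s, Q s → ∃ m ≤ M, Inv m s)
    (h1 : ∀ m s, Inv m s → s.reg r < s.reg r' → c.wp sz H (fun s' => ∃ m' < m, Inv m' s') s)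
    (h2 : ∀ m s, Inv m s → s.reg r' ≤ s.reg r → Q' s) :
    Spec sz H Q (loop r r' c) ((c.size + 2) * (M + 1) + 2) Q' := by
  rintro P L o cfg s rfl hP hs hpc hQ
  obtain ⟨m, hM, hInv⟩ := h0 s hQ
  have h3 := hP.tail.tail.append_left
  have h4 := hP.tail.tail.append_right.head
  have hstart : ∀ (c : RamConfig) (s : Store), Represents L c s → c.pc = o →
      ramStep P c = ⟨if s.reg r < s.reg r' then o + 2 else o + 1, c.reg, c.mem⟩ := by
    intro c s hs hpc
    rw [ramStep_of (by rw [hpc]; exact hP.head)]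
    simp only [hs.reg, hpc]
  suffices key : ∀ (m : ℕ) (cfg : RamConfig) (s : Store), Represents L cfg s → cfg.pc = o →
      Inv m s → Reach P ((c.size + 2) * (m + 1) + 2) cfg
        (Post L P (o + (Prog.loop r r' c).size) Q' H) from
    (key m cfg s hs hpc hInv).mono (by gcongr) fun _ h => h
  intro m
  induction m using Nat.strong_induction_on with
  | _ m ih =>
    intro cfg s hs hpc hInv
    by_cases hlt : s.reg r < s.reg r'
    · refine Reach.mono (T := c.size + ((c.size + 2) * m + 2 + 1) + 1) (Reach.step ?_)
        (by ring_nf; omega) fun _ h => h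
      rw [hstart cfg s hs hpc, if_pos hlt]
      refine (c.reach h3 (hs.setPc _) rfl (h1 m s hInv hlt)).andThen fun cfg' s' hs' hpc' hQ' => ?_
      refine Reach.step ?_
      rw [ramStep_of (by rw [hpc', ← Code.length_compile (o + 2)]; exact h4)]
      obtain ⟨m', hm', hInv'⟩ := hQ'
      exact (ih m' hm' _ s' (hs'.setPc _) rfl hInv').mono (by gcongr; omega) fun _ h => h
    · refine Reach.mono (T := 0 + 1 + 1) (Reach.step (Reach.step (.refl ?_)))
        (by omega) fun _ h => h
      rw [hstart cfg s hs hpc, if_neg hlt, ramStep_of (x := .jump (o + 3 + c.size)) hP.tail.head]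
      exact .of_represents (hs.setPc _) (by simp only [size]; omega) (h2 m s hInv (not_lt.1 hlt))

end Prog

end Exec

/-! ### The program for depth-first search -/

/-- `inp` holds the adjacency lists `nb` of a graph on `{0, …, n - 1}`. -/
structure HoldsLists (n : ℕ) (nb : ℕ → List ℕ) (inp : ℕ → ℕ) : Prop where
  zero : inp 0 = n
  start_succ : ∀ v < n, inp (v + 2) = inp (v + 1) + (nb v).length
  get : ∀ v < n, ∀ i < (nb v).length, (nb v)[i]? = some (inp (inp (v + 1) + i))
  start_le : ∀ v ≤ n, inp (v + 1) ≤ inp (n + 1)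
  le_end : n + 2 ≤ inp (n + 1)

/-- The sizes of the arrays: the input, and eleven arrays indexed by `0, …, n`. -/
def arraySize (n N a : ℕ) : ℕ := if a = 0 then N else if a < 12 then n + 1 else 0

/-- The stack `l`, linked by the array `f`, in which `0` stands for the end. -/
def LinkedStack (f : ℕ → ℕ) : ℕ → List ℕ → Prop
  | top, [] => top = 0
  | top, t :: l => top = t + 1 ∧ LinkedStack f (f t) l

theorem LinkedStack.congr {f g : ℕ → ℕ} {l : List ℕ} (hfg : ∀ x ∈ l, f x = g x) :
    ∀ {top}, LinkedStack f top l → LinkedStack g top l := by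
  induction l with
  | nil => exact fun h => h
  | cons t l ih =>
    rintro top ⟨h1, h2⟩
    refine ⟨h1, ?_⟩
    rw [← hfg t List.mem_cons_self]
    exact ih (fun x hx => hfg x (List.mem_cons_of_mem _ hx)) h2

/-- The arrays: `1` the numbers, `2` the scan pointers, `3` the links of the stack, `4`, …, `9` the
last six smaller numbers seen from each number. -/
structure DfsRel (n : ℕ) (inp : ℕ → ℕ) (d : DfsState) (s : Store) : Prop where
  reg0 : s.reg 0 = 0
  reg1 : s.reg 1 = n
  reg5 : s.reg 5 = d.cnt
  reg6 : s.reg 6 = d.root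
  arr0 : s.arr 0 = inp
  arr1 : ∀ v, s.arr 1 v = d.num v
  arr2 : ∀ v, d.num v ≠ 0 → s.arr 2 v = inp (v + 1) + d.pos v
  stk : LinkedStack (s.arr 3) (s.reg 7) d.stk
  slot : ∀ j < 6, ∀ k, s.arr (4 + j) k = (d.low k).getD j 0
  arr10 : ∀ k, s.arr 10 k = 0
  arr11 : ∀ k, s.arr 11 k = 0

open Code in
/-- Visit the vertex in register `12`. -/
def visitCode : Code :=
  .seq (inc 5) <| .seq (store 1 12 5) <| .seq (store 3 12 7) <| .seq (copy 7 12) <|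
  .seq (inc 7) <| .seq (copy 10 12) <| .seq (inc 10) <| .seq (load 11 0 10) (store 2 12 11)

open Code in
/-- Put register `14` in front of the slots of register `13`. -/
def insertCode : Code :=
  .seq (load 15 8 13) <| .seq (store 9 13 15) <| .seq (load 15 7 13) <| .seq (store 8 13 15) <|
  .seq (load 15 6 13) <| .seq (store 7 13 15) <| .seq (load 15 5 13) <| .seq (store 6 13 15) <|
  .seq (load 15 4 13) <| .seq (store 5 13 15) <| (store 4 13 14)

open Code in
/-- One step of depth-first search. -/
def dfsBody : Code :=
  .ifEq 7 0
    (.ifLt 6 1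
      (.seq (load 10 1 6) <| .seq (.ifEq 10 0 (.seq (copy 12 6) visitCode) skip) (inc 6))
      (const 8 0))
    (.seq (copy 9 7) <| .seq (dec 9) <| .seq (load 10 2 9) <| .seq (copy 11 9) <|
      .seq (inc 11) <| .seq (inc 11) <| .seq (load 11 0 11) <|
      .ifLt 10 11
        (.seq (load 12 0 10) <| .seq (inc 10) <| .seq (store 2 9 10) <| .seq (load 14 1 12) <|
          .ifEq 14 0 visitCode (.seq (load 13 1 9) (.ifLt 14 13 insertCode skip)))
        (load 7 3 9))

/-! ### The program carries out the depth-first search -/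

section Dfs

variable {n N : ℕ} {nb : ℕ → List ℕ} {inp : ℕ → ℕ} {d : DfsState} {s : Store} {H : Bool → Prop}

theorem wp_visitCode (hI : HoldsLists n nb inp) (hN : N = inp (n + 1)) {w : ℕ} (hw : s.reg 12 = w)
    (hwn : w < n) (hin : s.arr 0 = inp) (Q : Store → Prop)
    (hQ : ∀ s' : Store, s'.reg 5 = s.reg 5 + 1 → s'.reg 7 = w + 1 →
      (∀ r < 9, r ≠ 5 → r ≠ 7 → s'.reg r = s.reg r) →
      (∀ v, s'.arr 1 v = if v = w then s.reg 5 + 1 else s.arr 1 v) →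
      (∀ v, s'.arr 2 v = if v = w then inp (w + 1) else s.arr 2 v) →
      (∀ v, s'.arr 3 v = if v = w then s.reg 7 else s.arr 3 v) →
      (∀ a, a ≠ 1 → a ≠ 2 → a ≠ 3 → s'.arr a = s.arr a) → Q s') :
    visitCode.wp (arraySize n N) H Q s := by
  have := hI.le_end
  have h0 : ∀ a, 1 ≤ a → a < 12 → arraySize n N a = n + 1 := fun a h1 h2 => by
    rw [arraySize, if_neg (by omega), if_pos h2]
  simp only [visitCode, Code.wp]
  refine ⟨?_, ?_, ?_, ?_, hQ _ ?_ ?_ ?_ ?_ ?_ ?_ ?_⟩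
  · simp [h0, hw]; omega
  · simp [h0, hw]; omega
  · simp [arraySize, hw]; omega
  · simp [h0, hw]; omega
  · simp
  · simp [hw]
  · intro r h1 h2 h3
    simp [h2, h3, show r ≠ 10 by omega, show r ≠ 11 by omega]
  · simp [Store.setArr_arr, hw]
  · simp [Store.setArr_arr, hw, hin]
  · simp [Store.setArr_arr, hw]
  · intro a h1 h2 h3
    funext i
    simp [Store.setArr_arr, h1, h2, h3]

/-- The slots are shifted from the back, so each is copied before it is overwritten; only the
content of the sixth is lost. -/
theorem wp_insertCode {x : ℕ} (hx : s.reg 13 = x) (hxn : x ≤ n) (Q : Store → Prop)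
    (hQ : ∀ s' : Store, (∀ r < 9, s'.reg r = s.reg r) →
      (∀ a < 4, s'.arr a = s.arr a) → (∀ a, 10 ≤ a → s'.arr a = s.arr a) →
      (∀ k, s'.arr 4 k = if k = x then s.reg 14 else s.arr 4 k) →
      (∀ j < 5, ∀ k, s'.arr (4 + (j + 1)) k = s.arr (4 + if k = x then j else j + 1) k) → Q s') :
    insertCode.wp (arraySize n N) H Q s := by
  have h0 : ∀ a, 1 ≤ a → a < 12 → arraySize n N a = n + 1 := fun a h1 h2 => by
    rw [arraySize, if_neg (by omega), if_pos h2]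
  simp only [insertCode, Code.wp]
  refine ⟨?_, ?_, ?_, ?_, ?_, ?_, ?_, ?_, ?_, ?_, ?_, hQ _ ?_ ?_ ?_ ?_ ?_⟩
  any_goals (simp [h0, hx]; omega)
  · intro r hr
    simp [show r ≠ 15 by omega]
  · intro a ha
    funext i
    simp [Store.setArr_arr, show a ≠ 4 by omega, show a ≠ 5 by omega, show a ≠ 6 by omega,
      show a ≠ 7 by omega, show a ≠ 8 by omega, show a ≠ 9 by omega]
  · intro a ha
    funext i
    simp [Store.setArr_arr, show a ≠ 4 by omega, show a ≠ 5 by omega, show a ≠ 6 by omega,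
      show a ≠ 7 by omega, show a ≠ 8 by omega, show a ≠ 9 by omega]
  · simp [Store.setArr_arr, hx]
  · intro j hj k
    by_cases hk : k = x
    · interval_cases j <;> simp [Store.setArr_arr, hx, hk]
    · interval_cases j <;> simp [Store.setArr_arr, hx, hk]

theorem LinkedStack.cons_of {f g : ℕ → ℕ} {l : List ℕ} {w top : ℕ} (h : LinkedStack f top l)
    (hw : w ∉ l) (hg : ∀ v, g v = if v = w then top else f v) : LinkedStack g (w + 1) (w :: l) := by
  refine ⟨rfl, ?_⟩
  rw [hg w, if_pos rfl]
  exact h.congr fun x hx => by rw [hg, if_neg (by rintro rfl; exact hw hx)]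

/-- The invariant of the loop, with a bound for the number of remaining rounds. -/
def DfsLoopInv (n : ℕ) (nb : ℕ → List ℕ) (inp : ℕ → ℕ) (m : ℕ) (s : Store) : Prop :=
  ∃ d, DfsInv n nb d ∧ DfsRel n inp d s ∧
    ((s.reg 8 = 1 ∧ m = d.potential n nb + 1) ∨ (s.reg 8 = 0 ∧ d.stk = [] ∧ d.root = n))

theorem DfsRel.visit (hs : DfsRel n inp d s) (hd : DfsInv n nb d) {w : ℕ} (hw : d.num w = 0)
    {s' : Store} {root' : ℕ} {pos' : ℕ → ℕ} (hpos : ∀ v, v ≠ w → d.num v ≠ 0 →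
      s'.arr 2 v = inp (v + 1) + pos' v) (hpos' : s'.arr 2 w = inp (w + 1) + pos' w) (h0 : s'.reg 0 = 0)
    (h1 : s'.reg 1 = n) (h5 : s'.reg 5 = s.reg 5 + 1) (h6 : s'.reg 6 = root')
    (h7 : s'.reg 7 = w + 1)
    (a1 : ∀ v, s'.arr 1 v = if v = w then s.reg 5 + 1 else s.arr 1 v)
    (a3 : ∀ v, s'.arr 3 v = if v = w then s.reg 7 else s.arr 3 v)
    (ha : ∀ a, a ≠ 1 → a ≠ 2 → a ≠ 3 → s'.arr a = s.arr a) :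
    DfsRel n inp ⟨Function.update d.num w (d.cnt + 1), d.cnt + 1, w :: d.stk, pos', d.low, root'⟩
      s' := by
  constructor <;> try dsimp only
  · exact h0
  · exact h1
  · rw [h5, hs.reg5]
  · exact h6
  · rw [ha 0 (by decide) (by decide) (by decide), hs.arr0]
  · intro v
    rw [a1, hs.reg5, hs.arr1, Function.update_apply]
  · intro v hv
    by_cases e : v = w
    · rw [e, hpos']
    · rw [Function.update_of_ne e] at hv
      exact hpos v e hv
  · rw [h7]
    exact hs.stk.cons_of (fun hm => hd.stk_num w hm hw) a3
  · intro j hj k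
    rw [ha _ (by omega) (by omega) (by omega)]
    exact hs.slot j hj k
  · rw [ha 10 (by decide) (by decide) (by decide)]; exact hs.arr10
  · rw [ha 11 (by decide) (by decide) (by decide)]; exact hs.arr11

/-- The branches of the body correspond to the steps `visit_root`, `skip_root`, `visit_child`,
`scan_low`, `scan_skip` and `pop`, each of which lowers the potential. In the remaining branch the
search is complete and register `8` is cleared. -/
theorem wp_dfsBody (hnb : AdjFamily n nb) (hI : HoldsLists n nb inp) (hN : N = inp (n + 1)) {m : ℕ}
    (h : DfsLoopInv n nb inp m s) (h8 : s.reg 0 < s.reg 8) :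
    dfsBody.wp (arraySize n N) H (fun s' => ∃ m' < m, DfsLoopInv n nb inp m' s') s := by
  obtain ⟨d, hd, hs, hm⟩ := h
  obtain ⟨hg, rfl⟩ : s.reg 8 = 1 ∧ m = d.potential n nb + 1 := by
    rcases hm with hm | ⟨hm, -⟩
    · exact hm
    · omega
  have h0 : ∀ a, 1 ≤ a → a < 12 → arraySize n N a = n + 1 := fun a h1 h2 => by
    rw [arraySize, if_neg (by omega), if_pos h2]
  have hsz0 : arraySize n N 0 = N := rfl
  have r0 := hs.reg0
  have r1 := hs.reg1
  have r6 := hs.reg6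
  rw [dfsBody, Code.wp]
  constructor
  · intro h7
    have hstk : d.stk = [] := by
      rcases hk : d.stk with _ | ⟨t, l⟩
      · rfl
      · have := hs.stk
        rw [hk, h7, r0] at this
        exact absurd this.1 (by omega)
    rw [Code.wp]
    constructor
    · intro hr
      rw [r6, r1] at hr
      simp only [Code.wp]
      refine ⟨by rw [h0 1 (by omega) (by omega), r6]; omega, ?_, ?_⟩
      · intro hz
        have hnum : d.num d.root = 0 := by
          simpa [hs.arr1, r6, r0] using hz
        refine wp_visitCode hI hN (w := d.root) (by simp [r6]) hr (by simp [hs.arr0]) _ ?_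
        intro s' h5 h7 hreg a1 a2 a3 ha
        have hd' := hd.visit_root hnb hstk hr hnum
        refine ⟨_, ?_, _, hd', ?_, Or.inl ⟨?_, rfl⟩⟩
        -- Trying a root releases two units of potential, and the push consumes only one.
        · simp only [DfsState.potential, hstk, List.length_cons, List.length_nil]
          omega
        · rw [← hstk]
          refine hs.visit hd hnum ?_ ?_ ?_ ?_ ?_ ?_ ?_ ?_ ?_ ?_
          · intro v hv hv'
            simpa [a2, hv] using hs.arr2 v hv'
          · simp [a2, hd.pos_zero _ hnum]
          · simp [hreg, r0]
          · simp [hreg, r1]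
          · simp [h5]
          · simp [hreg, r6]
          · simp [h7]
          · simpa using a1
          · simpa using a3
          · simpa using ha
        · simp [hreg, hg]
      · intro hz
        have hnum : d.num d.root ≠ 0 := by
          simpa [hs.arr1, r6, r0] using hz
        have hd' := hd.skip_root hnum
        refine ⟨_, ?_, _, hd', ?_, Or.inl ⟨?_, rfl⟩⟩
        · simp only [DfsState.potential]
          omega
        · exact ⟨by simp [r0], by simp [r1], by simp [hs.reg5], by simp [r6], by simp [hs.arr0],
            by simp [hs.arr1], by simpa using hs.arr2, by simpa using hs.stk, by simpa using hs.slot,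
            by simpa using hs.arr10, by simpa using hs.arr11⟩
        · simp [hg]
    · intro hr
      rw [r6, r1] at hr
      refine ⟨0, by omega, d, hd, ?_, Or.inr ⟨by simp, hstk, le_antisymm hd.root_le hr⟩⟩
      exact ⟨by simp [r0], by simp [r1], by simp [hs.reg5], by simp [r6], by simp [hs.arr0],
            by simp [hs.arr1], by simpa using hs.arr2, by simpa using hs.stk, by simpa using hs.slot,
            by simpa using hs.arr10, by simpa using hs.arr11⟩
  · intro h7
    obtain ⟨t, tl, hstk⟩ : ∃ t tl, d.stk = t :: tl := by
      rcases hk : d.stk with _ | ⟨t, l⟩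
      · have := hs.stk
        rw [hk] at this
        exact (h7 (this.trans r0.symm)).elim
      · exact ⟨t, l, rfl⟩
    have hts : d.num t ≠ 0 := hd.stk_num t (by simp [hstk])
    have htn := hd.lt_of_num hts
    have hlink := hs.stk
    rw [hstk] at hlink
    obtain ⟨ht7, hlink⟩ := hlink
    have hst : inp (t + 2) ≤ inp (n + 1) := hI.start_le (t + 1) (by omega)
    have hss := hI.start_succ t htn
    have hple := hd.pos_le t
    have hle := hI.le_end
    have hptr := hs.arr2 t hts
    have htst : t ∉ tl := by
      have := hd.stk_sorted
      rw [hstk] at this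
      exact fun hm => ((List.pairwise_cons.1 this).1 t hm).false
    simp only [Code.wp]
    refine ⟨?_, ?_, ?_, ?_⟩
    · simp [h0, ht7]; omega
    · simp [hsz0, ht7]; omega
    · intro hlt
      replace hlt : inp (t + 1) + d.pos t < inp (t + 2) := by
        simpa [ht7, hptr, hs.arr0] using hlt
      have hw := hI.get t htn (d.pos t) (by omega)
      have hsum := sum_sub_update_succ (len := fun v => (nb v).length) (pos := d.pos) htn
        (by omega)
      set w := inp (inp (t + 1) + d.pos t) with hwdef
      have hwn : w < n := hnb.lt (List.mem_of_getElem? hw)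
      have hr14 : s.arr 1 w = d.num w := hs.arr1 w
      refine ⟨?_, ?_, ?_, ?_, ?_⟩
      · simp [hsz0, ht7, hptr]; omega
      · simp [h0, ht7]; omega
      · simp [h0, ht7, hptr, hs.arr0, ← hwdef]; omega
      · intro hz
        have hnum : d.num w = 0 := by
          simpa [ht7, hptr, hs.arr0, Store.setArr_arr, ← hwdef, hr14, r0] using hz
        refine wp_visitCode hI hN (w := w) (by simp [ht7, hptr, hs.arr0, ← hwdef]) hwn
          (by simp [hs.arr0, Store.setArr]) _ ?_
        intro s' h5 h7 hreg a1 a2 a3 ha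
        have hd' := hd.visit_child hnb hstk hw hnum
        refine ⟨_, ?_, _, hd', ?_, Or.inl ⟨?_, rfl⟩⟩
        · simp only [DfsState.potential, List.length_cons]
          omega
        · have htw : t ≠ w := by rintro e; exact hts (e ▸ hnum)
          refine hs.visit hd hnum ?_ ?_ ?_ ?_ ?_ ?_ ?_ ?_ ?_ ?_
          · intro v hv hv'
            by_cases e : v = t
            · subst e
              simp [a2, hv, Store.setArr_arr, ht7, hptr, add_assoc]
            · simpa [a2, hv, Store.setArr_arr, ht7, e] using hs.arr2 v hv'
          · rw [Function.update_of_ne htw.symm, hd.pos_zero _ hnum]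
            simp [a2]
          · simp [hreg, r0]
          · simp [hreg, r1]
          · simp [h5]
          · simp [hreg, r6]
          · simp [h7]
          · simpa [Store.setArr_arr] using a1
          · simpa [Store.setArr_arr] using a3
          · intro a b1 b2 b3
            rw [ha a b1 b2 b3]
            simp [Store.setArr, b2]
        · simp [hreg, hg]
      · intro hz
        have hnum : d.num w ≠ 0 := by
          simpa [ht7, hptr, hs.arr0, Store.setArr_arr, ← hwdef, hr14, r0] using hz
        refine ⟨?_, ?_, ?_⟩
        · simp [h0, ht7]; omega
        · intro hlow
          replace hlow : d.num w < d.num t := by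
            simpa [ht7, hptr, hs.arr0, Store.setArr_arr, ← hwdef, hs.arr1] using hlow
          have hd' := hd.scan_low hnb hstk hw hnum hlow
          have htc := (hd.num_le t).trans hd.cnt_le
          refine wp_insertCode (x := d.num t) (by simp [ht7, Store.setArr_arr, hs.arr1]) htc _ ?_
          intro s' hreg ha hb a4 aj
          refine ⟨_, ?_, _, hd', ?_, Or.inl ⟨?_, rfl⟩⟩
          · simp only [DfsState.potential]
            omega
          · constructor <;> try dsimp only
            · simp [hreg, r0]
            · simp [hreg, r1]
            · simp [hreg, hs.reg5]
            · simp [hreg, r6]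
            · simp [ha, Store.setArr, hs.arr0]
            · simp [ha, Store.setArr, hs.arr1]
            · intro v hv
              by_cases e : v = t
              · subst e
                simp [ha, Store.setArr_arr, ht7, hptr, add_assoc]
              · simpa [ha, Store.setArr_arr, ht7, e] using hs.arr2 v hv
            · simpa [hreg, ha, Store.setArr] using hs.stk
            · intro j hj k
              rcases j with _ | j
              · rw [add_zero, a4]
                have := hs.slot 0 (by omega) k
                by_cases hk : k = d.num t
                · simp [hk, ht7, hptr, hs.arr0, ← hwdef, Store.setArr_arr, hs.arr1]
                · simpa [hk, Function.update_of_ne hk, Store.setArr_arr] using this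
              · rw [aj j (by omega)]
                by_cases hk : k = d.num t
                · have := hs.slot j (by omega) k
                  rw [if_pos hk]
                  simpa [hk, Store.setArr_arr, show 4 + j ≠ 2 by omega] using hk ▸ this
                · have := hs.slot (j + 1) hj k
                  rw [if_neg hk]
                  simpa [hk, Function.update_of_ne hk, Store.setArr_arr,
                    show 4 + (j + 1) ≠ 2 by omega] using this
            · simp [hb, Store.setArr, hs.arr10]
            · simp [hb, Store.setArr, hs.arr11]
          · simp [hreg, hg]
        · intro hge
          replace hge : ¬ d.num w < d.num t := by
            simpa [ht7, hptr, hs.arr0, Store.setArr_arr, ← hwdef, hs.arr1] using hge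
          have hd' := hd.scan_skip hstk hw hnum hge
          refine ⟨_, ?_, _, hd', ?_, Or.inl ⟨?_, rfl⟩⟩
          · simp only [DfsState.potential]
            omega
          · constructor <;> try dsimp only
            · simp [r0]
            · simp [r1]
            · simp [hs.reg5]
            · simp [r6]
            · simp [Store.setArr, hs.arr0]
            · simp [Store.setArr, hs.arr1]
            · intro v hv
              by_cases e : v = t
              · subst e
                simp [Store.setArr_arr, ht7, hptr, add_assoc]
              · simpa [Store.setArr_arr, ht7, e] using hs.arr2 v hv
            · simpa [Store.setArr] using hs.stk
            · intro j hj k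
              simpa [Store.setArr_arr, show 4 + j ≠ 2 by omega] using hs.slot j hj k
            · simp [Store.setArr, hs.arr10]
            · simp [Store.setArr, hs.arr11]
          · simp [hg]
    · intro hge
      replace hge : inp (t + 2) ≤ inp (t + 1) + d.pos t := by
        simpa [ht7, hptr, hs.arr0] using hge
      have hd' := hd.pop hstk (by omega)
      refine ⟨?_, _, ?_, _, hd', ?_, Or.inl ⟨?_, rfl⟩⟩
      · simp [h0, ht7]; omega
      · simp only [DfsState.potential, hstk, List.length_cons]
        omega
      · exact ⟨by simp [r0], by simp [r1], by simp [hs.reg5], by simp [r6], by simp [hs.arr0],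
            by simp [hs.arr1], by simpa using hs.arr2, by simpa [ht7] using hlink,
            by simpa using hs.slot, by simpa using hs.arr10, by simpa using hs.arr11⟩
      · simp [hg]

end Dfs

/-! ### The decision at a vertex in the peeling procedure -/

/-- Equality in terms of a strict order. -/
def Tied (ρ : ℕ → ℕ → Prop) (a b : ℕ) : Prop := ¬ ρ a b ∧ ¬ ρ b a

/-- The registers for the `i`-th stack entry: `j = 0` is the entry itself, `j = 1, …, 5` are its
smaller neighbours, `j = 6` tells whether it is saturated, and `j = 7` is the next entry. -/
def cell (i j : ℕ) : ℕ := 40 + 8 * i + j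

/-- The register for a vertex of the piece: register `10` for the parent, and the entries. -/
def pieceReg : ℕ → ℕ
  | 0 => 10
  | i + 1 => cell i 0

/-- The register that tells whether a vertex of the piece is saturated. -/
def flagReg : ℕ → ℕ
  | 0 => 11
  | i + 1 => cell i 6

/-- The `i`-th entry has a smaller neighbour that is not smaller than the top entry. -/
def InSeg (ρ : ℕ → ℕ → Prop) (i : ℕ) : Prop := ∃ j < 5, ¬ ρ (cell i (j + 1)) (cell 0 0)

/-- The run of subtree entries must end among the loaded entries `0, …, K`. Entries past the end of
the stack read as `0`, which has no smaller neighbours and ends the run. -/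
def IsSegLength (ρ : ℕ → ℕ → Prop) (K k : ℕ) : Prop :=
  1 ≤ k ∧ k ≤ K ∧ (∀ i, 1 ≤ i → i < k → InSeg ρ i) ∧ ¬ InSeg ρ k

/-- Register `0` holds the number 0, so a tie with it marks an empty slot. -/
def IsClosedSeg (ρ : ℕ → ℕ → Prop) (k : ℕ) : Prop :=
  ∀ i < k, ∀ j < 5, ρ (cell i (j + 1)) (cell 0 0) →
    Tied ρ (cell i (j + 1)) 10 ∨ Tied ρ (cell i (j + 1)) 0

/-- The graph on the parent and the first `k` entries. -/
def pieceGraph (ρ : ℕ → ℕ → Prop) (k : ℕ) : SimpleGraph (Fin (k + 1)) :=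
  SimpleGraph.fromRel fun a b => ∃ i, (a : ℕ) = i + 1 ∧
    ∃ j < 5, Tied ρ (cell i (j + 1)) (pieceReg b) ∧ ¬ Tied ρ (cell i (j + 1)) 0

def pieceSat (ρ : ℕ → ℕ → Prop) (k : ℕ) : Set (Fin (k + 1)) := {a | ¬ Tied ρ (flagReg a) 0}

open Classical in
/-- What to do at a vertex, depending on the order of the registers. -/
noncomputable def peelAction (K : ℕ) (ρ : ℕ → ℕ → Prop) : Code :=
  -- Deciding `Good` costs no machine time: only finitely many relations `ρ` occur, and the outcome
  -- for each is part of the program text.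
  if h : ∃ k, IsSegLength ρ K k then
    if IsClosedSeg ρ h.choose then
      if Good (pieceGraph ρ h.choose) (pieceSat ρ h.choose ∪ {0}) then .copy 7 (cell h.choose 0)
      else if Good (pieceGraph ρ h.choose) (pieceSat ρ h.choose) then
        .seq (.copy 7 (cell h.choose 0)) (.seq (.const 13 1) (.store 10 10 13))
      else .halt false
    else .skip
  else .halt false

/-- The order `ρ` of the registers is as it should be for the stack entries `e`. -/
structure Reads (K : ℕ) (low : ℕ → List ℕ) (sat : Set ℕ) (c r : ℕ) (e : ℕ → ℕ)
    (ρ : ℕ → ℕ → Prop) : Prop where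
  slot_lt : ∀ i ≤ K, ∀ j < 5, (ρ (cell i (j + 1)) (cell 0 0) ↔ (low (e i)).getD j 0 < c)
  slot_par : ∀ i ≤ K, ∀ j < 5, (Tied ρ (cell i (j + 1)) 10 ↔ (low (e i)).getD j 0 = r)
  slot_zero : ∀ i ≤ K, ∀ j < 5, (Tied ρ (cell i (j + 1)) 0 ↔ (low (e i)).getD j 0 = 0)
  slot_entry : ∀ i ≤ K, ∀ j < 5, ∀ i' ≤ K,
    (Tied ρ (cell i (j + 1)) (cell i' 0) ↔ (low (e i)).getD j 0 = e i')
  flag_entry : ∀ i ≤ K, (Tied ρ (cell i 6) 0 ↔ e i ∉ sat)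
  flag_par : Tied ρ 11 0 ↔ r ∉ sat

/-- Lists are read as rows of slots padded with 0, which is never the number of a vertex. -/
theorem mem_iff_getD {l : List ℕ} {m : ℕ} (hl : l.length ≤ m) {y : ℕ} (hy : y ≠ 0) :
    y ∈ l ↔ ∃ j < m, l.getD j 0 = y := by
  constructor
  · intro h
    obtain ⟨j, hj, rfl⟩ := List.getElem_of_mem h
    exact ⟨j, by omega, by simp [hj]⟩
  · rintro ⟨j, -, rfl⟩
    by_cases hj : j < l.length
    · simp [hj]
    · exact (hy (List.getD_eq_default _ _ (not_lt.1 hj))).elim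

theorem le_foldr_max_iff {l : List ℕ} {m c : ℕ} (hl : l.length ≤ m) (hc : 0 < c) :
    c ≤ l.foldr max 0 ↔ ∃ j < m, c ≤ l.getD j 0 := by
  constructor
  · intro h
    obtain ⟨j, hj, hy⟩ := (mem_iff_getD hl (by omega)).1 (foldr_max_mem (l := l) (by omega))
    exact ⟨j, hj, by omega⟩
  · rintro ⟨j, hj, h⟩
    exact h.trans (le_foldr_max ((mem_iff_getD hl (by omega)).2 ⟨j, hj, rfl⟩))

/-- Since `p` fails at the padding value 0, the run also ends correctly where the list does. -/
theorem length_takeWhile_iff {p : ℕ → Bool} (h0 : p 0 = false) {l : List ℕ} {k : ℕ} :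
    ((∀ i < k, p (l.getD i 0) = true) ∧ p (l.getD k 0) = false) ↔ k = (l.takeWhile p).length := by
  induction l generalizing k with
  | nil =>
    constructor
    · rintro ⟨h1, -⟩
      by_contra h
      have := h1 0 (by simp at h; omega)
      simp [h0] at this
    · rintro rfl; simp [h0]
  | cons a t ih =>
    rcases k with _ | k
    · cases ha : p a <;> simp [ha]
    · cases ha : p a
      · simp only [List.takeWhile_cons, ha]
        constructor
        · rintro ⟨h1, -⟩
          have := h1 0 (by omega)
          simp [ha] at this
        · intro h; simp at h
      · simp only [List.takeWhile_cons, ha, if_true, List.length_cons, Nat.add_right_cancel_iff,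
          ← ih, List.getD_cons_succ]
        refine and_congr_left fun _ => ⟨fun h i hi => ?_, fun h i hi => ?_⟩
        · simpa using h (i + 1) (by omega)
        · rcases i with _ | i
          · simpa using ha
          · simpa using h i (by omega)

/-! ### The order of the registers determines the peeling step -/

section Decision

set_option linter.unusedSectionVars false

variable {V : Type*} {B : SimpleGraph V} {n K c : ℕ} {low : ℕ → List ℕ} {G : SimpleGraph ℕ}
  {St : List ℕ} {sat : Set ℕ} {ρ : ℕ → ℕ → Prop}

variable (hG : DfsResult B n low G) (h : PeelInv G (maxLow low) c St sat) (hc : 0 < c)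
  (hshort : ∀ d ∈ c :: St, (low d).length ≤ 5)
  (hρ : Reads K low sat c (maxLow low c) (fun i => (c :: St).getD i 0) ρ)

include hG in
theorem DfsResult.low_zero : low 0 = [] :=
  List.eq_nil_iff_forall_not_mem.2 fun y hy => by
    have := ((hG.mem_low 0 y).1 hy).2
    omega

include hG in
theorem DfsResult.pos_of_mem_low {x y : ℕ} (hy : y ∈ low x) : 0 < y :=
  hG.numbering.pos ((hG.mem_low x y).1 hy).1.symm

include hG hshort in
theorem length_low_entry_le (i : ℕ) : (low ((c :: St).getD i 0)).length ≤ 5 := by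
  by_cases hi : i < (c :: St).length
  · refine hshort _ ?_
    rw [List.getD_eq_getElem _ _ hi]
    exact List.getElem_mem hi
  · rw [List.getD_eq_default _ _ (not_lt.1 hi), hG.low_zero]
    simp

include hG hc hshort hρ

/-- The parent is the largest smaller neighbour, so it is at least `c` exactly if some slot is; by
`hshort` five slots hold the whole list. -/
theorem inSeg_iff {i : ℕ} (hi : i ≤ K) : InSeg ρ i ↔ c ≤ (maxLow low) ((c :: St).getD i 0) := by
  rw [InSeg, maxLow, le_foldr_max_iff (length_low_entry_le hG hshort i) hc]
  refine exists_congr fun j => and_congr_right fun hj => ?_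
  rw [hρ.slot_lt i hi j hj, not_lt]

theorem isSegLength_iff {k : ℕ} :
    IsSegLength ρ K k ↔ k = (c :: segTail (maxLow low) c St).length ∧ k ≤ K := by
  have h0 : decide (c ≤ (maxLow low) 0) = false := by simp [maxLow, hG.low_zero, hc.ne']
  rcases k with _ | k
  · simp [IsSegLength]
  rw [List.length_cons, Nat.add_right_cancel_iff, segTail,
    ← length_takeWhile_iff (p := fun x => decide (c ≤ (maxLow low) x)) h0, IsSegLength]
  constructor
  · rintro ⟨-, h1, h2, h3⟩
    rw [inSeg_iff hG hc hshort hρ h1] at h3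
    refine ⟨⟨fun i hi => ?_, by simpa using h3⟩, h1⟩
    have := h2 (i + 1) (by omega) (by omega)
    rw [inSeg_iff hG hc hshort hρ (by omega)] at this
    simpa using this
  · rintro ⟨⟨h1, h2⟩, h3⟩
    refine ⟨by omega, h3, fun i hi hik => ?_, ?_⟩
    · obtain ⟨i, rfl⟩ : ∃ i', i = i' + 1 := ⟨i - 1, by omega⟩
      rw [inSeg_iff hG hc hshort hρ (by omega)]
      simpa using h1 i (by omega)
    · rw [inSeg_iff hG hc hshort hρ h3]
      simpa using h2

omit hG hc hshort hρ in
theorem mem_seg_iff_exists {par : ℕ → ℕ} {x : ℕ} : x ∈ c :: segTail par c St ↔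
    ∃ i < (c :: segTail par c St).length, (c :: St).getD i 0 = x := by
  have : ∀ i < (c :: segTail par c St).length,
      (c :: St).getD i 0 = (c :: segTail par c St).getD i 0 := by
    intro i hi
    conv_lhs => rw [← List.takeWhile_append_dropWhile (p := fun x => decide (c ≤ par x)) (l := St),
      ← List.cons_append]
    exact List.getD_append _ _ _ _ hi
  constructor
  · intro h
    obtain ⟨i, hi, hx⟩ := List.getElem_of_mem h
    refine ⟨i, hi, ?_⟩
    rw [this i hi, List.getD_eq_getElem _ _ hi, hx]
  · rintro ⟨i, hi, rfl⟩
    rw [this i hi, List.getD_eq_getElem _ _ hi]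
    exact List.getElem_mem hi

include h

theorem le_of_mem_seg {x : ℕ} (hx : x ∈ c :: segTail (maxLow low) c St) : c ≤ x := by
  rcases List.mem_cons.1 hx with rfl | hx
  · exact le_rfl
  · exact (h.lt x ((List.takeWhile_sublist _).subset hx)).le

variable {k : ℕ} (hk : k = (c :: segTail (maxLow low) c St).length) (hkK : k ≤ K)
include hk hkK

theorem isClosedSeg_iff : IsClosedSeg ρ k ↔
    ∀ x ∈ c :: segTail (maxLow low) c St, ∀ y, G.Adj x y → y < c → y = (maxLow low) c := by
  constructor
  · intro hcl x hx y hxy hyc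
    have hcx := le_of_mem_seg hG h hc hshort hρ hx
    obtain ⟨i, hi, rfl⟩ := mem_seg_iff_exists.1 hx
    have hy0 := hG.numbering.pos hxy.symm
    have hy := (hG.mem_low _ y).2 ⟨hxy, by omega⟩
    obtain ⟨j, hj, rfl⟩ := (mem_iff_getD (length_low_entry_le hG hshort i) (by omega)).1 hy
    rcases hcl i (by omega) j hj ((hρ.slot_lt i (by omega) j hj).2 hyc) with h1 | h1
    · exact (hρ.slot_par i (by omega) j hj).1 h1
    · have := (hρ.slot_zero i (by omega) j hj).1 h1
      omega
  · intro hcl i hi j hj hlt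
    rw [hρ.slot_par i (by omega) j hj, hρ.slot_zero i (by omega) j hj]
    rw [hρ.slot_lt i (by omega) j hj] at hlt
    by_cases h0 : (low ((c :: St).getD i 0)).getD j 0 = 0
    · exact Or.inr h0
    · refine Or.inl (hcl ((c :: St).getD i 0) (mem_seg_iff_exists.2 ⟨i, by omega, rfl⟩) _ ?_ hlt)
      exact ((hG.mem_low _ _).1 ((mem_iff_getD (length_low_entry_le hG hshort i) h0).2
        ⟨j, hj, rfl⟩)).1

omit hG h hc hshort hρ hk hkK in
/-- The vertices of the piece. -/
def pieceVal (low : ℕ → List ℕ) (c : ℕ) (St : List ℕ) : ℕ → ℕ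
  | 0 => maxLow low c
  | i + 1 => (c :: St).getD i 0

theorem pieceVal_succ_mem {i : ℕ} (hi : i < k) :
    pieceVal low c St (i + 1) ∈ c :: segTail (maxLow low) c St :=
  mem_seg_iff_exists.2 ⟨i, by omega, rfl⟩

theorem parent_lt : (maxLow low) c < c := by
  have := hG.numbering.par_le c
  omega

theorem pieceVal_eq_parent_iff (a : Fin (k + 1)) : pieceVal low c St a = (maxLow low) c ↔ a = 0 := by
  obtain ⟨_ | i, hi⟩ := a
  · simp [pieceVal]
  · have h1 := parent_lt hG h hc hshort hρ hk hkK
    have h2 := le_of_mem_seg hG h hc hshort hρ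
      (pieceVal_succ_mem hG h hc hshort hρ hk hkK (Nat.lt_of_succ_lt_succ hi))
    simp only [Fin.ext_iff, Fin.val_zero]
    omega

theorem pieceVal_injective : Function.Injective fun a : Fin (k + 1) => pieceVal low c St a := by
  have hlen : ∀ {i}, i + 1 < k + 1 → i < (c :: St).length := fun hi => by
    have : (segTail (maxLow low) c St).length ≤ St.length := (List.takeWhile_sublist _).length_le
    simp only [List.length_cons] at hk ⊢
    omega
  have hnd : (c :: St).Nodup :=
    List.nodup_cons.2 ⟨fun hm => (h.lt c hm).false, h.sorted.imp fun h => ne_of_lt h⟩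
  intro a b hab
  dsimp only at hab
  by_cases ha : a = 0
  · rw [(pieceVal_eq_parent_iff hG h hc hshort hρ hk hkK a).2 ha, eq_comm,
      pieceVal_eq_parent_iff hG h hc hshort hρ hk hkK b] at hab
    rw [ha, hab]
  · by_cases hb : b = 0
    · rw [(pieceVal_eq_parent_iff hG h hc hshort hρ hk hkK b).2 hb,
        pieceVal_eq_parent_iff hG h hc hshort hρ hk hkK a] at hab
      exact (ha hab).elim
    · obtain ⟨_ | i, hi⟩ := a
      · exact (ha rfl).elim
      obtain ⟨_ | j, hj⟩ := b
      · exact (hb rfl).elim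
      simp only [pieceVal, List.getD_eq_getElem _ _ (hlen hi),
        List.getD_eq_getElem _ _ (hlen hj)] at hab
      have := hnd.getElem_inj_iff.1 hab
      exact Fin.ext (by simpa using this)

theorem pieceRel_iff (a b : Fin (k + 1)) :
    (∃ i, (a : ℕ) = i + 1 ∧ ∃ j < 5, Tied ρ (cell i (j + 1)) (pieceReg b) ∧
      ¬ Tied ρ (cell i (j + 1)) 0) ↔
    a ≠ 0 ∧ pieceVal low c St b ∈ low (pieceVal low c St a) := by
  obtain ⟨_ | i, hi⟩ := a
  · simp
  · have hi' : i ≤ K := by omega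
    have hb : ∀ j < 5, Tied ρ (cell i (j + 1)) (pieceReg b) ↔
        (low ((c :: St).getD i 0)).getD j 0 = pieceVal low c St b := by
      intro j hj
      obtain ⟨_ | i', hib⟩ := b
      · exact hρ.slot_par i hi' j hj
      · exact hρ.slot_entry i hi' j hj i' (by omega)
    have hl := length_low_entry_le hG hshort i
    constructor
    · rintro ⟨i', he, j, hj, h1, h2⟩
      obtain rfl : i = i' := by simpa using he
      rw [hb j hj] at h1
      rw [hρ.slot_zero i hi' j hj] at h2
      refine ⟨by simp [Fin.ext_iff], ?_⟩
      rw [h1] at h2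
      exact (mem_iff_getD hl h2).2 ⟨j, hj, h1⟩
    · rintro ⟨-, hm⟩
      have h0 := (hG.pos_of_mem_low hm).ne'
      obtain ⟨j, hj, hjb⟩ := (mem_iff_getD hl h0).1 hm
      refine ⟨i, rfl, j, hj, (hb j hj).2 hjb, ?_⟩
      rw [hρ.slot_zero i hi' j hj]
      rw [hjb]
      exact h0

/-- An edge of the piece is listed at its larger end, which is never the parent, so the slots of the
entries show all edges. Up to isolated vertices, `pieceVal` identifies the two graphs. -/
theorem good_piece_iff (X : Set ℕ) : Good (PeelInv.piece G (maxLow low) c St) X ↔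
    Good (pieceGraph ρ k) {a : Fin (k + 1) | pieceVal low c St a ∈ X} := by
  have hmem : ∀ a : Fin (k + 1),
      pieceVal low c St a ∈ {x | x ∈ c :: segTail (maxLow low) c St} ∪ {(maxLow low) c} := by
    rintro ⟨_ | i, hi⟩
    · exact Or.inr rfl
    · exact Or.inl (pieceVal_succ_mem hG h hc hshort hρ hk hkK (Nat.lt_of_succ_lt_succ hi))
  have hval := pieceVal_injective hG h hc hshort hρ hk hkK
  refine good_iff_of_image (fun a : Fin (k + 1) => pieceVal low c St a) hval
    (fun a b => ?_) (fun u v huv => ?_) X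
  · rw [PeelInv.piece, restrictTo_adj, pieceGraph, SimpleGraph.fromRel_adj,
      pieceRel_iff hG h hc hshort hρ hk hkK, pieceRel_iff hG h hc hshort hρ hk hkK]
    have key : ∀ a b : Fin (k + 1), G.Adj (pieceVal low c St a) (pieceVal low c St b) →
        pieceVal low c St b < pieceVal low c St a →
        a ≠ 0 ∧ pieceVal low c St b ∈ low (pieceVal low c St a) := by
      intro a b hab hlt
      refine ⟨?_, (hG.mem_low _ _).2 ⟨hab, hlt⟩⟩
      rintro rfl
      have h1 := parent_lt hG h hc hshort hρ hk hkK
      rcases hmem b with h2 | h2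
      · have h3 := le_of_mem_seg hG h hc hshort hρ h2
        have h4 : pieceVal low c St ((0 : Fin (k + 1)) : ℕ) = (maxLow low) c := rfl
        omega
      · exact hlt.ne h2
    constructor
    · rintro ⟨h1, -, -⟩
      refine ⟨fun e => h1.ne (by rw [e]), ?_⟩
      rcases lt_or_gt_of_ne h1.ne with hlt | hlt
      · exact Or.inr (key b a h1.symm hlt)
      · exact Or.inl (key a b h1 hlt)
    · rintro ⟨-, ⟨-, h1⟩ | ⟨-, h1⟩⟩
      · exact ⟨((hG.mem_low _ _).1 h1).1, hmem a, hmem b⟩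
      · exact ⟨((hG.mem_low _ _).1 h1).1.symm, hmem a, hmem b⟩
  · rcases (restrictTo_adj.1 huv).2.1 with h1 | h1
    · obtain ⟨i, hi, rfl⟩ := mem_seg_iff_exists.1 h1
      exact ⟨⟨i + 1, by omega⟩, rfl⟩
    · exact ⟨0, h1.symm⟩

theorem pieceSat_eq : pieceSat ρ k = {a : Fin (k + 1) | pieceVal low c St a ∈ sat} := by
  ext ⟨_ | i, hi⟩
  · exact (not_congr hρ.flag_par).trans not_not
  · exact (not_congr (hρ.flag_entry i (by omega))).trans not_not

theorem pieceSat_union_eq :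
    pieceSat ρ k ∪ {0} = {a : Fin (k + 1) | pieceVal low c St a ∈ sat ∪ {(maxLow low) c}} := by
  rw [pieceSat_eq hG h hc hshort hρ hk hkK]
  ext a
  have := pieceVal_eq_parent_iff hG h hc hshort hρ hk hkK a
  simp only [Set.mem_union, Set.mem_ofPred_eq, Set.mem_singleton_iff] at this ⊢
  rw [this]

omit hk hkK

/-- The possible outcomes of the decision are correct. -/
theorem peelAction_cases (hK : segBound ≤ K) :
    (peelAction K ρ = .halt false ∧ ¬ Good G ∅) ∨
    (peelAction K ρ = .skip ∧ PeelInv G (maxLow low) (c - 1) (c :: St) sat) ∨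
    ∃ k ≤ K, segRest (maxLow low) c St = (c :: St).drop k ∧
      ((peelAction K ρ = .copy 7 (cell k 0) ∧ PeelInv G (maxLow low) (c - 1) (segRest (maxLow low) c St) sat) ∨
      (peelAction K ρ = .seq (.copy 7 (cell k 0)) (.seq (.const 13 1) (.store 10 10 13)) ∧
        PeelInv G (maxLow low) (c - 1) (segRest (maxLow low) c St) (sat ∪ {(maxLow low) c}))) := by
  classical
  by_cases hex : ∃ k, IsSegLength ρ K k
  · obtain ⟨hk, hkK⟩ := (isSegLength_iff hG hc hshort hρ).1 hex.choose_spec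
    have hact : peelAction K ρ = if IsClosedSeg ρ hex.choose then
      if Good (pieceGraph ρ hex.choose) (pieceSat ρ hex.choose ∪ {0}) then
        .copy 7 (cell hex.choose 0)
      else if Good (pieceGraph ρ hex.choose) (pieceSat ρ hex.choose) then
        .seq (.copy 7 (cell hex.choose 0)) (.seq (.const 13 1) (.store 10 10 13))
      else .halt false
    else .skip := by rw [peelAction, dif_pos hex]
    generalize hex.choose = k at hk hkK hact
    have hdrop : segRest (maxLow low) c St = (c :: St).drop k := by
      conv_rhs => rw [← List.takeWhile_append_dropWhile (p := fun x => decide (c ≤ (maxLow low) x)) (l := St),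
        ← List.cons_append, hk]
      exact List.drop_left.symm
    rw [hact]
    by_cases hcl : IsClosedSeg ρ k
    · have hcl' := (isClosedSeg_iff hG h hc hshort hρ hk hkK).1 hcl
      rw [if_pos hcl, pieceSat_union_eq hG h hc hshort hρ hk hkK,
        ← good_piece_iff hG h hc hshort hρ hk hkK, pieceSat_eq hG h hc hshort hρ hk hkK,
        ← good_piece_iff hG h hc hshort hρ hk hkK]
      by_cases h1 : Good (PeelInv.piece G (maxLow low) c St) (sat ∪ {(maxLow low) c})
      · exact Or.inr (Or.inr ⟨k, hkK, hdrop, Or.inl ⟨if_pos h1, h.pop hG.numbering hc hcl' h1⟩⟩)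
      · rw [if_neg h1]
        by_cases h2 : Good (PeelInv.piece G (maxLow low) c St) sat
        · exact Or.inr (Or.inr ⟨k, hkK, hdrop, Or.inr ⟨if_pos h2,
            h.pop_saturate hG.numbering hc hcl' h2 h1⟩⟩)
        · exact Or.inl ⟨if_neg h2, fun hg => h2 (h.good_piece hG.numbering hc hcl' hg)⟩
    · rw [if_neg hcl]
      refine Or.inr (Or.inl ⟨rfl, h.push hG.numbering hc ?_⟩)
      rw [isClosedSeg_iff hG h hc hshort hρ hk hkK] at hcl
      push Not at hcl
      exact hcl
  · refine Or.inl ⟨by rw [peelAction, dif_neg hex], fun hg =>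
      hex ⟨(c :: segTail (maxLow low) c St).length, ?_⟩⟩
    exact (isSegLength_iff hG hc hshort hρ).2
      ⟨rfl, (h.length_le hG.numbering hc hg).trans hK⟩

end Decision

/-! ### The program for the peeling procedure -/

/-- The list `l` of nonzero numbers, linked by `f` from `top` on. -/
def LinkedList (f : ℕ → ℕ) : ℕ → List ℕ → Prop
  | top, [] => top = 0
  | top, d :: l => top = d ∧ LinkedList f (f d) l

theorem LinkedList.congr {f g : ℕ → ℕ} {l : List ℕ} (hfg : ∀ x ∈ l, f x = g x) :
    ∀ {top}, LinkedList f top l → LinkedList g top l := by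
  induction l with
  | nil => exact fun h => h
  | cons t l ih =>
    rintro top ⟨h1, h2⟩
    refine ⟨h1, ?_⟩
    rw [← hfg t List.mem_cons_self]
    exact ih (fun x hx => hfg x (List.mem_cons_of_mem _ hx)) h2

/-- As `f` fixes 0, following the links beyond the end yields the padding value, so a fixed number
of entries can always be loaded. -/
theorem LinkedList.iterate {f : ℕ → ℕ} (h0 : f 0 = 0) (i : ℕ) {l : List ℕ} :
    ∀ {top}, LinkedList f top l → f^[i] top = l.getD i 0 ∧ LinkedList f (f^[i] top) (l.drop i) := by
  induction i generalizing l with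
  | zero =>
    intro top h
    rcases l with _ | ⟨d, l⟩
    · exact ⟨h, h⟩
    · exact ⟨h.1, h⟩
  | succ i ih =>
    intro top h
    rw [Function.iterate_succ_apply]
    rcases l with _ | ⟨d, l⟩
    · have h1 : top = 0 := h
      rw [h1, h0]
      simpa using ih (l := []) (top := 0) rfl
    · obtain ⟨rfl, h2⟩ := h
      simpa using ih h2

open Code in
/-- Load the stack entry in register `r` and what is known about it. -/
def loadEntry (r i : ℕ) : Code :=
  .seq (copy (cell i 0) r) <| .seq (load (cell i 1) 4 (cell i 0)) <|
  .seq (load (cell i 2) 5 (cell i 0)) <| .seq (load (cell i 3) 6 (cell i 0)) <|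
  .seq (load (cell i 4) 7 (cell i 0)) <| .seq (load (cell i 5) 8 (cell i 0)) <|
  .seq (load (cell i 6) 10 (cell i 0)) (load (cell i 7) 11 (cell i 0))

/-- Load the topmost stack entries. -/
def loadEntries : ℕ → Code
  | 0 => loadEntry 7 0
  | k + 1 => .seq (loadEntries k) (loadEntry (cell k 7) (k + 1))

def maxStep (j : ℕ) : Code := .ifLt 10 (cell 0 j) (.copy 10 (cell 0 j)) .skip

/-- Compute the parent of the top entry. -/
def parentCode : Code :=
  .seq (.copy 10 (cell 0 1)) <| .seq (maxStep 2) <| .seq (maxStep 3) <| .seq (maxStep 4) (maxStep 5)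

/-- Compare registers, and go on as the outcome requires. -/
def decisionTree : List (ℕ × ℕ) → ((ℕ × ℕ → Prop) → Code) → Code
  | [], f => f fun _ => False
  | p :: l, f => .ifLt p.1 p.2 (decisionTree l fun ρ => f fun q => q = p ∨ ρ q)
      (decisionTree l fun ρ => f fun q => q ≠ p ∧ ρ q)

/-- The number of registers in use when `K + 1` stack entries are loaded. -/
def numRegs (K : ℕ) : ℕ := cell (K + 1) 0

open Code in
/-- One step of the peeling procedure. -/
noncomputable def peelBody (K : ℕ) : Code :=
  .seq (load 10 9 6) <| .ifEq 10 0
    (.seq (store 11 6 7) <| .seq (copy 7 6) <| .seq (loadEntries K) <| .seq parentCode <|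
      .seq (load 11 10 10) <|
      .seq (decisionTree (List.range (numRegs K) ×ˢ List.range (numRegs K))
        fun ρ => peelAction K fun a b => ρ (a, b)) (dec 6))
    (halt false)

/-! ### Effect of the building blocks of the peeling program -/

section Wp

variable {n N : ℕ} {s : Store} {H : Bool → Prop}

theorem arraySize_eq {a : ℕ} (h1 : 1 ≤ a) (h2 : a < 12) : arraySize n N a = n + 1 := by
  rw [arraySize, if_neg (by omega), if_pos h2]

/-- The registers of the `i`-th entry hold what is known about `x`. -/
structure EntryLoaded (s : Store) (i x : ℕ) : Prop where
  entry : s.reg (cell i 0) = x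
  slot : ∀ j < 5, s.reg (cell i (j + 1)) = s.arr (4 + j) x
  flag : s.reg (cell i 6) = s.arr 10 x
  next : s.reg (cell i 7) = s.arr 11 x

theorem wp_loadEntry {r i : ℕ} (hr : s.reg r ≤ n) (Q : Store → Prop)
    (hQ : ∀ s' : Store, s'.arr = s.arr →
      (∀ q, q < cell i 0 ∨ cell (i + 1) 0 ≤ q → s'.reg q = s.reg q) →
      EntryLoaded s' i (s.reg r) → Q s') :
    (loadEntry r i).wp (arraySize n N) H Q s := by
  simp only [loadEntry, Code.wp]
  refine ⟨?_, ?_, ?_, ?_, ?_, ?_, ?_, hQ _ rfl ?_ ⟨?_, ?_, ?_, ?_⟩⟩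
  any_goals (simp [cell, arraySize_eq]; omega)
  · intro q hq
    simp only [cell] at hq ⊢
    simp only [Store.setReg_reg]
    repeat rw [if_neg (by omega)]
  · simp [cell]
  · intro j hj
    interval_cases j <;> simp [cell]
  · simp [cell]
  · simp [cell]

theorem wp_loadEntries (Q : Store → Prop) (k : ℕ)
    (hle : ∀ i ≤ k, (s.arr 11)^[i] (s.reg 7) ≤ n)
    (hQ : ∀ s' : Store, s'.arr = s.arr → (∀ q < 40, s'.reg q = s.reg q) →
      (∀ i ≤ k, EntryLoaded s' i ((s.arr 11)^[i] (s.reg 7))) → Q s') :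
    (loadEntries k).wp (arraySize n N) H Q s := by
  induction k generalizing Q with
  | zero =>
    refine wp_loadEntry (hle 0 le_rfl) Q fun s' h1 h2 h3 => hQ s' h1 (fun q hq => h2 q (Or.inl ?_)) ?_
    · simp only [cell]; omega
    · intro i hi
      obtain rfl : i = 0 := by omega
      exact h3
  | succ k ih =>
    refine ih _ (fun i hi => hle i (by omega)) fun s₁ h1 h2 h3 => ?_
    have hnext : s₁.reg (cell k 7) = (s.arr 11)^[k + 1] (s.reg 7) := by
      rw [(h3 k le_rfl).next, h1, Function.iterate_succ_apply']
    refine wp_loadEntry (by rw [hnext]; exact hle _ le_rfl) Q fun s' h4 h5 h6 => ?_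
    refine hQ s' (h4.trans h1) (fun q hq => ?_) fun i hi => ?_
    · rw [h5 q (Or.inl (by simp only [cell]; omega)), h2 q hq]
    · rcases hi.eq_or_lt with rfl | hi
      · rw [hnext] at h6
        exact h6
      · have h7 := h3 i (by omega)
        have h8 : ∀ j < 8, s'.reg (cell i j) = s₁.reg (cell i j) := fun j hj =>
          h5 _ (Or.inl (by simp only [cell]; omega))
        exact ⟨by rw [h8 0 (by omega), h7.entry],
          fun j hj => by rw [h8 _ (by omega), h7.slot j hj, h4],
          by rw [h8 6 (by omega), h7.flag, h4], by rw [h8 7 (by omega), h7.next, h4]⟩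

theorem wp_maxStep {j : ℕ} {sz : ℕ → ℕ} (Q : Store → Prop)
    (hQ : Q (s.setReg 10 (max (s.reg 10) (s.reg (cell 0 j))))) : (maxStep j).wp sz H Q s := by
  simp only [maxStep, Code.wp]
  constructor
  · intro h; rwa [max_eq_right h.le] at hQ
  · intro h
    rw [max_eq_left h] at hQ
    simpa [Store.setReg] using hQ

theorem wp_parentCode {sz : ℕ → ℕ} (Q : Store → Prop) {l : List ℕ} (hl : l.length ≤ 5)
    (hs : ∀ j < 5, s.reg (cell 0 (j + 1)) = l.getD j 0)
    (hQ : Q (s.setReg 10 (l.foldr max 0))) : parentCode.wp sz H Q s := by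
  simp only [parentCode, Code.wp]
  refine wp_maxStep _ (wp_maxStep _ (wp_maxStep _ (wp_maxStep _ ?_)))
  convert hQ using 1
  simp only [Store.setReg, Function.update_idem, Function.update_self]
  congr 2
  have h2 : ∀ j v, Function.update s.reg 10 v (cell 0 j) = s.reg (cell 0 j) :=
    fun j v => by simp [cell, show 40 + j ≠ 10 by omega]
  simp only [h2]
  rw [hs 0 (by omega), hs 1 (by omega), hs 2 (by omega), hs 3 (by omega), hs 4 (by omega)]
  rcases l with _ | ⟨a, _ | ⟨b, _ | ⟨c, _ | ⟨d, _ | ⟨e, _ | ⟨f, l⟩⟩⟩⟩⟩⟩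
  · simp
  · simp
  · simp
  · simp [max_assoc]
  · simp [max_assoc]
  · simp [max_assoc]
  · simp at hl; omega

/-- At the leaf that is reached, the recorded relation is the true order of the registers on the
pairs in `l`, so only the code at this leaf matters. -/
theorem wp_decisionTree {sz : ℕ → ℕ} (Q : Store → Prop) (l : List (ℕ × ℕ))
    (f : (ℕ × ℕ → Prop) → Code)
    (h : (f fun q => q ∈ l ∧ s.reg q.1 < s.reg q.2).wp sz H Q s) :
    (decisionTree l f).wp sz H Q s := by
  induction l generalizing f with
  | nil => simpa [decisionTree] using h
  | cons p l ih =>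
    rw [decisionTree, Code.wp]
    have hcongr : ∀ ρ : ℕ × ℕ → Prop, (∀ q, ρ q ↔ q ∈ p :: l ∧ s.reg q.1 < s.reg q.2) →
        (f ρ).wp sz H Q s := fun ρ hρ => by
      rwa [show ρ = fun q => q ∈ p :: l ∧ s.reg q.1 < s.reg q.2 from funext fun q => propext (hρ q)]
    refine ⟨fun hlt => ih _ (hcongr _ fun q => ?_), fun hge => ih _ (hcongr _ fun q => ?_)⟩
    · rw [List.mem_cons]
      constructor
      · rintro (rfl | h)
        · exact ⟨Or.inl rfl, hlt⟩
        · exact ⟨Or.inr h.1, h.2⟩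
      · rintro ⟨rfl | h1, h2⟩
        · exact Or.inl rfl
        · exact Or.inr ⟨h1, h2⟩
    · rw [List.mem_cons]
      constructor
      · rintro ⟨-, h⟩
        exact ⟨Or.inr h.1, h.2⟩
      · rintro ⟨h1, h2⟩
        have hne : q ≠ p := by rintro rfl; omega
        exact ⟨hne, h1.resolve_left hne, h2⟩

end Wp

/-! ### The program carries out the peeling procedure -/

section Peel

variable {V : Type*} {B : SimpleGraph V} {n N K : ℕ} {low : ℕ → List ℕ} {G : SimpleGraph ℕ}
  {s : Store} {H : Bool → Prop}

/-- The store holds the state of the peeling procedure. -/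
structure PeelRel (n : ℕ) (low : ℕ → List ℕ) (c : ℕ) (St : List ℕ) (sat : Set ℕ) (s : Store) :
    Prop where
  reg0 : s.reg 0 = 0
  reg6 : s.reg 6 = c
  le : c ≤ n
  stk : LinkedList (s.arr 11) (s.reg 7) St
  nil : s.arr 11 0 = 0
  slot : ∀ j < 6, ∀ k, s.arr (4 + j) k = (low k).getD j 0
  sat : ∀ x, s.arr 10 x = 0 ↔ x ∉ sat
  short : ∀ d ∈ St, (low d).length ≤ 5
  le_of_mem : ∀ d ∈ St, d ≤ n

def PeelLoopInv (n : ℕ) (low : ℕ → List ℕ) (G : SimpleGraph ℕ) (m : ℕ) (s : Store) : Prop :=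
  ∃ St sat, PeelInv G (maxLow low) m St sat ∧ PeelRel n low m St sat s

theorem wp_peelBody (hG : DfsResult B n low G) (hK : segBound ≤ K) {m : ℕ}
    (h : PeelLoopInv n low G m s) (hlt : s.reg 0 < s.reg 6) :
    (peelBody K).wp (arraySize n N) (fun b => b = true ↔ Good G ∅)
      (fun s' => ∃ m' < m, PeelLoopInv n low G m' s') s := by
  obtain ⟨St, sat, hP, hs⟩ := h
  have hc : 0 < m := by rw [← hs.reg6, ← hs.reg0]; exact hlt
  have hle := hs.le
  have r6 := hs.reg6
  have r0 := hs.reg0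
  have hslot5 : s.arr 9 m = (low m).getD 5 0 := hs.slot 5 (by omega) m
  rw [peelBody, Code.wp, Code.wp]
  refine ⟨by rw [arraySize_eq (by omega) (by omega), r6]; omega, ?_⟩
  rw [Code.wp]
  constructor
  swap
  -- A nonempty sixth slot means six smaller neighbours, one more than a good graph allows.
  · intro h5
    have h6 : (low m).getD 5 0 ≠ 0 := by
      rw [← hslot5]
      simpa [r6, r0] using h5
    simp only [Code.wp, Bool.false_eq_true, false_iff]
    intro hg
    have := hP.up_card_le hG.numbering hc hg (low m).toFinset fun y hy =>
      (hG.mem_low m y).1 (List.mem_toFinset.1 hy)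
    rw [List.toFinset_card_of_nodup (hG.low_nodup m)] at this
    exact h6 (List.getD_eq_default _ _ (by omega))
  intro h5
  have hshort : ∀ d ∈ m :: St, (low d).length ≤ 5 := by
    intro d hd
    rcases List.mem_cons.1 hd with rfl | hd
    · have h6 : (low d).getD 5 0 = 0 := by
        rw [← hslot5]
        simpa [r6, r0] using h5
      by_contra hlen
      rw [List.getD_eq_getElem _ _ (by omega)] at h6
      have := hG.pos_of_mem_low (List.getElem_mem (l := low d) (n := 5) (by omega))
      omega
    · exact hs.short d hd
  have hlen : ∀ d ∈ m :: St, d ≤ n := by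
    intro d hd
    rcases List.mem_cons.1 hd with rfl | hd
    · exact hle
    · exact hs.le_of_mem d hd
  rw [Code.wp, Code.wp]
  refine ⟨by rw [arraySize_eq (by omega) (by omega)]; simp [r6]; omega, ?_⟩
  rw [Code.wp, Code.wp]
  -- The current vertex is linked on top of the stack before the decision. A push then needs no
  -- action, and a removal only resets the top.
  set s₁ := ((s.setReg 10 (s.arr 9 (s.reg 6))).setArr 11 ((s.setReg 10 (s.arr 9 (s.reg 6))).reg 6)
    ((s.setReg 10 (s.arr 9 (s.reg 6))).reg 7)) with hs₁
  set s₂ := s₁.setReg 7 (s₁.reg 6) with hs₂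
  have a11 : ∀ x, s₂.arr 11 x = if x = m then s.reg 7 else s.arr 11 x := by
    intro x; simp [hs₂, hs₁, Store.setArr_arr, r6]
  have aother : ∀ a, a ≠ 11 → s₂.arr a = s.arr a := by
    intro a ha; simp [hs₂, hs₁, Store.setArr, ha]
  have hnil : s₂.arr 11 0 = 0 := by rw [a11, if_neg hc.ne, hs.nil]
  have r7 : s₂.reg 7 = m := by simp [hs₂, hs₁, r6]
  have r6' : s₂.reg 6 = m := by simp [hs₂, hs₁, r6]
  have r0' : s₂.reg 0 = 0 := by simp [hs₂, hs₁, r0]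
  have hlink : LinkedList (s₂.arr 11) (s₂.reg 7) (m :: St) := by
    refine ⟨r7, ?_⟩
    rw [a11, if_pos rfl]
    refine hs.stk.congr fun x hx => ?_
    rw [a11, if_neg]
    rintro rfl
    exact (hP.lt x hx).false
  have hiter := fun i => hlink.iterate hnil i
  have hgetD : ∀ i, (m :: St).getD i 0 ≤ n := by
    intro i
    by_cases hi : i < (m :: St).length
    · rw [List.getD_eq_getElem _ _ hi]; exact hlen _ (List.getElem_mem hi)
    · rw [List.getD_eq_default _ _ (not_lt.1 hi)]; omega
  rw [Code.wp]
  refine wp_loadEntries _ K (fun i _ => by rw [(hiter i).1]; exact hgetD i) ?_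
  intro s₃ h3a h3r h3e
  simp only [(hiter _).1] at h3e
  rw [Code.wp]
  have hslot : ∀ i ≤ K, ∀ j < 5,
      s₃.reg (cell i (j + 1)) = (low ((m :: St).getD i 0)).getD j 0 := by
    intro i hi j hj
    rw [(h3e i hi).slot j hj, h3a, aother _ (by omega), hs.slot j (by omega)]
  refine wp_parentCode _ (length_low_entry_le hG hshort 0) (hslot 0 (by omega)) ?_
  rw [Code.wp, Code.wp]
  have hpar : maxLow low m ≤ n := by
    have := hG.numbering.par_le m
    omega
  have e0 : (low ((m :: St).getD 0 0)).foldr max 0 = maxLow low m := rfl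
  rw [e0]
  refine ⟨by rw [arraySize_eq (by omega) (by omega)]; simp; omega, ?_⟩
  rw [Code.wp]
  set s₄ := (s₃.setReg 10 (maxLow low m)).setReg 11
    ((s₃.setReg 10 (maxLow low m)).arr 10 ((s₃.setReg 10 (maxLow low m)).reg 10)) with hs₄
  have h4cell : ∀ i j, s₄.reg (cell i j) = s₃.reg (cell i j) := by
    intro i j
    simp [hs₄, cell, show 40 + 8 * i + j ≠ 10 by omega, show 40 + 8 * i + j ≠ 11 by omega]
  have h4a : s₄.arr = s₂.arr := h3a
  have h4r : ∀ q < 10, s₄.reg q = s₂.reg q := by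
    intro q hq
    rw [← h3r q (by omega)]
    simp [hs₄, show q ≠ 10 by omega, show q ≠ 11 by omega]
  have h4r10 : s₄.reg 10 = maxLow low m := by simp [hs₄]
  have h4r11 : s₄.reg 11 = s.arr 10 (maxLow low m) := by simp [hs₄, h3a, aother]
  have h40 : s₄.reg 0 = 0 := by rw [h4r 0 (by omega), r0']
  refine wp_decisionTree _ _ _ ?_
  set ρ : ℕ → ℕ → Prop := fun a b =>
    (a, b) ∈ (List.range (numRegs K) ×ˢ List.range (numRegs K)) ∧ s₄.reg a < s₄.reg b with hρdef
  have hρ : ∀ a b, a < numRegs K → b < numRegs K → (ρ a b ↔ s₄.reg a < s₄.reg b) := by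
    intro a b ha hb
    simp only [hρdef, List.mem_product, List.mem_range, and_iff_right_iff_imp]
    exact fun _ => ⟨ha, hb⟩
  have htied : ∀ a b, a < numRegs K → b < numRegs K → (Tied ρ a b ↔ s₄.reg a = s₄.reg b) := by
    intro a b ha hb
    rw [Tied, hρ a b ha hb, hρ b a hb ha]
    omega
  have hcell : ∀ i ≤ K, ∀ j < 8, cell i j < numRegs K := by
    intro i hi j hj
    simp only [numRegs, cell]
    omega
  have hlow : ∀ q < 40, q < numRegs K := by
    intro q hq
    simp only [numRegs, cell]
    omega
  have hreads : Reads K low sat m (maxLow low m) (fun i => (m :: St).getD i 0) ρ := by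
    constructor
    · intro i hi j hj
      rw [hρ _ _ (hcell i hi _ (by omega)) (hcell 0 (by omega) 0 (by omega)), h4cell, h4cell,
        hslot i hi j hj, (h3e 0 (by omega)).entry]
      rfl
    · intro i hi j hj
      rw [htied _ _ (hcell i hi _ (by omega)) (hlow 10 (by omega)), h4cell, hslot i hi j hj, h4r10]
    · intro i hi j hj
      rw [htied _ _ (hcell i hi _ (by omega)) (hlow 0 (by omega)), h4cell, hslot i hi j hj, h40]
    · intro i hi j hj i' hi'
      rw [htied _ _ (hcell i hi _ (by omega)) (hcell i' hi' 0 (by omega)), h4cell, h4cell,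
        hslot i hi j hj, (h3e i' hi').entry]
    · intro i hi
      rw [htied _ _ (hcell i hi 6 (by omega)) (hlow 0 (by omega)), h4cell, (h3e i hi).flag, h40,
        h3a, aother 10 (by omega), hs.sat]
    · rw [htied _ _ (hlow 11 (by omega)) (hlow 0 (by omega)), h4r11, h40, hs.sat]
  -- what the store has to satisfy after the decision
  have hfinal : ∀ (St' : List ℕ) (sat' : Set ℕ) (s₅ : Store),
      PeelInv G (maxLow low) (m - 1) St' sat' → s₅.reg 0 = 0 → s₅.reg 6 = m →
      LinkedList (s₅.arr 11) (s₅.reg 7) St' → (∀ a, a ≠ 10 → s₅.arr a = s₂.arr a) →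
      (∀ x, s₅.arr 10 x = 0 ↔ x ∉ sat') → (∀ d ∈ St', d ∈ m :: St) →
      (Code.dec 6).wp (arraySize n N) (fun b => b = true ↔ Good G ∅)
        (fun s' => ∃ m' < m, PeelLoopInv n low G m' s') s₅ := by
    intro St' sat' s₅ h1 h2 h3 h4 h5 h6 h7
    refine ⟨m - 1, by omega, St', sat', h1, ?_⟩
    refine ⟨by simp [h2], by simp [h3], by omega, by simpa using h4, ?_, ?_, by simpa using h6,
      fun d hd => hshort d (h7 d hd), fun d hd => hlen d (h7 d hd)⟩
    · rw [Store.setReg_arr, h5 11 (by omega), hnil]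
    · intro j hj k
      rw [Store.setReg_arr, h5 _ (by omega), aother _ (by omega), hs.slot j hj]
  have hsat : ∀ x, s₄.arr 10 x = 0 ↔ x ∉ sat := by
    intro x; rw [h4a, aother 10 (by omega), hs.sat]
  have h46 : s₄.reg 6 = m := by rw [h4r 6 (by omega), r6']
  rcases peelAction_cases hG hP hc hshort hreads hK with ⟨ha, hn⟩ | ⟨ha, hI⟩ | ⟨k, hkK, hdrop, hk⟩
  · rw [ha]
    simpa using hn
  · rw [ha]
    refine hfinal _ _ s₄ hI h40 h46 ?_ (fun a _ => by rw [h4a]) hsat fun d hd => hd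
    rw [h4a, h4r 7 (by omega)]
    exact hlink
  -- Entry `k`, the first outside the subtree, becomes the new top; it reads as 0 if the stack ends
  -- there.
  · have htop : LinkedList (s₂.arr 11) (s₄.reg (cell k 0)) (segRest (maxLow low) m St) := by
      rw [h4cell, (h3e k hkK).entry, ← (hiter k).1, hdrop]
      exact (hiter k).2
    have hmem : ∀ d ∈ segRest (maxLow low) m St, d ∈ m :: St := fun d hd =>
      List.mem_cons_of_mem _ ((List.dropWhile_sublist _).subset hd)
    rcases hk with ⟨ha, hI⟩ | ⟨ha, hI⟩
    · rw [ha, Code.wp]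
      refine hfinal _ _ _ hI (by simp [h40]) (by simp [h46]) ?_ (fun a _ => by simp [h4a])
        (by simpa using hsat) hmem
      simpa [h4a] using htop
    · rw [ha]
      simp only [Code.wp]
      refine ⟨by rw [arraySize_eq (by omega) (by omega)]; simp [h4r10]; omega, ?_⟩
      refine hfinal _ _ _ hI (by simp [h40]) (by simp [h46]) ?_ ?_ ?_ hmem
      · simpa [h4a, Store.setArr] using htop
      · intro a ha
        simp [h4a, Store.setArr, ha]
      · intro x
        rw [Store.setArr_arr]
        by_cases hx : x = maxLow low m
        · simp [hx, h4r10]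
        · simpa [hx, h4r10] using hsat x

end Peel

/-! ### The input -/

theorem getElem?_flatMap_of_take {α β : Type*} (f : α → List β) {l : List α} {v i : ℕ}
    (hv : v < l.length) (hi : i < (f l[v]).length) :
    (l.flatMap f)[((l.take v).map fun a => (f a).length).sum + i]? = (f l[v])[i]? := by
  induction l generalizing v with
  | nil => simp at hv
  | cons a l ih =>
    rcases v with _ | v
    · simp only [List.getElem_cons_zero] at hi
      simp [List.flatMap_cons, List.getElem?_append_left hi]
    · simp only [List.length_cons, Nat.add_lt_add_iff_right] at hv
      simp only [List.getElem_cons_succ] at hi ⊢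
      rw [List.take_succ_cons, List.map_cons, List.sum_cons, List.flatMap_cons, add_assoc,
        List.getElem?_append_right (by omega), Nat.add_sub_cancel_left]
      exact ih hv hi

section Input

variable {n : ℕ} {B : SimpleGraph (Fin n)} {adj : Fin n → List (Fin n)}

/-- The adjacency lists as lists of natural numbers. -/
def natLists (adj : Fin n → List (Fin n)) (v : ℕ) : List ℕ :=
  if h : v < n then (adj ⟨v, h⟩).map Fin.val else []

theorem natLists_fin (v : Fin n) : natLists adj v = (adj v).map Fin.val := by
  simp [natLists]

theorem mem_natLists {v w : ℕ} :
    w ∈ natLists adj v ↔ ∃ (hv : v < n) (hw : w < n), (⟨w, hw⟩ : Fin n) ∈ adj ⟨v, hv⟩ := by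
  rw [natLists]
  split_ifs with hv
  · simp only [List.mem_map, hv, exists_true_left]
    constructor
    · rintro ⟨a, ha, rfl⟩; exact ⟨a.2, ha⟩
    · rintro ⟨hw, h⟩; exact ⟨_, h, rfl⟩
  · simp [hv]

theorem IsAdjLists.adj_iff (hadj : IsAdjLists B adj) (u v : Fin n) :
    B.Adj u v ↔ (v : ℕ) ∈ natLists adj u := by
  rw [mem_natLists]
  simp [(hadj u).2 v]

theorem IsAdjLists.adjFamily (hadj : IsAdjLists B adj) : AdjFamily n (natLists adj) where
  nodup v := by
    rw [natLists]
    split_ifs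
    · exact (hadj _).1.map Fin.val_injective
    · exact List.nodup_nil
  symm h := by
    obtain ⟨hv, hw, h⟩ := mem_natLists.1 h
    exact mem_natLists.2 ⟨hw, hv, ((hadj _).2 _).2 (((hadj _).2 _).1 h).symm⟩
  lt h := (mem_natLists.1 h).2.1
  irrefl v h := by
    obtain ⟨hv, hw, h⟩ := mem_natLists.1 h
    exact (((hadj _).2 _).1 h).ne rfl

/-- The contents of the memory cells. -/
def inputCell (adj : Fin n → List (Fin n)) (a : ℕ) : ℕ := (encodeAdjLists adj).getD a 0

theorem inputCell_succ {k : ℕ} (hk : k ≤ n) : inputCell adj (k + 1) =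
    n + 2 + (((List.finRange n).take k).map fun v => (adj v).length).sum := by
  simp only [inputCell, encodeAdjLists, List.cons_append, List.getD_cons_succ]
  rw [List.getD_append _ _ _ _ (by simp; omega), List.getD_eq_getElem _ _ (by simp; omega)]
  simp

theorem length_encodeAdjLists : (encodeAdjLists adj).length = inputCell adj (n + 1) := by
  rw [inputCell_succ le_rfl, List.take_of_length_le (by simp)]
  simp [encodeAdjLists, List.length_flatMap]
  omega

theorem inputCell_eq_zero {a : ℕ} (ha : inputCell adj (n + 1) ≤ a) : inputCell adj a = 0 :=
  List.getD_eq_default _ _ (by rwa [length_encodeAdjLists])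

theorem inputCell_start_succ {v : ℕ} (hv : v < n) :
    inputCell adj (v + 2) = inputCell adj (v + 1) + (natLists adj v).length := by
  rw [inputCell_succ hv, inputCell_succ hv.le, List.take_add_one]
  simp [natLists, hv, add_assoc]

theorem holdsLists : HoldsLists n (natLists adj) (inputCell adj) where
  zero := rfl
  start_succ v hv := inputCell_start_succ hv
  get v hv i hi := by
    have h1 : i < (adj ⟨v, hv⟩).length := by simpa [natLists, hv] using hi
    have h2 := getElem?_flatMap_of_take (fun v => (adj v).map Fin.val) (l := List.finRange n)
      (v := v) (i := i) (by simpa using hv) (by simpa using h1)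
    simp only [List.length_map, List.getElem_finRange, Fin.cast_mk] at h2
    have h3 : (natLists adj v)[i]? = ((adj ⟨v, hv⟩).map Fin.val)[i]? := by simp [natLists, hv]
    rw [h3, ← h2, inputCell_succ hv.le, inputCell, encodeAdjLists, List.cons_append,
      show n + 2 + (((List.finRange n).take v).map fun v => (adj v).length).sum + i =
        (n + 1 + ((((List.finRange n).take v).map fun v => (adj v).length).sum + i)) + 1 by omega,
      List.getD_cons_succ, List.getD_append_right _ _ _ _ (by simp)]
    rw [List.getD_eq_getElem?_getD]
    simp only [List.length_map, List.length_range, Nat.add_sub_cancel_left]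
    rw [h2]
    have h4 : i < ((adj ⟨v, hv⟩).map Fin.val).length := by simpa using h1
    rw [List.getElem?_eq_getElem h4]
    rfl
  start_le v hv := by
    have : ∀ k, v + k ≤ n → inputCell adj (v + 1) ≤ inputCell adj (v + k + 1) := by
      intro k
      induction k with
      | zero => exact fun _ => le_rfl
      | succ k ih =>
        intro hk
        have := inputCell_start_succ (adj := adj) (v := v + k) (by omega)
        rw [show v + (k + 1) + 1 = v + k + 2 by omega, this]
        exact (ih (by omega)).trans (Nat.le_add_right _ _)
    have h := this (n - v) (by omega)
    rwa [show v + (n - v) = n by omega] at h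
  le_end := by
    rw [inputCell_succ le_rfl]
    omega

theorem sum_length_natLists :
    n + 2 + ∑ v ∈ Finset.range n, (natLists adj v).length = inputCell adj (n + 1) := by
  rw [inputCell_succ le_rfl, List.take_of_length_le (by simp), Finset.sum_range]
  simp only [natLists_fin, List.length_map]
  rw [← List.sum_ofFn, List.ofFn_eq_map]

/-- A good graph has degree sum at most `3 * n - 2`, to which the header adds `n + 2` cells. This
bound is what makes the running time linear in `n`. -/
theorem Good.inputCell_le (hadj : IsAdjLists B adj) (hn : 1 ≤ n) (h : Good B ∅) :
    inputCell adj (n + 1) ≤ 4 * (n + 1) := by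
  classical
  have h1 := h.2.card_edges hn id Function.injective_id B.edgeFinset fun a b hab => by
    simpa using hab
  have h2 := B.sum_degrees_eq_twice_card_edges
  have h3 : ∀ v, B.degree v = (natLists adj v).length := by
    intro v
    rw [natLists_fin, List.length_map, ← List.toFinset_card_of_nodup (hadj v).1,
      ← B.card_neighborFinset_eq_degree]
    congr 1
    ext w
    simp [(hadj v).2 w]
  have h4 := sum_length_natLists (adj := adj)
  rw [Finset.sum_range] at h4
  simp only [h3] at h2
  omega

end Input

/-! ### The whole program -/

/-- Increment the registers in the list. -/
def incAll : List ℕ → Code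
  | [] => .skip
  | r :: l => .seq (.inc r) (incAll l)

theorem wp_incAll {sz : ℕ → ℕ} {H : Bool → Prop} {Q : Store → Prop} (l : List ℕ) {s : Store}
    (hQ : Q ⟨fun r => s.reg r + l.count r, s.arr⟩) : (incAll l).wp sz H Q s := by
  induction l generalizing s with
  | nil => exact hQ
  | cons a l ih =>
    refine ih ?_
    convert hQ using 2
    · funext r
      by_cases hr : r = a
      · subst hr; simp; omega
      · simp [hr, List.count_cons_of_ne (Ne.symm hr)]
    · rfl

/-- Copy register `3` to the registers in the list. -/
def copyAll : List ℕ → Code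
  | [] => .skip
  | r :: l => .seq (.copy r 3) (copyAll l)

theorem wp_copyAll {sz : ℕ → ℕ} {H : Bool → Prop} {Q : Store → Prop} (l : List ℕ) (hl : 3 ∉ l)
    {s : Store} (hQ : Q ⟨fun r => if r ∈ l then s.reg 3 else s.reg r, s.arr⟩) :
    (copyAll l).wp sz H Q s := by
  induction l generalizing s with
  | nil => simpa [copyAll] using hQ
  | cons a l ih =>
    rw [List.mem_cons, not_or] at hl
    refine ih hl.2 ?_
    convert hQ using 2
    · funext r
      by_cases hr : r = a
      · subst hr; simp [hl.1]
      · simp [hr, hl.1]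
    · rfl

/-- The registers that are incremented in a round of the loop that computes the addresses. -/
def addressIncs : List ℕ :=
  -- Without multiplication, multiples of `n + 1` are counted up in `n + 1` rounds: register `4`
  -- counts the rounds, register `5` reaches the edge bound `4 * (n + 1)`, and register `20 + k`,
  -- for `k ≥ 1`, gains `k - 1` per round on top of the input length, which gives the address of
  -- array `k`.
  4 :: List.replicate 4 5 ++ (List.range 12).flatMap fun k => List.replicate (k - 1) (20 + k)

open Code in
/-- Compute the addresses of the arrays, and reject if there are too many edges. -/
def setupProg : Prog :=
  .seq (.code (.seq (load 1 0 0) <| .seq (copy 2 1) <| .seq (inc 2) <| .seq (load 3 0 2) <|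
    copyAll ((List.range 11).map (21 + ·)))) <|
  .seq (.loop 4 2 (incAll addressIncs)) (.code (.ifLt 5 3 (halt false) skip))

/-- The instructions that put the addresses of the arrays in place. -/
def moveBases : List RamInstr := (List.range 12).map fun k => .copy k (20 + k + 12)

open Code in
noncomputable def mainProg (K : ℕ) : Prog :=
  .seq (.code (.seq (const 5 0) <| .seq (const 6 0) <| .seq (const 7 0) (const 8 1))) <|
  .seq (.loop 0 8 dfsBody) <| .seq (.code (copy 6 1)) <| .seq (.loop 0 6 (peelBody K))
  (.code (halt true))

/-- The program that recognizes the m-decyclable distance-hereditary graphs. -/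
noncomputable def recognizer (K : ℕ) : List RamInstr :=
  setupProg.compile 0 ++ moveBases ++ (mainProg K).compile (setupProg.size + 12)

/-! ### Correctness and running time of the whole program -/

section Main

variable {n : ℕ} {B : SimpleGraph (Fin n)} {adj : Fin n → List (Fin n)}

/-- The whole memory as one array. -/
def flatLayout (N : ℕ) : Layout where
  base _ := 0
  size a := if a = 0 then N else 0
  lt_of_size {a i} h := by
    by_contra h'
    rw [if_neg (by omega)] at h
    omega
  disjoint {a i a' i'} h h' e := by
    split_ifs at h h' with h1 h2
    · omega
    all_goals omega

def arrayBase (n N a : ℕ) : ℕ := if a = 0 then 0 else N + (n + 1) * (a - 1)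

/-- The input, followed by eleven arrays of size `n + 1`. -/
def arrayLayout (n N : ℕ) : Layout where
  base := arrayBase n N
  size := arraySize n N
  lt_of_size {a i} h := by
    by_contra h'
    rw [arraySize, if_neg (by omega), if_neg h'] at h
    omega
  disjoint {a i a' i'} h h' e := by
    have key : ∀ {a i}, i < arraySize n N a →
        (a = 0 ∧ i < N ∧ arrayBase n N a = 0) ∨
        ∃ b, a = b + 1 ∧ i < n + 1 ∧ arrayBase n N a = N + (n + 1) * b := by
      intro a i h
      rw [arraySize] at h
      rcases a with _ | a
      · exact Or.inl ⟨rfl, by simpa using h, rfl⟩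
      · rw [if_neg (by omega)] at h
        split_ifs at h with h2
        · exact Or.inr ⟨a, rfl, h, by simp [arrayBase]⟩
        · omega
    rcases key h with ⟨h1, h2, h3⟩ | ⟨b, h1, h2, h3⟩ <;>
      rcases key h' with ⟨h4, h5, h6⟩ | ⟨b', h4, h5, h6⟩ <;> rw [h3, h6] at e
    · omega
    · omega
    · omega
    · have hbb : b = b' := by
        have e1 : (i + (n + 1) * b) / (n + 1) = (i' + (n + 1) * b') / (n + 1) := by
          congr 1; omega
        rwa [Nat.add_mul_div_left _ _ (by omega), Nat.add_mul_div_left _ _ (by omega),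
          Nat.div_eq_of_lt h2, Nat.div_eq_of_lt h5, zero_add, zero_add] at e1
      subst hbb
      omega

/-- The state after the computation of the addresses. -/
structure SetupDone (n : ℕ) (inp : ℕ → ℕ) (s : Store) : Prop where
  reg0 : s.reg 0 = 0
  reg1 : s.reg 1 = n
  base : ∀ a < 12, s.reg (20 + a) = arrayBase n (inp (n + 1)) a
  arr0 : s.arr 0 = inp
  le : inp (n + 1) ≤ 4 * (n + 1)

def setupTime (n : ℕ) : ℕ := 15 + (((incAll addressIncs).size + 2) * (n + 2) + 2 + 3)

theorem spec_setupProg (hadj : IsAdjLists B adj) (hn : 1 ≤ n) {N : ℕ}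
    (hN : inputCell adj (n + 1) ≤ N) :
    Prog.Spec (flatLayout N).size (fun b => b = true ↔ Good B ∅)
      (fun s => (∀ r, s.reg r = 0) ∧ s.arr 0 = inputCell adj) setupProg (setupTime n)
      (SetupDone n (inputCell adj)) := by
  have hI := holdsLists (adj := adj)
  have hle := hI.le_end
  refine Prog.Spec.seq (T := 15) (Q' := fun s => s.reg 0 = 0 ∧ s.reg 1 = n ∧ s.reg 2 = n + 1 ∧
      s.reg 3 = inputCell adj (n + 1) ∧ s.reg 4 = 0 ∧ s.reg 5 = 0 ∧ s.reg 20 = 0 ∧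
      (∀ k < 11, s.reg (21 + k) = inputCell adj (n + 1)) ∧ s.arr 0 = inputCell adj)
    (Prog.Spec.code fun s hs => ?_) (Prog.Spec.seq
    (Q' := fun s => s.reg 0 = 0 ∧ s.reg 1 = n ∧ s.reg 3 = inputCell adj (n + 1) ∧
      s.reg 5 = 4 * (n + 1) ∧ s.reg 20 = 0 ∧
      (∀ k < 11, s.reg (21 + k) = inputCell adj (n + 1) + (n + 1) * k) ∧ s.arr 0 = inputCell adj)
    (Prog.Spec.loop (fun m s => ∃ i, m + i = n + 1 ∧ s.reg 0 = 0 ∧ s.reg 1 = n ∧ s.reg 2 = n + 1 ∧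
      s.reg 3 = inputCell adj (n + 1) ∧ s.reg 4 = i ∧ s.reg 5 = 4 * i ∧ s.reg 20 = 0 ∧
      (∀ k < 11, s.reg (21 + k) = inputCell adj (n + 1) + i * k) ∧ s.arr 0 = inputCell adj) (n + 1)
      (fun s hs => ?_) (fun m s hs hlt => ?_) (fun m s hs hge => ?_))
    (Prog.Spec.code fun s hs => ?_))
  · obtain ⟨h1, h2⟩ := hs
    have hz := hI.zero
    simp only [Code.wp, flatLayout]
    refine ⟨by simp [h1]; omega, by simp [h1, h2, hz]; omega, wp_copyAll _ (by decide) ?_⟩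
    have hm : ∀ r, r ∈ (List.range 11).map (21 + ·) ↔ 21 ≤ r ∧ r < 32 := fun r => by
      simp only [List.mem_map, List.mem_range]
      exact ⟨by rintro ⟨k, hk, rfl⟩; omega, fun hr => ⟨r - 21, by omega, by omega⟩⟩
    simp only [hm]
    refine ⟨by simp [h1], by simp [h1, h2, hz], by simp [h1, h2, hz], by simp [h1, h2, hz],
      by simp [h1], by simp [h1], by simp [h1], fun k hk => ?_, by simpa using h2⟩
    rw [if_pos (by omega)]
    simp [h1, h2, hz]
  · obtain ⟨h0, h1, h2, h3, h4, h5, h6, h7, h8⟩ := hs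
    exact ⟨n + 1, le_rfl, 0, by omega, h0, h1, h2, h3, h4, h5, h6, by simpa using h7, h8⟩
  · obtain ⟨i, hi, h0, h1, h2, h3, h4, h5, h6, h7, h8⟩ := hs
    rw [h4, h2] at hlt
    refine wp_incAll _ ⟨m - 1, by omega, i + 1, by omega, ?_⟩
    have c0 : addressIncs.count 0 = 0 := by decide
    have c1 : addressIncs.count 1 = 0 := by decide
    have c2 : addressIncs.count 2 = 0 := by decide
    have c3 : addressIncs.count 3 = 0 := by decide
    have c4 : addressIncs.count 4 = 1 := by decide
    have c5 : addressIncs.count 5 = 4 := by decide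
    have c20 : addressIncs.count 20 = 0 := by decide
    have ck : ∀ k < 11, addressIncs.count (21 + k) = k := by decide
    refine ⟨?_, ?_, ?_, ?_, ?_, ?_, ?_, fun k hk => ?_, h8⟩ <;> dsimp only
    · rw [h0, c0]
    · rw [h1, c1, add_zero]
    · rw [h2, c2]
    · rw [h3, c3, add_zero]
    · rw [h4, c4]
    · rw [h5, c5]; ring
    · rw [h6, c20]
    · rw [h7 k hk, ck k hk]; ring
  · obtain ⟨i, hi, h0, h1, h2, h3, h4, h5, h6, h7, h8⟩ := hs
    rw [h4, h2] at hge
    obtain rfl : i = n + 1 := by omega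
    exact ⟨h0, h1, h3, h5, h6, h7, h8⟩
  · obtain ⟨h0, h1, h3, h5, h6, h7, h8⟩ := hs
    simp only [Code.wp]
    rw [h5, h3]
    refine ⟨fun hlt => ?_, fun hge => ⟨h0, h1, fun a ha => ?_, h8, hge⟩⟩
    · simp only [Bool.false_eq_true, false_iff]
      intro hg
      have := hg.inputCell_le hadj hn
      omega
    · rcases a with _ | a
      · exact h6
      · rw [arrayBase, if_neg (by omega), show 20 + (a + 1) = 21 + a by omega, h7 a (by omega)]
        simp

/-- The search starts with measure at most `10 * n + 9`: an input of at most `4 * (n + 1)` cells has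
at most `3 * n + 2` list entries, and roots and entries count twice. -/
def mainTime (n d p : ℕ) : ℕ :=
  4 + ((d + 2) * (10 * n + 9 + 1) + 2 + (1 + ((p + 2) * (n + 1) + 2 + 1)))

/-- The postcondition is `False` because the program always halts: it rejects within the peeling
loop, or accepts once the loop has ended with no edges left. -/
theorem spec_mainProg (hadj : IsAdjLists B adj) {K : ℕ} (hK : segBound ≤ K)
    (hle : inputCell adj (n + 1) ≤ 4 * (n + 1)) :
    Prog.Spec (arraySize n (inputCell adj (n + 1))) (fun b => b = true ↔ Good B ∅)
      (fun s => s.reg 0 = 0 ∧ s.reg 1 = n ∧ s.arr 0 = inputCell adj ∧ ∀ a, a ≠ 0 → ∀ i, s.arr a i = 0)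
      (mainProg K) (mainTime n dfsBody.size (peelBody K).size) (fun _ => False) := by
  have hI := holdsLists (adj := adj)
  have hnb := hadj.adjFamily
  refine Prog.Spec.seq (T := 4)
    (Q' := fun s => ∃ m ≤ 10 * n + 9, DfsLoopInv n (natLists adj) (inputCell adj) m s)
    (Prog.Spec.code fun s hs => ?_) (Prog.Spec.seq
    (Q' := fun s => ∃ d, DfsInv n (natLists adj) d ∧ DfsRel n (inputCell adj) d s ∧ d.stk = [] ∧
      d.root = n)
    (Prog.Spec.loop (DfsLoopInv n (natLists adj) (inputCell adj)) _ (fun s hs => hs)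
      (fun m s hs hlt => wp_dfsBody hnb hI rfl hs hlt) (fun m s hs hge => ?_)) (Prog.Spec.seq (T := 1)
    (Q' := fun s => ∃ low G, DfsResult B n low G ∧ PeelLoopInv n low G n s)
    (Prog.Spec.code fun s hs => ?_) (Prog.Spec.seq (Q' := fun _ => Good B ∅)
    (Prog.Spec.loop (fun m s => ∃ low G, DfsResult B n low G ∧ PeelLoopInv n low G m s) n
      (fun s hs => ⟨n, le_rfl, hs⟩) (fun m s hs hlt => ?_) (fun m s hs hge => ?_))
    (Prog.Spec.code fun s hs => ?_))))
  · obtain ⟨h0, h1, h2, h3⟩ := hs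
    refine ⟨_, ?_, _, DfsInv.start, ?_, Or.inl ⟨by simp, rfl⟩⟩
    · have := sum_length_natLists (adj := adj)
      simp only [DfsState.potential, Nat.sub_zero, List.length_nil]
      omega
    · refine ⟨by simp [h0], by simp [h1], by simp, by simp, by simp [h2], by simp [h3], by simp,
        by simp [LinkedStack], fun j hj k => ?_, by simp [h3], by simp [h3]⟩
      simpa using h3 (4 + j) (by omega) k
  · obtain ⟨d, hd, hs, ⟨h8, -⟩ | ⟨-, h1, h2⟩⟩ := hs
    · rw [hs.reg0, h8] at hge
      omega
    · exact ⟨d, hd, hs, h1, h2⟩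
  · obtain ⟨d, hd, hs, hstk, hroot⟩ := hs
    obtain ⟨G, hG⟩ := hd.result hnb hstk hroot B hadj.adj_iff
    refine ⟨d.low, G, hG, [], ∅, PeelInv.start hG.adj_le, ?_⟩
    have h7 : s.reg 7 = 0 := by
      have := hs.stk
      rwa [hstk] at this
    exact ⟨by simp [hs.reg0], by simp [hs.reg1], le_rfl, by simpa [LinkedList] using h7,
      by simp [hs.arr11], by simpa using hs.slot, by simp [hs.arr10], by simp, by simp⟩
  · obtain ⟨low, G, hG, hs⟩ := hs
    -- The peeling loop answers for the numbered graph, which is good exactly if the input graph is.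
    have hH : (fun b : Bool => b = true ↔ Good B ∅) = fun b => b = true ↔ Good G ∅ := by
      rw [hG.good_iff]
    rw [hH]
    exact Code.wp_mono (wp_peelBody hG hK hs hlt) fun s' ⟨m', hm', h⟩ => ⟨m', hm', low, G, hG, h⟩
  · obtain ⟨low, G, hG, St, sat, hP, hs⟩ := hs
    rw [hs.reg6, hs.reg0] at hge
    exact hG.good_iff.2 (hP.finish hG.numbering (by omega))
  · simpa using hs

/-- The sources are registers from `32` on, so no copy destroys a later source. Structured code
cannot do this, as its registers start at `12`. -/
theorem reach_moveBases {P : List RamInstr} {o : ℕ} (hP : CodeAt P o moveBases) {c : RamConfig}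
    (hpc : c.pc = o) : Reach P 12 c fun c' => c'.pc = o + 12 ∧ c'.mem = c.mem ∧
      (∀ k < 12, c'.reg k = c.reg (20 + k + 12)) ∧ ∀ r, 12 ≤ r → c'.reg r = c.reg r := by
  have key : ∀ m ≤ 12, ((ramStep P)^[m] c).pc = o + m ∧ ((ramStep P)^[m] c).mem = c.mem ∧
      (∀ k < m, ((ramStep P)^[m] c).reg k = c.reg (20 + k + 12)) ∧
      ∀ r, m ≤ r → ((ramStep P)^[m] c).reg r = c.reg r := by
    intro m
    induction m with
    | zero => exact fun _ => ⟨hpc, rfl, by omega, fun _ _ => rfl⟩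
    | succ m ih =>
      intro hm
      obtain ⟨h1, h2, h3, h4⟩ := ih (by omega)
      have hx : P[o + m]? = some (.copy m (20 + m + 12)) :=
        hP m _ (by simp [moveBases, List.getElem?_range (show m < 12 by omega)])
      rw [Function.iterate_succ_apply', ramStep_of (by rw [h1]; exact hx)]
      dsimp only
      refine ⟨by omega, h2, fun k hk => ?_, fun r hr => ?_⟩
      · by_cases e : k = m
        · rw [e, Function.update_self, h4 _ (by omega)]
        · rw [Function.update_of_ne e, h3 k (by omega)]
      · rw [Function.update_of_ne (by omega), h4 r (by omega)]
  obtain ⟨h1, h2, h3, h4⟩ := key 12 le_rfl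
  exact ⟨12, le_rfl, h1, h2, h3, h4⟩

theorem reach_recognizer (hadj : IsAdjLists B adj) (hn : 1 ≤ n) {K : ℕ} (hK : segBound ≤ K) :
    Reach (recognizer K) (setupTime n + (12 + mainTime n dfsBody.size (peelBody K).size))
      (ramInit (encodeAdjLists adj))
      fun c => ∃ b, (recognizer K)[c.pc]? = some (.halt b) ∧ (b = true ↔ Good B ∅) := by
  have hP : CodeAt (recognizer K) 0 (recognizer K) := fun i x hx => by rwa [zero_add]
  have hP1 := hP.append_left.append_left
  have hP2 := hP.append_left.append_right
  have hP3 := hP.append_right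
  rw [Prog.length_compile, zero_add] at hP2
  rw [zero_add, List.length_append, Prog.length_compile] at hP3
  set N := inputCell adj (n + 1) with hN
  have hsetup := spec_setupProg hadj hn (N := N + 11 * (n + 1)) (by omega) (recognizer K) _ 0
    (ramInit (encodeAdjLists adj)) ⟨fun _ => 0, fun _ => inputCell adj⟩ rfl hP1
    ⟨fun _ => rfl, fun _ _ => rfl, fun {a i} _ => by simp [flatLayout, ramInit, inputCell]⟩ rfl
    ⟨fun _ => rfl, rfl⟩
  refine hsetup.trans fun c hc => ?_
  rcases hc with ⟨hpc, s, hs, hQ⟩ | hc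
  swap
  · exact .refl hc
  rw [zero_add] at hpc
  refine (reach_moveBases hP2 hpc).trans fun c' ⟨hpc', hmem, hbase, hreg⟩ => ?_
  -- The memory seen so far as one array is now read in parts. All cells behind the input are still
  -- 0, so the eleven working arrays start out as zero.
  have hrep : Represents (arrayLayout n N) c'
      ⟨s.reg, fun a i => if a = 0 then inputCell adj i else 0⟩ := by
    refine ⟨fun r => ?_, fun a ha => ?_, fun {a i} hi => ?_⟩
    · rw [hreg _ (by omega), hs.reg]
    · rw [hbase a ha, hs.reg, hQ.base a ha]
      rfl
    · have h1 : ∀ j < N + 11 * (n + 1), c'.mem j = inputCell adj j := by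
        intro j hj
        have := hs.arr (a := 0) (i := j) hj
        rw [hmem, ← hQ.arr0, ← this]
        simp [flatLayout]
      have ha := (arrayLayout n N).lt_of_size hi
      change i < arraySize n N a at hi
      change c'.mem (arrayBase n N a + i) = if a = 0 then inputCell adj i else 0
      rw [arraySize] at hi
      by_cases h0 : a = 0
      · rw [if_pos h0] at hi
        rw [arrayBase, if_pos h0, if_pos h0, zero_add, h1 i (by omega)]
      · rw [if_neg h0, if_pos ha] at hi
        have h2 : (n + 1) * (a - 1) ≤ (n + 1) * 10 := Nat.mul_le_mul_left _ (by omega)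
        rw [arrayBase, if_neg h0, if_neg h0, h1 _ (by omega), inputCell_eq_zero (by omega)]
  refine (spec_mainProg hadj hK hQ.le (recognizer K) (arrayLayout n N) _ c' _ rfl hP3 hrep hpc'
    ⟨hQ.reg0, hQ.reg1, by simp, fun a ha i => if_neg ha⟩).mono le_rfl fun c'' hc'' => ?_
  rcases hc'' with ⟨-, -, -, h⟩ | h
  · exact h.elim
  · exact h

end Main

/-- The total time is affine in `n` with nonnegative coefficients, so for `n ≥ 1` it is at most `n`
times its value at 1. -/
theorem setupTime_add_mainTime_le (n d p : ℕ) (hn : 1 ≤ n) :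
    setupTime n + (12 + mainTime n d p) ≤ (setupTime 1 + (12 + mainTime 1 d p)) * n := by
  obtain ⟨m, rfl⟩ : ∃ m, n = m + 1 := ⟨n - 1, by omega⟩
  simp only [setupTime, mainTime]
  generalize (incAll addressIncs).size = a
  nlinarith [Nat.zero_le (a * m), Nat.zero_le (d * m), Nat.zero_le (p * m), Nat.zero_le m]

theorem theorem8 :
    ∃ (P : List RamInstr) (c : ℕ), ∀ (n : ℕ), 1 ≤ n →
      ∀ (G : SimpleGraph (Fin n)) (adj : Fin n → List (Fin n)), IsAdjLists G adj →
        ∃ b : Bool, RamHaltsWith P (encodeAdjLists adj) (c * n) b ∧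
          (b = true ↔ DistanceHereditary G ∧ MDecyclable G) := by
  refine ⟨recognizer segBound,
    setupTime 1 + (12 + mainTime 1 dfsBody.size (peelBody segBound).size), ?_⟩
  intro n hn G adj hadj
  obtain ⟨t, ht, b, hb, hgood⟩ := reach_recognizer hadj hn (K := segBound) le_rfl
  refine ⟨b, ⟨t, ht.trans (setupTime_add_mainTime_le n _ _ hn), hb⟩, ?_⟩
  rw [hgood, mDecyclable_iff_mDecAvoid]
  exact Iff.rfl
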